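/- Let $\{h_\gamma\}_{\gamma\in\Gamma}$ and $\{f_\theta\}_{\theta\in\Theta}$ be families of probability densities with respect to a common $\sigma$-finite measure $\mu$, strictly positive outside a $\mu$-null set that does not depend on the parameter, where $\Gamma$ and $\Theta$ are non-empty subsets of Euclidean spaces. $L\ge 1$ sensors observe samples $y^\ell_t$ ($\ell=1,\dots,L$, $t=1,2,\dots$), independent over time and across sensors, with common density $h_\gamma$ (law $\mathbb P_\gamma$) under the null hypothesis and $f_\theta$ (law $\mathbb P_\theta$) under the alternative. Write $D(\cdot\|\cdot)$ for the Kullback-Leibler divergence and $S(\gamma,\theta)=\log f_\theta(Y)-\log h_\gamma(Y)$ for a single sample $Y$. Assume: (A1) for some $\varepsilon>0$, $\inf_{\gamma}D(f_\theta\|h_\gamma)>\varepsilon$ for every $\theta\in\Theta$ and $\inf_\theta D(h_\gamma\|f_\theta)>\varepsilon$ for every $\gamma\in\Gamma$; (A2) $D(f_\theta\|h_\gamma)$ and $D(h_\gamma\|f_\theta)$ are finite and twice continuously differentiable in $(\gamma,\theta)\in\Gamma\times\Theta$; (A3) $\Gamma$ and $\Theta$ are compact, and in each of them any two sufficiently close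 points $x,y$ are joined by a path inside the set of length at most $C|x-y|$, for some constant $C$ (as is the case for convex sets, finite sets, and finite disjoint unions of compact convex sets); (A4) for almost every sample, $S$ is differentiable in $\theta$ on $\Theta$ and in $\gamma$ on $\Gamma$, and there are $\eta>1$ and $x_0>0$ such that for all $\gamma\in\Gamma$, $\theta\in\Theta$ and $x>x_0$, $$\mathbb P_\gamma\Big(\sup_{\theta'\in\Theta}|\nabla_{\theta}S(\gamma,\theta')|>x\Big)\le e^{-|\log x|^\eta},\qquad \mathbb P_\theta\Big(\sup_{\gamma'\in\Gamma}|\nabla_{\gamma}S(\gamma',\theta)|>x\Big)\le e^{-|\log x|^\eta}.$$ The level-triggered-sampling GSPRT with local thresholds $a,b$ and global thresholds $A,B$ is the following test. With $$\widetilde S^{t,\ell}_{k}=\sup_{\theta\in\Theta}\sum_{j=k}^t\log f_\theta(y^\ell_j)-\sup_{\gamma\in\Gamma}\sum_{j=k}^t\log h_\gamma(y^\ell_j),$$ sensor $\ell$ transmits at the times $t^\ell_0=0$, $t^\ell_n=\inf\{t>t^\ell_{n-1}:\widetilde S^{t,\ell}_{t^\ell_{n-1}+1}\notin(-b,a)\}$,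 $n\ge1$, the message $u^\ell_n=1$ if $\widetilde S^{t^\ell_n,\ell}_{t^\ell_{n-1}+1}\ge a$ and $u^\ell_n=-1$ if it is $\le -b$. With $N^\ell_t=\max\{n:t^\ell_n\le t\}$ and $$\widetilde V_t=\sum_{\ell=1}^L\sum_{n=1}^{N^\ell_t}\big(a\,\mathbb 1_{\{u^\ell_n=1\}}-b\,\mathbb 1_{\{u^\ell_n=-1\}}\big),$$ the fusion center stops at $T=\inf\{t:\widetilde V_t\notin(-B,A)\}$ and decides $\delta=1$ if $\widetilde V_T\ge A$, $\delta=0$ if $\widetilde V_T\le -B$. Theorem. In the asymptotic regime where $a,b\to\infty$, $\limsup a/b<\infty$, $\limsup b/a<\infty$, $A/a\to\infty$ and $B/b\to\infty$, the error probabilities satisfy $$\sup_{\gamma\in\Gamma}\log\mathbb P_\gamma(\delta=1)\sim -A,\qquad \sup_{\theta\in\Theta}\log\mathbb P_\theta(\delta=0)\sim -B,$$ where $x\sim y$ means $x/y\to1$. -/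

import Mathlib

open MeasureTheory Filter Topology
open scoped ENNReal NNReal

namespace LTS

noncomputable section

/-! ### The statistical model -/

/-- The law of one sample: the measure with density `q` with respect to `μ`. -/
def sampleLaw {Y : Type*} [MeasurableSpace Y] (μ : Measure Y) (q : Y → ℝ) : Measure Y :=
  μ.withDensity (fun y => ENNReal.ofReal (q y))

/-- The joint law of all samples `ω (ℓ, t)` (sensor `ℓ`, time `t`), which are independent over
time and across the `L` sensors, each with density `q`. -/
def jointLaw {Y : Type*} [MeasurableSpace Y] (L : ℕ) (μ : Measure Y) (q : Y → ℝ) :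
    Measure (Fin L × ℕ → Y) :=
  Measure.infinitePi (fun _ : Fin L × ℕ => sampleLaw μ q)

/-- `q x`, for `x` in the parameter set `K`, are probability densities with respect to `μ`,
which are strictly positive outside a `μ`-null set that does not depend on the parameter. -/
def IsDensityFamily {Y : Type*} [MeasurableSpace Y] {E : Type*} (μ : Measure Y)
    (q : E → Y → ℝ) (K : Set E) : Prop :=
  (∀ x ∈ K, Measurable (q x)) ∧
  (∀ x ∈ K, ∫⁻ y, ENNReal.ofReal (q x y) ∂μ = 1) ∧
  (∀ᵐ y ∂μ, ∀ x ∈ K, 0 < q x y)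

/-! ### Regularity conditions -/

/-- Any two sufficiently close points `x`, `y` of `K` are joined by a path in `K` of length at
most `C * dist x y` (a Lipschitz parametrization over `[0, 1]` with that constant). Convex sets,
finite sets and finite disjoint unions of compact convex sets are examples. -/
def LocallyQuasiconvex {E : Type*} [PseudoMetricSpace E] (K : Set E) : Prop :=
  ∃ (C : ℝ≥0) (r : ℝ), 0 < r ∧ ∀ x ∈ K, ∀ y ∈ K, dist x y < r →
    ∃ p : ℝ → E, p 0 = x ∧ p 1 = y ∧ (∀ s ∈ Set.Icc (0 : ℝ) 1, p s ∈ K) ∧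
      LipschitzOnWith (C * nndist x y) p (Set.Icc (0 : ℝ) 1)

/-- The two hypotheses are strictly separated in Kullback-Leibler divergence. -/
def StrictlySeparated {Y : Type*} [MeasurableSpace Y] {E F : Type*} (μ : Measure Y)
    (h : E → Y → ℝ) (f : F → Y → ℝ) (Γ : Set E) (Θ : Set F) : Prop :=
  ∃ ε : ℝ, 0 < ε ∧
    (∀ θ ∈ Θ, ENNReal.ofReal ε <
      ⨅ γ ∈ Γ, InformationTheory.klDiv (sampleLaw μ (f θ)) (sampleLaw μ (h γ))) ∧
    (∀ γ ∈ Γ, ENNReal.ofReal ε <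
      ⨅ θ ∈ Θ, InformationTheory.klDiv (sampleLaw μ (h γ)) (sampleLaw μ (f θ)))

/-- Both Kullback-Leibler divergences are finite and twice continuously differentiable in the
parameters. -/
def SmoothDivergences {Y : Type*} [MeasurableSpace Y] {E F : Type*}
    [NormedAddCommGroup E] [NormedSpace ℝ E] [NormedAddCommGroup F] [NormedSpace ℝ F]
    (μ : Measure Y) (h : E → Y → ℝ) (f : F → Y → ℝ) (Γ : Set E) (Θ : Set F) : Prop :=
  (∀ γ ∈ Γ, ∀ θ ∈ Θ,
    InformationTheory.klDiv (sampleLaw μ (f θ)) (sampleLaw μ (h γ)) ≠ ∞ ∧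
    InformationTheory.klDiv (sampleLaw μ (h γ)) (sampleLaw μ (f θ)) ≠ ∞) ∧
  ContDiffOn ℝ 2 (fun x : E × F =>
    (InformationTheory.klDiv (sampleLaw μ (f x.2)) (sampleLaw μ (h x.1))).toReal) (Γ ×ˢ Θ) ∧
  ContDiffOn ℝ 2 (fun x : E × F =>
    (InformationTheory.klDiv (sampleLaw μ (h x.1)) (sampleLaw μ (f x.2))).toReal) (Γ ×ˢ Θ)

/-- The log-likelihood ratio `S(γ, θ)` of one sample `y`. -/
def logLR {Y E F : Type*} (h : E → Y → ℝ) (f : F → Y → ℝ) (γ : E) (θ : F) (y : Y) : ℝ :=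
  Real.log (f θ y) - Real.log (h γ y)

/-- For almost every sample the log-likelihood ratio is differentiable in each parameter, and
the suprema of the norms of its gradients have tails bounded by `exp (-|log x| ^ η)`, `η > 1`,
for `x > x₀`, uniformly in the parameters. Gradients are taken within the parameter set. -/
def GradientTails {Y : Type*} [MeasurableSpace Y] {E F : Type*}
    [NormedAddCommGroup E] [InnerProductSpace ℝ E] [CompleteSpace E]
    [NormedAddCommGroup F] [InnerProductSpace ℝ F] [CompleteSpace F]
    (μ : Measure Y) (h : E → Y → ℝ) (f : F → Y → ℝ) (Γ : Set E) (Θ : Set F) : Prop :=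
  ∃ η x₀ : ℝ, 1 < η ∧ 0 < x₀ ∧
    (∀ γ ∈ Γ, ∃ G : F → Y → F,
      (∀ᵐ y ∂μ, ∀ θ ∈ Θ,
        HasGradientWithinAt (fun θ' => logLR h f γ θ' y) (G θ y) Θ θ) ∧
      ∀ x : ℝ, x₀ < x →
        sampleLaw μ (h γ) {y | ENNReal.ofReal x < ⨆ θ ∈ Θ, ‖G θ y‖ₑ} ≤
          ENNReal.ofReal (Real.exp (-(|Real.log x| ^ η)))) ∧
    (∀ θ ∈ Θ, ∃ G : E → Y → E,
      (∀ᵐ y ∂μ, ∀ γ ∈ Γ,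
        HasGradientWithinAt (fun γ' => logLR h f γ' θ y) (G γ y) Γ γ) ∧
      ∀ x : ℝ, x₀ < x →
        sampleLaw μ (f θ) {y | ENNReal.ofReal x < ⨆ γ ∈ Γ, ‖G γ y‖ₑ} ≤
          ENNReal.ofReal (Real.exp (-(|Real.log x| ^ η))))

/-! ### The level-triggered-sampling GSPRT

Samples are taken at the times `t = 1, 2, …`; the entry with index `0` of a sample sequence is
never used. -/

/-- The local generalized log-likelihood ratio of the samples `y k, …, y t` of one sensor. -/
def localGLR {Y E F : Type*} (h : E → Y → ℝ) (f : F → Y → ℝ) (Γ : Set E) (Θ : Set F)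
    (y : ℕ → Y) (k t : ℕ) : ℝ :=
  (⨆ θ : Θ, ∑ j ∈ Finset.Icc k t, Real.log (f θ (y j))) -
    ⨆ γ : Γ, ∑ j ∈ Finset.Icc k t, Real.log (h γ (y j))

/-- The `n`-th transmission time of a sensor with sample sequence `y` and local thresholds
`a`, `b`; it is `⊤` if there is no `n`-th transmission. -/
def transTime {Y E F : Type*} (h : E → Y → ℝ) (f : F → Y → ℝ) (Γ : Set E) (Θ : Set F)
    (a b : ℝ) (y : ℕ → Y) : ℕ → ℕ∞
  | 0 => 0
  | n + 1 => sInf {t : ℕ∞ | ∃ s m : ℕ, transTime h f Γ Θ a b y n = s ∧ s < m ∧ t = m ∧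
      localGLR h f Γ Θ y (s + 1) m ∉ Set.Ioo (-b) a}

/-- The local statistic on which the `n`-th message (`n ≥ 1`) is based. -/
def statAt {Y E F : Type*} (h : E → Y → ℝ) (f : F → Y → ℝ) (Γ : Set E) (Θ : Set F)
    (a b : ℝ) (y : ℕ → Y) (n : ℕ) : ℝ :=
  localGLR h f Γ Θ y ((transTime h f Γ Θ a b y (n - 1)).toNat + 1)
    (transTime h f Γ Θ a b y n).toNat

/-- The `n`-th one-bit message (`n ≥ 1`), meaningful when the `n`-th transmission takes place:
`1` if the upper local threshold is reached and `-1` if the lower one is. -/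
def message {Y E F : Type*} (h : E → Y → ℝ) (f : F → Y → ℝ) (Γ : Set E) (Θ : Set F)
    (a b : ℝ) (y : ℕ → Y) (n : ℕ) : ℤ :=
  open Classical in
  if a ≤ statAt h f Γ Θ a b y n then 1
  else if statAt h f Γ Θ a b y n ≤ -b then -1 else 0

/-- The number of messages sent by a sensor up to time `t`. The set is contained in
`{0, …, t}`, as transmission times are strictly increasing. -/
def numMessages {Y E F : Type*} (h : E → Y → ℝ) (f : F → Y → ℝ) (Γ : Set E) (Θ : Set F)
    (a b : ℝ) (y : ℕ → Y) (t : ℕ) : ℕ :=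
  sSup {n : ℕ | transTime h f Γ Θ a b y n ≤ t}

/-- The statistic of the fusion center at time `t`. -/
def fusionStat {Y E F : Type*} {L : ℕ} (h : E → Y → ℝ) (f : F → Y → ℝ) (Γ : Set E) (Θ : Set F)
    (a b : ℝ) (ω : Fin L × ℕ → Y) (t : ℕ) : ℝ :=
  open Classical in
  ∑ ℓ : Fin L, ∑ n ∈ Finset.Icc 1 (numMessages h f Γ Θ a b (fun j => ω (ℓ, j)) t),
    ((if message h f Γ Θ a b (fun j => ω (ℓ, j)) n = 1 then a else 0) -
      (if message h f Γ Θ a b (fun j => ω (ℓ, j)) n = -1 then b else 0))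

/-- The stopping time of the fusion center with global thresholds `A`, `B` (`⊤` if it never
stops). -/
def stopTime {Y E F : Type*} {L : ℕ} (h : E → Y → ℝ) (f : F → Y → ℝ) (Γ : Set E) (Θ : Set F)
    (a b A B : ℝ) (ω : Fin L × ℕ → Y) : ℕ∞ :=
  sInf {t : ℕ∞ | ∃ m : ℕ, t = m ∧ fusionStat h f Γ Θ a b ω m ∉ Set.Ioo (-B) A}

/-- The event that the fusion center stops and decides for the alternative. -/
def decideOne {Y E F : Type*} (L : ℕ) (h : E → Y → ℝ) (f : F → Y → ℝ) (Γ : Set E) (Θ : Set F)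
    (a b A B : ℝ) : Set (Fin L × ℕ → Y) :=
  {ω | ∃ m : ℕ, stopTime h f Γ Θ a b A B ω = m ∧ A ≤ fusionStat h f Γ Θ a b ω m}

/-- The event that the fusion center stops and decides for the null hypothesis. -/
def decideZero {Y E F : Type*} (L : ℕ) (h : E → Y → ℝ) (f : F → Y → ℝ) (Γ : Set E) (Θ : Set F)
    (a b A B : ℝ) : Set (Fin L × ℕ → Y) :=
  {ω | ∃ m : ℕ, stopTime h f Γ Θ a b A B ω = m ∧ fusionStat h f Γ Θ a b ω m ≤ -B}

end

end LTS

/-! A sensor starts afresh after every message, so its contribution to the fusion statistic is a sum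
over independent blocks, each worth `a` or `-b`. Both bounds on the error probability come from
exponential moments of one block.

Upper bound. Under `γ` a block ends upwards with probability at most about `exp (-a)`
(`RegularModel.exitUp_le`). Indeed, up to an exponentially small probability the block is over after
a multiple of `a` samples, by a Chernoff bound with exponent 1/2 and the uniform bound on the
Hellinger affinities. Before that time the supremum over `Θ` can be replaced by a maximum over a net
of subexponential size (`RegularFamily.exists_net`), and the likelihood ratio of each point of the
net has mean one. Hence, for `r < 1`, the factor `exp (r * v)` of a block with value `v` has mean at
most 1/2. The products of these factors, summed over all possible numbers of messages, have mean at
most 2 and dominate `exp (r * contribution)` of the sensor at every time simultaneously.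
Independence of the sensors and Markov's inequality give `2 ^ L * exp (-r * A)`
(`jointLaw_decideOne_le`), with no need to control the stopping time.

Lower bound. Fix any `θ`, let `D` be the infimum over `γ` of the divergences of `f θ` from `h γ`,
and let `γ` nearly attain it. Under `θ` downward blocks are rare and a block takes at most about `a
/ D` samples, so after about `A / (L * D)` samples per sensor the fusion statistic has reached `A`
without ever having been negative, with probability at least 1/2. Those samples carry a
log-likelihood ratio of `θ` against `γ` of at most about `L * (A / (L * D)) * D = A`, so the same
event has probability at least about `exp (-A)` under `γ` (`RegularModel.le_jointLaw_of_bad`,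
`RegularModel.eventually_le_jointLaw_decideOne`). The exponents match because `D` governs both the
speed of the test and the price of the change of measure.

The assertion on `decideZero` follows by exchanging the hypotheses. The gradient tails enter through
a Lipschitz modulus of the log-densities whose tails decay faster than any power (`exists_modulus`),
and all almost sure assumptions are made to hold everywhere by altering the densities on a null set
(`exists_regularModel_fillOne`). -/

namespace LTS

open ProbabilityTheory

/-! ### Infinite product measures: independence and change of measure. -/

section InfiniteProduct

variable {Y : Type*} [MeasurableSpace Y] {ι : Type*}

lemma exists_factor_restrict [Nonempty Y] {β : Type*} [MeasurableSpace β] {F : (ι → Y) → β}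
    (hF : Measurable F) {S : Finset ι} (hS : DependsOn F (S : Set ι)) :
    ∃ F' : (S → Y) → β, Measurable F' ∧ ∀ ω, F ω = F' (S.restrict ω) := by
  classical
  obtain ⟨y₀⟩ := ‹Nonempty Y›
  refine ⟨fun x => F (fun i => if h : i ∈ S then x ⟨i, h⟩ else y₀), hF.comp ?_, ?_⟩
  · refine measurable_pi_lambda _ fun i => ?_
    by_cases h : i ∈ S
    · simpa [h] using measurable_pi_apply _
    · simp [h]
  · intro ω
    refine hS fun i hi => ?_
    have : i ∈ S := hi
    simp [this]

/-- Independence of functions of disjoint finite sets of coordinates. It will separate the past of a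
sensor up to a fixed time from the block that starts there. -/
lemma lintegral_mul_of_dependsOn (P : ι → Measure Y) [∀ i, IsProbabilityMeasure (P i)]
    {F G : (ι → Y) → ℝ≥0∞} (hF : Measurable F) (hG : Measurable G) {S T : Finset ι}
    (hST : Disjoint S T) (hFS : DependsOn F (S : Set ι)) (hGT : DependsOn G (T : Set ι)) :
    ∫⁻ ω, F ω * G ω ∂(Measure.infinitePi P) =
      (∫⁻ ω, F ω ∂(Measure.infinitePi P)) * ∫⁻ ω, G ω ∂(Measure.infinitePi P) := by
  rcases isEmpty_or_nonempty Y with hY | hY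
  · rcases isEmpty_or_nonempty ι with hι | ⟨⟨i⟩⟩
    · have h1 : ∀ ω, F ω = F (fun i => hι.elim i) := fun ω => congrArg F (Subsingleton.elim _ _)
      have h2 : ∀ ω, G ω = G (fun i => hι.elim i) := fun ω => congrArg G (Subsingleton.elim _ _)
      simp_rw [h1, h2]
      simp
    · have := (P i).eq_zero_of_isEmpty
      exact absurd this (IsProbabilityMeasure.ne_zero _)
  obtain ⟨F', hF', hFF⟩ := exists_factor_restrict hF hFS
  obtain ⟨G', hG', hGG⟩ := exists_factor_restrict hG hGT
  have hind : iIndepFun (fun (i : ι) (ω : ι → Y) => ω i) (Measure.infinitePi P) :=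
    iIndepFun_infinitePi (X := fun _ y => y) (by fun_prop)
  have h := hind.indepFun_finset S T hST (by fun_prop)
  have h2 := h.comp hF' hG'
  have h3 := lintegral_mul_eq_lintegral_mul_lintegral_of_indepFun
    (hF'.comp (by fun_prop)) (hG'.comp (by fun_prop)) h2
  simp_rw [hFF, hGG]
  exact h3

lemma lintegral_prod_infinitePi (P : ι → Measure Y) [∀ i, IsProbabilityMeasure (P i)]
    (S : Finset ι) (g : ι → Y → ℝ≥0∞) (hg : ∀ i, Measurable (g i)) :
    ∫⁻ ω, ∏ i ∈ S, g i (ω i) ∂(Measure.infinitePi P) = ∏ i ∈ S, ∫⁻ y, g i y ∂(P i) := by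
  have hind : iIndepFun (fun (i : ι) (ω : ι → Y) => g i (ω i)) (Measure.infinitePi P) :=
    iIndepFun_infinitePi hg
  rw [lintegral_prod_eq_prod_lintegral_of_indepFun S _ hind (fun i => by have := hg i; fun_prop)]
  refine Finset.prod_congr rfl fun i _ => ?_
  rw [← Measure.infinitePi_map_eval P i, lintegral_map (hg i) (by fun_prop)]

lemma map_shift_infinitePi (P : Measure Y) [IsProbabilityMeasure P] (s : ℕ) :
    (Measure.infinitePi fun _ : ℕ => P).map (fun y j => y (s + j)) =
      Measure.infinitePi fun _ : ℕ => P :=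
  Measure.map_infinitePi_infinitePi_of_inj (P := fun _ : ℕ => P) (add_right_injective s)

lemma map_sensor_infinitePi {κ : Type*} (P : Measure Y) [IsProbabilityMeasure P] (ℓ : κ) :
    (Measure.infinitePi fun _ : κ × ℕ => P).map (fun ω j => ω (ℓ, j)) =
      Measure.infinitePi fun _ : ℕ => P :=
  Measure.map_infinitePi_infinitePi_of_inj (P := fun _ : κ × ℕ => P)
    (f := fun j : ℕ => (ℓ, j)) (fun _ _ h => by simpa using h)

lemma lintegral_prod_sensors {κ : Type*} [Fintype κ] (P : Measure Y) [IsProbabilityMeasure P]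
    (F : (ℕ → Y) → ℝ≥0∞) (hF : Measurable F) :
    ∫⁻ ω, ∏ ℓ : κ, F (fun j => ω (ℓ, j)) ∂(Measure.infinitePi fun _ : κ × ℕ => P) =
      (∫⁻ y, F y ∂(Measure.infinitePi fun _ : ℕ => P)) ^ Fintype.card κ := by
  have h := Measure.infinitePi_map_curry (fun (_ : κ) (_ : ℕ) => P)
  have h1 := lintegral_prod_infinitePi
    (fun _ : κ => Measure.infinitePi fun _ : ℕ => P) Finset.univ (fun _ => F) (fun _ => hF)
  rw [← h, lintegral_map (by fun_prop) (by fun_prop)] at h1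
  rw [Finset.prod_const, Finset.card_univ] at h1
  exact h1

/-- Infinite products of different laws have no density with respect to each other in general, so
only finitely many coordinates are tilted. The identity is checked on cylinders. -/
lemma withDensity_prod_infinitePi [DecidableEq ι] {P₀ P₁ : Measure Y} [IsProbabilityMeasure P₀]
    [IsProbabilityMeasure P₁] {r : Y → ℝ≥0∞} (hr : Measurable r) (h : P₁ = P₀.withDensity r)
    (I : Finset ι) :
    (Measure.infinitePi fun _ : ι => P₀).withDensity (fun ω => ∏ i ∈ I, r (ω i)) =
      Measure.infinitePi fun i : ι => if i ∈ I then P₁ else P₀ := by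
  have : ∀ i : ι, IsProbabilityMeasure (if i ∈ I then P₁ else P₀) := fun i => by
    split_ifs <;> infer_instance
  refine Measure.eq_infinitePi _ fun s t ht => ?_
  have hms : MeasurableSet (Set.pi (s : Set ι) t) :=
    MeasurableSet.pi s.countable_toSet fun i _ => ht i
  have h1 : ∫⁻ y, r y ∂P₀ = 1 := by
    rw [← setLIntegral_univ, ← withDensity_apply _ MeasurableSet.univ, ← h, measure_univ]
  let g : ι → Y → ℝ≥0∞ := fun i y =>
    (if i ∈ I then r y else 1) * (if i ∈ s then (t i).indicator 1 y else 1)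
  have hg : ∀ i, Measurable (g i) := by
    intro i
    refine Measurable.mul ?_ ?_
    · split_ifs
      · exact hr
      · exact measurable_const
    · split_ifs
      · exact measurable_one.indicator (ht i)
      · exact measurable_const
  rw [withDensity_apply _ hms, ← lintegral_indicator hms]
  -- Written as one product over `s ∪ I`, the integrand factorizes over coordinates.
  have hpt : ∀ ω : ι → Y, (Set.pi (s : Set ι) t).indicator (fun ω => ∏ i ∈ I, r (ω i)) ω =
      ∏ i ∈ s ∪ I, g i (ω i) := by
    intro ω
    simp only [g, Finset.prod_mul_distrib]
    rw [Finset.prod_ite_mem, Finset.prod_ite_mem, Finset.inter_eq_right.2 Finset.subset_union_right,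
      Finset.inter_eq_right.2 Finset.subset_union_left]
    have hind : (∏ i ∈ s, (t i).indicator (1 : Y → ℝ≥0∞) (ω i)) =
        (Set.pi (s : Set ι) t).indicator 1 ω := by
      by_cases hω : ω ∈ Set.pi (s : Set ι) t
      · rw [Set.indicator_of_mem hω]
        exact Finset.prod_eq_one fun i hi => by rw [Set.indicator_of_mem (hω i hi)]; rfl
      · rw [Set.indicator_of_notMem hω]
        simp only [Set.mem_pi, not_forall] at hω
        obtain ⟨i, hi, hit⟩ := hω
        exact Finset.prod_eq_zero (i := i) hi (Set.indicator_of_notMem hit _)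
    rw [hind]
    by_cases hω : ω ∈ Set.pi (s : Set ι) t <;> simp [hω]
  simp_rw [hpt]
  rw [lintegral_prod_infinitePi _ _ _ hg]
  have hgi : ∀ i ∈ s ∪ I, ∫⁻ y, g i y ∂P₀ =
      if i ∈ s then (if i ∈ I then P₁ else P₀) (t i) else 1 := by
    intro i hi
    by_cases his : i ∈ s
    · by_cases hiI : i ∈ I
      · simp only [g, his, hiI, if_true]
        rw [h, withDensity_apply _ (ht i), ← lintegral_indicator (ht i)]
        refine lintegral_congr fun y => ?_
        by_cases hy : y ∈ t i <;> simp [hy]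
      · simp only [g, his, hiI, if_true, if_false, one_mul]
        exact lintegral_indicator_one (ht i)
    · have hiI : i ∈ I := by simpa [his] using hi
      simp only [g, his, hiI, if_true, if_false, mul_one]
      exact h1
  rw [Finset.prod_congr rfl hgi, Finset.prod_ite_mem,
    Finset.inter_eq_right.2 Finset.subset_union_left]

/-- Change of measure on finitely many coordinates. -/
lemma infinitePi_le_mul_of_likelihood_le {P₀ P₁ : Measure Y}
    [IsProbabilityMeasure P₀] [IsProbabilityMeasure P₁] {r : Y → ℝ≥0∞} (hr : Measurable r)
    (h : P₁ = P₀.withDensity r) (I : Finset ι) {G : Set (ι → Y)} (hG : MeasurableSet G)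
    (hGI : DependsOn (· ∈ G) (I : Set ι)) {c : ℝ≥0∞} (hc : ∀ ω ∈ G, ∏ i ∈ I, r (ω i) ≤ c) :
    (Measure.infinitePi fun _ : ι => P₁) G ≤ c * (Measure.infinitePi fun _ : ι => P₀) G := by
  classical
  have : Nonempty Y := by
    by_contra hY
    rw [not_nonempty_iff] at hY
    exact IsProbabilityMeasure.ne_zero P₀ P₀.eq_zero_of_isEmpty
  have : ∀ i : ι, IsProbabilityMeasure (if i ∈ I then P₁ else P₀) := fun i => by
    split_ifs <;> infer_instance
  obtain ⟨G', hG', hGG⟩ := exists_factor_restrict (measurable_mem.2 hG) hGI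
  have hpre : G = I.restrict ⁻¹' {x | G' x} := by
    ext ω
    exact (hGG ω).to_iff
  have hms : MeasurableSet {x | G' x} := measurableSet_setOfPred.2 hG'
  -- The event does not see the coordinates outside `I`, so their law may be changed from `P₁` to
  -- `P₀`.
  have heq : (Measure.infinitePi fun _ : ι => P₁) G =
      (Measure.infinitePi fun i : ι => if i ∈ I then P₁ else P₀) G := by
    rw [hpre, ← Measure.map_apply (by fun_prop) hms, ← Measure.map_apply (by fun_prop) hms,
      Measure.infinitePi_map_restrict, Measure.infinitePi_map_restrict]
    congr 2
    funext i
    simp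
  rw [heq, ← withDensity_prod_infinitePi hr h, withDensity_apply _ hG]
  calc ∫⁻ ω in G, ∏ i ∈ I, r (ω i) ∂(Measure.infinitePi fun _ : ι => P₀)
      ≤ ∫⁻ _ in G, c ∂(Measure.infinitePi fun _ : ι => P₀) := setLIntegral_mono measurable_const hc
    _ = _ := by simp

end InfiniteProduct

end LTS

namespace LTS

/-! ### Deterministic structure of the test along a fixed path. -/

section Paths

variable {Y E F : Type*} (h : E → Y → ℝ) (f : F → Y → ℝ) (Γ : Set E) (Θ : Set F) (a b : ℝ)

/-- Started after time `s`, the local statistic leaves `(-b, a)` at time `m`, upwards. -/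
def exitUp (s m : ℕ) : Set (ℕ → Y) :=
  {y | s < m ∧ (∀ t, s < t → t < m → localGLR h f Γ Θ y (s + 1) t ∈ Set.Ioo (-b) a) ∧
    a ≤ localGLR h f Γ Θ y (s + 1) m}

/-- Started after time `s`, the local statistic leaves `(-b, a)` at time `m`, downwards. -/
def exitDown (s m : ℕ) : Set (ℕ → Y) :=
  {y | s < m ∧ (∀ t, s < t → t < m → localGLR h f Γ Θ y (s + 1) t ∈ Set.Ioo (-b) a) ∧
    localGLR h f Γ Θ y (s + 1) m ≤ -b}

/-- The contribution of the first `n` messages of a sensor to the fusion statistic. -/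
noncomputable def messageSum (y : ℕ → Y) (n : ℕ) : ℝ :=
  open Classical in
  ∑ i ∈ Finset.Icc 1 n,
    ((if message h f Γ Θ a b y i = 1 then a else 0) -
      (if message h f Γ Θ a b y i = -1 then b else 0))

variable {h f Γ Θ a b}

/-- A finite infimum in `ℕ∞` is attained, which gives the renewal description of the transmission
times on which the later path arguments rest. -/
lemma transTime_succ_eq_coe {y : ℕ → Y} {n m : ℕ} :
    transTime h f Γ Θ a b y (n + 1) = m ↔ ∃ s : ℕ, transTime h f Γ Θ a b y n = s ∧
      (y ∈ exitUp h f Γ Θ a b s m ∨ y ∈ exitDown h f Γ Θ a b s m) := by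
  have hnot : ∀ x : ℝ, x ∉ Set.Ioo (-b) a ↔ (a ≤ x ∨ x ≤ -b) := by
    intro x
    simp only [Set.mem_Ioo, not_and_or, not_lt]
    tauto
  rw [transTime]
  constructor
  · intro hm
    have hne : {t : ℕ∞ | ∃ s m : ℕ, transTime h f Γ Θ a b y n = s ∧ s < m ∧ t = m ∧
        localGLR h f Γ Θ y (s + 1) m ∉ Set.Ioo (-b) a}.Nonempty := by
      by_contra hne
      rw [Set.not_nonempty_iff_eq_empty] at hne
      rw [hne, sInf_empty] at hm
      exact ENat.top_ne_natCast m hm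
    obtain ⟨s, m', hs, hsm, hmm, hex⟩ := csInf_mem hne
    have hmm' : m' = m := by
      have := hmm.symm.trans hm
      exact_mod_cast this
    subst hmm'
    refine ⟨s, hs, ?_⟩
    have hin : ∀ t, s < t → t < m' → localGLR h f Γ Θ y (s + 1) t ∈ Set.Ioo (-b) a := by
      intro t hst htm
      by_contra hcon
      have h1 : sInf {t : ℕ∞ | ∃ s m : ℕ, transTime h f Γ Θ a b y n = s ∧ s < m ∧ t = m ∧
        localGLR h f Γ Θ y (s + 1) m ∉ Set.Ioo (-b) a} ≤ (t : ℕ∞) :=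
        sInf_le ⟨s, t, hs, hst, rfl, hcon⟩
      rw [hm] at h1
      have : m' ≤ t := by exact_mod_cast h1
      omega
    rcases (hnot _).1 hex with h1 | h1
    · exact Or.inl ⟨hsm, hin, h1⟩
    · exact Or.inr ⟨hsm, hin, h1⟩
  · rintro ⟨s, hs, hor⟩
    have hsm : s < m := by rcases hor with h1 | h1 <;> exact h1.1
    have hin : ∀ t, s < t → t < m → localGLR h f Γ Θ y (s + 1) t ∈ Set.Ioo (-b) a := by
      rcases hor with h1 | h1 <;> exact h1.2.1
    have hex : localGLR h f Γ Θ y (s + 1) m ∉ Set.Ioo (-b) a := by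
      rw [hnot]
      rcases hor with h1 | h1
      · exact Or.inl h1.2.2
      · exact Or.inr h1.2.2
    refine le_antisymm (sInf_le ⟨s, m, hs, hsm, rfl, hex⟩) (le_sInf ?_)
    rintro _ ⟨s', m', hs', hsm', rfl, hex'⟩
    have : s' = s := by
      have := hs'.symm.trans hs
      exact_mod_cast this
    subst this
    by_contra hlt
    have hlt' : m' < m := by
      have := not_le.1 hlt
      exact_mod_cast this
    exact hex' (hin m' hsm' hlt')

lemma message_of_exitUp {y : ℕ → Y} {n s m : ℕ} (hs : transTime h f Γ Θ a b y n = s)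
    (hm : y ∈ exitUp h f Γ Θ a b s m) : message h f Γ Θ a b y (n + 1) = 1 := by
  have hm' : transTime h f Γ Θ a b y (n + 1) = m :=
    transTime_succ_eq_coe.2 ⟨s, hs, Or.inl hm⟩
  have : statAt h f Γ Θ a b y (n + 1) = localGLR h f Γ Θ y (s + 1) m := by
    simp [statAt, hs, hm']
  rw [message, this, if_pos hm.2.2]

lemma message_of_exitDown (ha : 0 < a) (hb : 0 < b) {y : ℕ → Y} {n s m : ℕ}
    (hs : transTime h f Γ Θ a b y n = s)
    (hm : y ∈ exitDown h f Γ Θ a b s m) : message h f Γ Θ a b y (n + 1) = -1 := by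
  have hm' : transTime h f Γ Θ a b y (n + 1) = m :=
    transTime_succ_eq_coe.2 ⟨s, hs, Or.inr hm⟩
  have : statAt h f Γ Θ a b y (n + 1) = localGLR h f Γ Θ y (s + 1) m := by
    simp [statAt, hs, hm']
  have h1 := hm.2.2
  rw [message, this, if_neg (by linarith), if_pos h1]

lemma messageSum_zero (y : ℕ → Y) : messageSum h f Γ Θ a b y 0 = 0 := by
  simp [messageSum]

lemma messageSum_succ (y : ℕ → Y) (n : ℕ) : messageSum h f Γ Θ a b y (n + 1) =
    messageSum h f Γ Θ a b y n + ((if message h f Γ Θ a b y (n + 1) = 1 then a else 0) -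
      (if message h f Γ Θ a b y (n + 1) = -1 then b else 0)) := by
  rw [messageSum, Finset.sum_Icc_succ_top (by omega)]
  simp only [messageSum]

lemma messageSum_of_exitUp {y : ℕ → Y} {n s m : ℕ} (hs : transTime h f Γ Θ a b y n = s)
    (hm : y ∈ exitUp h f Γ Θ a b s m) :
    messageSum h f Γ Θ a b y (n + 1) = messageSum h f Γ Θ a b y n + a := by
  rw [messageSum_succ, message_of_exitUp hs hm]
  norm_num

lemma messageSum_of_exitDown (ha : 0 < a) (hb : 0 < b) {y : ℕ → Y} {n s m : ℕ}
    (hs : transTime h f Γ Θ a b y n = s) (hm : y ∈ exitDown h f Γ Θ a b s m) :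
    messageSum h f Γ Θ a b y (n + 1) = messageSum h f Γ Θ a b y n - b := by
  rw [messageSum_succ, message_of_exitDown ha hb hs hm]
  norm_num
  ring

lemma le_transTime {y : ℕ → Y} {n m : ℕ} (hm : transTime h f Γ Θ a b y n = m) : n ≤ m := by
  induction n generalizing m with
  | zero => omega
  | succ n ih =>
    obtain ⟨s, hs, hor⟩ := transTime_succ_eq_coe.1 hm
    have := ih hs
    have hsm : s < m := by rcases hor with h1 | h1 <;> exact h1.1
    omega

/-- Without this bound the `sSup` in `numMessages` could take its default value `0`. -/
lemma transTime_mem_bddAbove (y : ℕ → Y) (t : ℕ) :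
    BddAbove {n : ℕ | transTime h f Γ Θ a b y n ≤ t} := by
  refine ⟨t, fun n hn => ?_⟩
  have hn' : transTime h f Γ Θ a b y n ≤ t := hn
  obtain ⟨m, hm⟩ := ENat.ne_top_iff_exists.1 (ne_top_of_le_ne_top (ENat.natCast_ne_top t) hn')
  rw [← hm] at hn'
  have h1 := le_transTime hm.symm
  have : m ≤ t := by exact_mod_cast hn'
  omega

lemma transTime_numMessages (y : ℕ → Y) (t : ℕ) :
    ∃ m : ℕ, m ≤ t ∧ transTime h f Γ Θ a b y (numMessages h f Γ Θ a b y t) = m := by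
  have h0 : {n : ℕ | transTime h f Γ Θ a b y n ≤ t}.Nonempty := ⟨0, by simp [transTime]⟩
  have h1 : transTime h f Γ Θ a b y (numMessages h f Γ Θ a b y t) ≤ t :=
    Nat.sSup_mem h0 (transTime_mem_bddAbove y t)
  obtain ⟨m, hm⟩ := ENat.ne_top_iff_exists.1 (ne_top_of_le_ne_top (ENat.natCast_ne_top t) h1)
  rw [← hm] at h1
  exact ⟨m, by exact_mod_cast h1, hm.symm⟩

lemma le_numMessages {y : ℕ → Y} {t k m : ℕ} (hm : transTime h f Γ Θ a b y k = m) (hmt : m ≤ t) :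
    k ≤ numMessages h f Γ Θ a b y t :=
  le_csSup (transTime_mem_bddAbove y t)
    (show transTime h f Γ Θ a b y k ≤ t by rw [hm]; exact_mod_cast hmt)

lemma fusionStat_eq_sum {L : ℕ} (ω : Fin L × ℕ → Y) (t : ℕ) :
    fusionStat h f Γ Θ a b ω t = ∑ ℓ : Fin L, messageSum h f Γ Θ a b (fun j => ω (ℓ, j))
      (numMessages h f Γ Θ a b (fun j => ω (ℓ, j)) t) := rfl

/-- The fusion center may stop before `n`, but if the lower threshold is avoided up to `n` it can
only have stopped upwards. -/
lemma mem_decideOne_of_forall_pos {L : ℕ} {A B : ℝ} (ω : Fin L × ℕ → Y) (n : ℕ)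
    (hpos : ∀ t ≤ n, -B < fusionStat h f Γ Θ a b ω t)
    (hn : A ≤ fusionStat h f Γ Θ a b ω n) : ω ∈ decideOne L h f Γ Θ a b A B := by
  have hmem : (n : ℕ∞) ∈ {t : ℕ∞ | ∃ m : ℕ, t = m ∧
      fusionStat h f Γ Θ a b ω m ∉ Set.Ioo (-B) A} :=
    ⟨n, rfl, fun hcon => by have := hcon.2; linarith⟩
  obtain ⟨m, hm, hex⟩ := csInf_mem (s := {t : ℕ∞ | ∃ m : ℕ, t = m ∧
      fusionStat h f Γ Θ a b ω m ∉ Set.Ioo (-B) A}) ⟨_, hmem⟩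
  refine ⟨m, hm, ?_⟩
  have hle := sInf_le hmem
  rw [hm] at hle
  have hmn : m ≤ n := by exact_mod_cast hle
  by_contra hcon
  exact hex ⟨hpos m hmn, not_le.1 hcon⟩

/-! Shifted start -/

lemma localGLR_shift (y : ℕ → Y) (s k t : ℕ) :
    localGLR h f Γ Θ (fun j => y (s + j)) k t = localGLR h f Γ Θ y (s + k) (s + t) := by
  have : ∀ g : Y → ℝ, ∑ j ∈ Finset.Icc (s + k) (s + t), g (y j) =
      ∑ j ∈ Finset.Icc k t, g (y (s + j)) := by
    intro g
    rw [← Finset.image_add_left_Icc, Finset.sum_image (fun _ _ _ _ h => by simpa using h)]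
  simp only [localGLR]
  congr 1
  · exact iSup_congr fun θ => (this fun x => Real.log (f θ x)).symm
  · exact iSup_congr fun γ => (this fun x => Real.log (h γ x)).symm

lemma mem_exitUp_shift (y : ℕ → Y) (s m : ℕ) :
    y ∈ exitUp h f Γ Θ a b s (s + m) ↔ (fun j => y (s + j)) ∈ exitUp h f Γ Θ a b 0 m := by
  simp only [exitUp, Set.mem_ofPred_eq, localGLR_shift]
  refine and_congr (by omega) (and_congr ⟨fun H t h1 h2 => ?_, fun H t h1 h2 => ?_⟩ ?_)
  · exact H (s + t) (by omega) (by omega)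
  · have := H (t - s) (by omega) (by omega)
    rwa [Nat.add_sub_of_le h1.le] at this
  · rfl

lemma mem_exitDown_shift (y : ℕ → Y) (s m : ℕ) :
    y ∈ exitDown h f Γ Θ a b s (s + m) ↔ (fun j => y (s + j)) ∈ exitDown h f Γ Θ a b 0 m := by
  simp only [exitDown, Set.mem_ofPred_eq, localGLR_shift]
  refine and_congr (by omega) (and_congr ⟨fun H t h1 h2 => ?_, fun H t h1 h2 => ?_⟩ ?_)
  · exact H (s + t) (by omega) (by omega)
  · have := H (t - s) (by omega) (by omega)
    rwa [Nat.add_sub_of_le h1.le] at this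
  · rfl

/-! Exchange of the hypotheses -/

lemma localGLR_swap (y : ℕ → Y) (k t : ℕ) :
    localGLR f h Θ Γ y k t = -localGLR h f Γ Θ y k t := by
  simp [localGLR]

lemma localGLR_swap_mem_Ioo (y : ℕ → Y) (k t : ℕ) :
    localGLR f h Θ Γ y k t ∈ Set.Ioo (-a) b ↔ localGLR h f Γ Θ y k t ∈ Set.Ioo (-b) a := by
  rw [localGLR_swap, Set.mem_Ioo, Set.mem_Ioo]
  constructor <;> rintro ⟨h1, h2⟩ <;> constructor <;> linarith

lemma transTime_swap (y : ℕ → Y) (n : ℕ) :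
    transTime f h Θ Γ b a y n = transTime h f Γ Θ a b y n := by
  induction n with
  | zero => rfl
  | succ n ih => simp only [transTime, ih, localGLR_swap_mem_Ioo (h := h) (f := f) (Γ := Γ) (Θ := Θ)]

lemma exitUp_swap (s m : ℕ) : exitUp f h Θ Γ b a s m = exitDown h f Γ Θ a b s m := by
  ext y
  simp only [exitUp, exitDown, Set.mem_ofPred_eq, localGLR_swap_mem_Ioo (h := h) (f := f) (Γ := Γ) (Θ := Θ)]
  rw [localGLR_swap, le_neg]

lemma message_swap (ha : 0 < a) (hb : 0 < b) (y : ℕ → Y) (n : ℕ) :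
    message f h Θ Γ b a y n = -message h f Γ Θ a b y n := by
  have : statAt f h Θ Γ b a y n = -statAt h f Γ Θ a b y n := by
    simp only [statAt, transTime_swap (h := h) (f := f) (Γ := Γ) (Θ := Θ),
      localGLR_swap (h := h) (f := f) (Γ := Γ) (Θ := Θ)]
  simp only [message, this]
  by_cases h1 : a ≤ statAt h f Γ Θ a b y n
  · rw [if_neg (by linarith), if_pos (by linarith), if_pos h1]
  · by_cases h2 : statAt h f Γ Θ a b y n ≤ -b
    · rw [if_pos (by linarith), if_neg h1, if_pos h2]; norm_num
    · rw [if_neg (by linarith), if_neg (by linarith), if_neg h1, if_neg h2]; norm_num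

lemma fusionStat_swap (ha : 0 < a) (hb : 0 < b) {L : ℕ} (ω : Fin L × ℕ → Y) (t : ℕ) :
    fusionStat f h Θ Γ b a ω t = -fusionStat h f Γ Θ a b ω t := by
  simp only [fusionStat, numMessages, transTime_swap (h := h) (f := f) (Γ := Γ) (Θ := Θ),
    message_swap (h := h) (f := f) (Γ := Γ) (Θ := Θ) ha hb, ← Finset.sum_neg_distrib]
  refine Finset.sum_congr rfl fun ℓ _ => Finset.sum_congr rfl fun n _ => ?_
  have h1 : ∀ z : ℤ, (-z = 1 ↔ z = -1) := fun z => by omega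
  have h2 : ∀ z : ℤ, (-z = -1 ↔ z = 1) := fun z => by omega
  simp only [h1, h2]
  ring

/-- Exchanging the hypotheses negates the local and the fusion statistics. Positivity of `a` and `b`
is needed because `message` tests the upper threshold first, which is harmless only if the two exits
exclude each other. -/
lemma decideOne_swap (ha : 0 < a) (hb : 0 < b) (L : ℕ) (A B : ℝ) :
    decideOne L f h Θ Γ b a B A = decideZero L h f Γ Θ a b A B := by
  ext ω
  have h1 : ∀ t, fusionStat f h Θ Γ b a ω t ∈ Set.Ioo (-A) B ↔
      fusionStat h f Γ Θ a b ω t ∈ Set.Ioo (-B) A := by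
    intro t
    rw [fusionStat_swap ha hb, Set.mem_Ioo, Set.mem_Ioo]
    constructor <;> rintro ⟨h1, h2⟩ <;> constructor <;> linarith
  have h2 : stopTime f h Θ Γ b a B A ω = stopTime h f Γ Θ a b A B ω := by
    simp only [stopTime, h1]
  simp only [decideOne, decideZero, Set.mem_ofPred_eq, h2, fusionStat_swap (h := h) (f := f) (Γ := Γ) (Θ := Θ) ha hb]
  refine exists_congr fun m => and_congr Iff.rfl ?_
  rw [le_neg]

/-! Congruence -/

variable {h' : E → Y → ℝ} {f' : F → Y → ℝ}

/-- The test depends on the densities only through their values at the observed samples and at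
parameters in `Γ` and `Θ`. This allows the densities to be altered on a null set of samples. -/
lemma localGLR_congr {y : ℕ → Y} (hh : ∀ j, ∀ γ ∈ Γ, h γ (y j) = h' γ (y j))
    (hf : ∀ j, ∀ θ ∈ Θ, f θ (y j) = f' θ (y j)) (k t : ℕ) :
    localGLR h f Γ Θ y k t = localGLR h' f' Γ Θ y k t := by
  simp only [localGLR]
  congr 1
  · exact iSup_congr fun θ => Finset.sum_congr rfl fun j _ => by rw [hf j θ θ.2]
  · exact iSup_congr fun γ => Finset.sum_congr rfl fun j _ => by rw [hh j γ γ.2]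

lemma fusionStat_congr {L : ℕ} {ω : Fin L × ℕ → Y}
    (hh : ∀ j, ∀ γ ∈ Γ, h γ (ω j) = h' γ (ω j))
    (hf : ∀ j, ∀ θ ∈ Θ, f θ (ω j) = f' θ (ω j)) (t : ℕ) :
    fusionStat h f Γ Θ a b ω t = fusionStat h' f' Γ Θ a b ω t := by
  have h1 : ∀ ℓ k t, localGLR h f Γ Θ (fun j => ω (ℓ, j)) k t =
      localGLR h' f' Γ Θ (fun j => ω (ℓ, j)) k t := fun ℓ k t =>
    localGLR_congr (fun j => hh (ℓ, j)) (fun j => hf (ℓ, j)) k t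
  have h2 : ∀ ℓ n, transTime h f Γ Θ a b (fun j => ω (ℓ, j)) n =
      transTime h' f' Γ Θ a b (fun j => ω (ℓ, j)) n := by
    intro ℓ n
    induction n with
    | zero => rfl
    | succ n ih => simp only [transTime, ih, h1]
  have h3 : ∀ ℓ n, message h f Γ Θ a b (fun j => ω (ℓ, j)) n =
      message h' f' Γ Θ a b (fun j => ω (ℓ, j)) n := by
    intro ℓ n
    have : statAt h f Γ Θ a b (fun j => ω (ℓ, j)) n =
        statAt h' f' Γ Θ a b (fun j => ω (ℓ, j)) n := by simp only [statAt, h1, h2]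
    simp only [message, this]
  simp only [fusionStat, numMessages, h2, h3]

lemma mem_decideOne_congr {L : ℕ} {A B : ℝ} {ω : Fin L × ℕ → Y}
    (hh : ∀ j, ∀ γ ∈ Γ, h γ (ω j) = h' γ (ω j))
    (hf : ∀ j, ∀ θ ∈ Θ, f θ (ω j) = f' θ (ω j)) :
    ω ∈ decideOne L h f Γ Θ a b A B ↔ ω ∈ decideOne L h' f' Γ Θ a b A B := by
  simp only [decideOne, stopTime, Set.mem_ofPred_eq, fusionStat_congr hh hf]

end Paths

end LTS

namespace LTS

/-! ### Exponential weights of message paths and their renewal bound. -/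

section Weights

variable {Y E F : Type*} (h : E → Y → ℝ) (f : F → Y → ℝ) (Γ : Set E) (Θ : Set F) (a b : ℝ)

/-- The weight `exp (c * v + κ * τ)` of a block that starts after time `s` and ends at time `m`,
where `τ = m - s` is its length and `v` is the contribution of its message. -/
noncomputable def blockWeight (c κ : ℝ) (s m : ℕ) (y : ℕ → Y) : ℝ≥0∞ :=
  (exitUp h f Γ Θ a b s m).indicator
      (fun _ => ENNReal.ofReal (Real.exp (c * a + κ * ((m : ℝ) - s)))) y +
    (exitDown h f Γ Θ a b s m).indicator
      (fun _ => ENNReal.ofReal (Real.exp (c * (-b) + κ * ((m : ℝ) - s)))) y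

/-- The product of the weights of the first `n` blocks, if the `n`-th one ends at time `m`. -/
noncomputable def pathWeight (c κ : ℝ) : ℕ → ℕ → (ℕ → Y) → ℝ≥0∞
  | 0, m, _ => if m = 0 then 1 else 0
  | n + 1, m, y => ∑ s ∈ Finset.range m,
      pathWeight c κ n s y * blockWeight h f Γ Θ a b c κ s m y

variable {h f Γ Θ a b} {c κ : ℝ}

lemma localGLR_congr_of_agree {y y' : ℕ → Y} {k t : ℕ}
    (hyy : ∀ j ∈ Finset.Icc k t, y j = y' j) :
    localGLR h f Γ Θ y k t = localGLR h f Γ Θ y' k t := by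
  simp only [localGLR]
  congr 1
  · exact iSup_congr fun θ => Finset.sum_congr rfl fun j hj => by rw [hyy j hj]
  · exact iSup_congr fun γ => Finset.sum_congr rfl fun j hj => by rw [hyy j hj]

lemma mem_exit_congr_of_agree {y y' : ℕ → Y} {s m : ℕ}
    (hyy : ∀ j ∈ Finset.Ioc s m, y j = y' j) :
    (y ∈ exitUp h f Γ Θ a b s m ↔ y' ∈ exitUp h f Γ Θ a b s m) ∧
      (y ∈ exitDown h f Γ Θ a b s m ↔ y' ∈ exitDown h f Γ Θ a b s m) := by
  have h1 : ∀ t ≤ m, localGLR h f Γ Θ y (s + 1) t = localGLR h f Γ Θ y' (s + 1) t := by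
    intro t ht
    refine localGLR_congr_of_agree fun j hj => hyy j ?_
    rw [Finset.mem_Icc] at hj
    rw [Finset.mem_Ioc]
    omega
  have h2 : (∀ t, s < t → t < m → localGLR h f Γ Θ y (s + 1) t ∈ Set.Ioo (-b) a) ↔
      ∀ t, s < t → t < m → localGLR h f Γ Θ y' (s + 1) t ∈ Set.Ioo (-b) a :=
    forall_congr' fun t => forall_congr' fun _ => forall_congr' fun ht => by rw [h1 t ht.le]
  simp only [exitUp, exitDown, Set.mem_ofPred_eq, h2, h1 m le_rfl, and_self]

lemma indicator_const_congr {α β : Type*} {S : Set α} {T : Set β} {x : α} {y : β}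
    (hxy : x ∈ S ↔ y ∈ T) (C : ℝ≥0∞) :
    S.indicator (fun _ => C) x = T.indicator (fun _ => C) y := by
  by_cases hx : x ∈ S
  · rw [Set.indicator_of_mem hx, Set.indicator_of_mem (hxy.1 hx)]
  · rw [Set.indicator_of_notMem hx, Set.indicator_of_notMem (mt hxy.2 hx)]

lemma dependsOn_blockWeight (s m : ℕ) :
    DependsOn (blockWeight h f Γ Θ a b c κ s m) (Finset.Ioc s m : Set ℕ) := by
  intro y y' hyy
  obtain ⟨h1, h2⟩ := mem_exit_congr_of_agree (h := h) (f := f) (Γ := Γ) (Θ := Θ) (a := a) (b := b)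
    (y := y) (y' := y') (s := s) (m := m) (fun j hj => hyy j hj)
  exact congrArg₂ (· + ·) (indicator_const_congr h1 _) (indicator_const_congr h2 _)

lemma dependsOn_pathWeight (n m : ℕ) :
    DependsOn (pathWeight h f Γ Θ a b c κ n m) (Finset.Icc 1 m : Set ℕ) := by
  induction n generalizing m with
  | zero => intro y y' _; rfl
  | succ n ih =>
    intro y y' hyy
    simp only [pathWeight]
    refine Finset.sum_congr rfl fun s hs => ?_
    rw [Finset.mem_range] at hs
    have hyy' : ∀ j, 1 ≤ j → j ≤ m → y j = y' j := fun j h1 hj => hyy j (by simp [h1, hj])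
    rw [ih s (fun j hj => hyy' j (by simp at hj; omega) (by simp at hj; omega)),
      dependsOn_blockWeight s m (fun j hj => hyy' j (by simp at hj; omega) (by simp at hj; omega))]

lemma blockWeight_of_not_lt {s m : ℕ} (hsm : ¬ s < m) (y : ℕ → Y) :
    blockWeight h f Γ Θ a b c κ s m y = 0 := by
  have h1 : y ∉ exitUp h f Γ Θ a b s m := fun hy => hsm hy.1
  have h2 : y ∉ exitDown h f Γ Θ a b s m := fun hy => hsm hy.1
  simp [blockWeight, h1, h2]

lemma blockWeight_shift (s m : ℕ) (y : ℕ → Y) :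
    blockWeight h f Γ Θ a b c κ s (s + m) y =
      blockWeight h f Γ Θ a b c κ 0 m (fun j => y (s + j)) := by
  have hcast : ((s + m : ℕ) : ℝ) - s = (m : ℝ) - (0 : ℕ) := by push_cast; ring
  rw [blockWeight, hcast]
  exact congrArg₂ (· + ·) (indicator_const_congr (mem_exitUp_shift y s m) _)
    (indicator_const_congr (mem_exitDown_shift y s m) _)

lemma tsum_blockWeight_shift (s : ℕ) (y : ℕ → Y) :
    ∑' m, blockWeight h f Γ Θ a b c κ s m y =
      ∑' m, blockWeight h f Γ Θ a b c κ 0 m (fun j => y (s + j)) := by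
  simp_rw [← blockWeight_shift]
  refine ((add_right_injective s).tsum_eq
    (f := fun m => blockWeight h f Γ Θ a b c κ s m y) ?_).symm
  intro m hm
  by_contra hcon
  refine hm (blockWeight_of_not_lt (fun hlt => hcon ⟨m - s, ?_⟩) y)
  simp only
  omega

/-- At most one term is nonzero: at an exit time the statistic is outside `(-b, a)`, while before a
later exit it would have to be inside. -/
lemma tsum_blockWeight_zero_le {y : ℕ → Y} {C : ℝ≥0∞}
    (hC : ∀ m, blockWeight h f Γ Θ a b c κ 0 m y ≤ C) :
    ∑' m, blockWeight h f Γ Θ a b c κ 0 m y ≤ C := by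
  by_cases hz : ∀ m, blockWeight h f Γ Θ a b c κ 0 m y = 0
  · simp [hz]
  push Not at hz
  obtain ⟨m, hm⟩ := hz
  have hor : ∀ m, blockWeight h f Γ Θ a b c κ 0 m y ≠ 0 →
      y ∈ exitUp h f Γ Θ a b 0 m ∨ y ∈ exitDown h f Γ Θ a b 0 m := by
    intro m hm
    by_contra hcon
    push Not at hcon
    exact hm (by simp [blockWeight, hcon.1, hcon.2])
  have hlt : ∀ m m', blockWeight h f Γ Θ a b c κ 0 m y ≠ 0 →
      blockWeight h f Γ Θ a b c κ 0 m' y ≠ 0 → ¬ m < m' := by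
    intro m m' hm hm' hmm
    have h1 : localGLR h f Γ Θ y (0 + 1) m ∈ Set.Ioo (-b) a := by
      rcases hor m hm with h0 | h0 <;> rcases hor m' hm' with h1 | h1 <;>
        exact h1.2.1 m h0.1 hmm
    rcases hor m hm with h0 | h0
    · have := h0.2.2; linarith [h1.2]
    · have := h0.2.2; linarith [h1.1]
  rw [tsum_eq_single m]
  · exact hC m
  · intro m' hne
    by_contra hm'
    rcases lt_or_gt_of_ne hne with h1 | h1
    · exact hlt _ _ hm' hm h1
    · exact hlt _ _ hm hm' h1

/-- Weights multiply along the path: in each sum over `s`, keep only the term of the true previous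
transmission time. -/
lemma le_pathWeight (ha : 0 < a) (hb : 0 < b) {y : ℕ → Y} {n m : ℕ}
    (hm : transTime h f Γ Θ a b y n = m) :
    ENNReal.ofReal (Real.exp (c * messageSum h f Γ Θ a b y n + κ * m)) ≤
      pathWeight h f Γ Θ a b c κ n m y := by
  induction n generalizing m with
  | zero =>
    have : m = 0 := by
      simp only [transTime] at hm
      exact_mod_cast hm.symm
    subst this
    simp [pathWeight, messageSum_zero]
  | succ n ih =>
    obtain ⟨s, hs, hor⟩ := transTime_succ_eq_coe.1 hm
    have hsm : s < m := by rcases hor with h1 | h1 <;> exact h1.1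
    rw [pathWeight]
    refine le_trans ?_ (Finset.single_le_sum (fun _ _ => zero_le) (Finset.mem_range.2 hsm))
    refine le_trans ?_ (mul_le_mul_left (ih hs) _)
    rcases hor with h1 | h1
    · have h2 : ENNReal.ofReal (Real.exp (c * a + κ * ((m : ℝ) - s))) ≤
          blockWeight h f Γ Θ a b c κ s m y := by
        rw [blockWeight, Set.indicator_of_mem h1]
        exact le_self_add
      refine le_trans (le_of_eq ?_) (mul_le_mul_right h2 _)
      rw [← ENNReal.ofReal_mul (Real.exp_nonneg _), ← Real.exp_add, messageSum_of_exitUp hs h1]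
      congr 2
      ring
    · have h2 : ENNReal.ofReal (Real.exp (c * (-b) + κ * ((m : ℝ) - s))) ≤
          blockWeight h f Γ Θ a b c κ s m y := by
        rw [blockWeight, Set.indicator_of_mem h1]
        exact le_add_self
      refine le_trans (le_of_eq ?_) (mul_le_mul_right h2 _)
      rw [← ENNReal.ofReal_mul (Real.exp_nonneg _), ← Real.exp_add,
        messageSum_of_exitDown ha hb hs h1]
      congr 2
      ring

/-- Lets a transmission time be read off from path weights, which are measurable and depend on
finitely many samples. -/
lemma transTime_of_pathWeight_ne_zero {y : ℕ → Y} {n m : ℕ}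
    (hm : pathWeight h f Γ Θ a b c κ n m y ≠ 0) : transTime h f Γ Θ a b y n = m := by
  induction n generalizing m with
  | zero =>
    have : m = 0 := by
      by_contra hne
      exact hm (by simp [pathWeight, hne])
    simp [this, transTime]
  | succ n ih =>
    rw [pathWeight] at hm
    obtain ⟨s, hs, hne⟩ := Finset.exists_ne_zero_of_sum_ne_zero hm
    refine transTime_succ_eq_coe.2 ⟨s, ih (left_ne_zero_of_mul hne), ?_⟩
    by_contra hcon
    push Not at hcon
    exact right_ne_zero_of_mul hne (by simp [blockWeight, hcon.1, hcon.2])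

variable [MeasurableSpace Y]

lemma measurableSet_exitUp (hmeas : ∀ k t, Measurable fun y => localGLR h f Γ Θ y k t) (s m : ℕ) :
    MeasurableSet (exitUp h f Γ Θ a b s m) := by
  have h1 : exitUp h f Γ Θ a b s m = {_y | s < m} ∩ ((⋂ t, ⋂ (_ : s < t), ⋂ (_ : t < m),
      (fun y => localGLR h f Γ Θ y (s + 1) t) ⁻¹' Set.Ioo (-b) a) ∩
      (fun y => localGLR h f Γ Θ y (s + 1) m) ⁻¹' Set.Ici a) := by
    ext y
    simp [exitUp]
  rw [h1]
  refine (MeasurableSet.const _).inter (MeasurableSet.inter ?_ (hmeas _ _ measurableSet_Ici))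
  exact MeasurableSet.iInter fun t => MeasurableSet.iInter fun _ => MeasurableSet.iInter fun _ =>
    hmeas _ _ measurableSet_Ioo

lemma measurableSet_exitDown (hmeas : ∀ k t, Measurable fun y => localGLR h f Γ Θ y k t)
    (s m : ℕ) : MeasurableSet (exitDown h f Γ Θ a b s m) := by
  rw [← exitUp_swap]
  refine measurableSet_exitUp (fun k t => ?_) s m
  simp_rw [localGLR_swap (h := h) (f := f)]
  exact (hmeas k t).neg

lemma measurable_blockWeight (hmeas : ∀ k t, Measurable fun y => localGLR h f Γ Θ y k t)
    (s m : ℕ) : Measurable (blockWeight h f Γ Θ a b c κ s m) :=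
  (measurable_const.indicator (measurableSet_exitUp hmeas s m)).add
    (measurable_const.indicator (measurableSet_exitDown hmeas s m))

lemma measurable_pathWeight (hmeas : ∀ k t, Measurable fun y => localGLR h f Γ Θ y k t)
    (n m : ℕ) : Measurable (pathWeight h f Γ Θ a b c κ n m) := by
  induction n generalizing m with
  | zero => exact measurable_const
  | succ n ih =>
    simp only [pathWeight]
    exact Finset.measurable_fun_sum _ fun s _ => (ih s).mul (measurable_blockWeight hmeas s m)

lemma tsum_lintegral_blockWeight (P : Measure Y) [IsProbabilityMeasure P]
    (hmeas : ∀ k t, Measurable fun y => localGLR h f Γ Θ y k t) (s : ℕ) :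
    ∑' m, ∫⁻ y, blockWeight h f Γ Θ a b c κ s m y ∂(Measure.infinitePi fun _ : ℕ => P) =
      ∫⁻ y, ∑' m, blockWeight h f Γ Θ a b c κ 0 m y ∂(Measure.infinitePi fun _ : ℕ => P) := by
  rw [← lintegral_tsum fun m => (measurable_blockWeight hmeas s m).aemeasurable]
  simp_rw [tsum_blockWeight_shift s]
  conv_rhs => rw [← map_shift_infinitePi P s]
  rw [lintegral_map (Measurable.tsum fun m => measurable_blockWeight hmeas 0 m)
    (by fun_prop)]

/-- Decomposing over the deterministic values `s` of the last transmission time replaces the strong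
Markov property: for fixed `s` the past and the next block are independent, and by stationarity the
total mean weight of the next block does not depend on `s`. -/
lemma tsum_lintegral_pathWeight_le (P : Measure Y) [IsProbabilityMeasure P]
    (hmeas : ∀ k t, Measurable fun y => localGLR h f Γ Θ y k t) {ρ : ℝ≥0∞}
    (hρ : ∫⁻ y, ∑' m, blockWeight h f Γ Θ a b c κ 0 m y
      ∂(Measure.infinitePi fun _ : ℕ => P) ≤ ρ) (n : ℕ) :
    ∑' m, ∫⁻ y, pathWeight h f Γ Θ a b c κ n m y ∂(Measure.infinitePi fun _ : ℕ => P) ≤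
      ρ ^ n := by
  induction n with
  | zero =>
    rw [tsum_eq_single 0]
    · simp [pathWeight]
    · intro m hm
      simp [pathWeight, hm]
  | succ n ih =>
    calc ∑' m, ∫⁻ y, pathWeight h f Γ Θ a b c κ (n + 1) m y ∂(Measure.infinitePi fun _ : ℕ => P)
        = ∑' m, ∑ s ∈ Finset.range m,
            (∫⁻ y, pathWeight h f Γ Θ a b c κ n s y ∂(Measure.infinitePi fun _ : ℕ => P)) *
            ∫⁻ y, blockWeight h f Γ Θ a b c κ s m y ∂(Measure.infinitePi fun _ : ℕ => P) := by
          refine tsum_congr fun m => ?_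
          simp only [pathWeight]
          rw [lintegral_finsetSum _ fun s _ => by
            have h1 := measurable_pathWeight (a := a) (b := b) (c := c) (κ := κ) hmeas n s
            have h2 := measurable_blockWeight (a := a) (b := b) (c := c) (κ := κ) hmeas s m
            fun_prop]
          refine Finset.sum_congr rfl fun s _ => ?_
          refine lintegral_mul_of_dependsOn _ (measurable_pathWeight hmeas n s)
            (measurable_blockWeight hmeas s m) ?_ (dependsOn_pathWeight n s)
            (dependsOn_blockWeight s m)
          -- The past uses the samples `1, …, s`, the block the samples `s + 1, …, m`.
          rw [Finset.disjoint_left]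
          intro j hj hj'
          rw [Finset.mem_Icc] at hj
          rw [Finset.mem_Ioc] at hj'
          omega
      _ ≤ ∑' m, ∑' s,
            (∫⁻ y, pathWeight h f Γ Θ a b c κ n s y ∂(Measure.infinitePi fun _ : ℕ => P)) *
            ∫⁻ y, blockWeight h f Γ Θ a b c κ s m y ∂(Measure.infinitePi fun _ : ℕ => P) :=
          ENNReal.tsum_le_tsum fun m => ENNReal.sum_le_tsum _
      _ = ∑' s, (∫⁻ y, pathWeight h f Γ Θ a b c κ n s y ∂(Measure.infinitePi fun _ : ℕ => P)) *
            ∑' m, ∫⁻ y, blockWeight h f Γ Θ a b c κ s m y ∂(Measure.infinitePi fun _ : ℕ => P) := by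
          rw [ENNReal.tsum_comm]
          exact tsum_congr fun s => ENNReal.tsum_mul_left
      _ ≤ ∑' s, (∫⁻ y, pathWeight h f Γ Θ a b c κ n s y ∂(Measure.infinitePi fun _ : ℕ => P)) * ρ :=
          ENNReal.tsum_le_tsum fun s => by
            rw [tsum_lintegral_blockWeight P hmeas s]
            exact mul_le_mul_right hρ _
      _ ≤ ρ ^ (n + 1) := by
          rw [ENNReal.tsum_mul_right, pow_succ]
          exact mul_le_mul_left ih ρ

end Weights

end LTS

namespace LTS

/-! ### Regular families: continuity and measurability of the suprema. -/

section RegularFamilies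

variable {Y : Type*} [MeasurableSpace Y] {E F : Type*} [PseudoMetricSpace E] [PseudoMetricSpace F]

/-- The set `K` has covering numbers of polynomial growth. -/
def PolynomialCovering (K : Set E) : Prop :=
  ∃ (C : ℝ) (p : ℕ), 0 < C ∧ ∀ δ : ℝ, 0 < δ → δ ≤ 1 → ∃ N : Finset E, (N : Set E) ⊆ K ∧
    (N.card : ℝ) ≤ C * (1 / δ) ^ p ∧ ∀ x ∈ K, ∃ x' ∈ N, dist x x' ≤ δ

/-- A family of everywhere positive densities on a compact parameter set, whose logarithms are
locally Lipschitz in the parameter, with a measurable modulus `Z`. -/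
structure RegularFamily (μ : Measure Y) (q : E → Y → ℝ) (K : Set E) (Z : Y → ℝ) (r : ℝ) :
    Prop where
  nonempty : K.Nonempty
  compact : IsCompact K
  covering : PolynomialCovering K
  measurable : ∀ x ∈ K, Measurable (q x)
  pos : ∀ x ∈ K, ∀ y, 0 < q x y
  lintegral_eq_one : ∀ x ∈ K, ∫⁻ y, ENNReal.ofReal (q x y) ∂μ = 1
  measurable_modulus : Measurable Z
  modulus_nonneg : ∀ y, 0 ≤ Z y
  radius_pos : 0 < r
  lipschitz : ∀ y, ∀ x ∈ K, ∀ x' ∈ K, dist x x' < r →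
    |Real.log (q x y) - Real.log (q x' y)| ≤ Z y * dist x x'

/-- The tails of `Z` decay faster than any power, uniformly over the laws with densities `q x`,
`x ∈ K`. -/
def RapidTails (μ : Measure Y) (q : E → Y → ℝ) (K : Set E) (Z : Y → ℝ) : Prop :=
  ∀ k : ℕ, ∃ x₀ : ℝ, 0 < x₀ ∧ ∀ x, x₀ ≤ x → ∀ γ ∈ K,
    sampleLaw μ (q γ) {y | x < Z y} ≤ ENNReal.ofReal ((x ^ k)⁻¹)

/-- Two regular families, each with a modulus that has rapidly decaying tails under the other one,
and with Hellinger affinities bounded away from `1`. -/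
structure RegularModel (μ : Measure Y) (h : E → Y → ℝ) (f : F → Y → ℝ) (Γ : Set E) (Θ : Set F)
    (Zh : Y → ℝ) (rh : ℝ) (Zf : Y → ℝ) (rf : ℝ) : Prop where
  null : RegularFamily μ h Γ Zh rh
  alt : RegularFamily μ f Θ Zf rf
  tails_null : RapidTails μ h Γ Zf
  tails_alt : RapidTails μ f Θ Zh
  affinity : ∃ ρ : ℝ, 0 < ρ ∧ ρ < 1 ∧ ∀ γ ∈ Γ, ∀ θ ∈ Θ,
    ∫⁻ y, ENNReal.ofReal (√(f θ y * h γ y)) ∂μ ≤ ENNReal.ofReal ρ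

variable {μ : Measure Y} {h : E → Y → ℝ} {f : F → Y → ℝ} {Γ : Set E} {Θ : Set F}
  {Zh Zf : Y → ℝ} {rh rf : ℝ}

lemma RegularModel.swap (H : RegularModel μ h f Γ Θ Zh rh Zf rf) :
    RegularModel μ f h Θ Γ Zf rf Zh rh where
  null := H.alt
  alt := H.null
  tails_null := H.tails_alt
  tails_alt := H.tails_null
  affinity := by
    obtain ⟨ρ, h0, h1, h2⟩ := H.affinity
    exact ⟨ρ, h0, h1, fun θ hθ γ hγ => by simpa only [mul_comm] using h2 γ hγ θ hθ⟩

variable {q : E → Y → ℝ} {K : Set E} {Z : Y → ℝ} {r : ℝ}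

lemma RegularFamily.isProbabilityMeasure (H : RegularFamily μ q K Z r) {x : E} (hx : x ∈ K) :
    IsProbabilityMeasure (sampleLaw μ (q x)) :=
  ⟨by rw [sampleLaw, withDensity_apply _ MeasurableSet.univ, setLIntegral_univ,
    H.lintegral_eq_one x hx]⟩

lemma RegularFamily.continuous_sum (H : RegularFamily μ q K Z r) (y : ℕ → Y) (s : Finset ℕ) :
    Continuous fun x : K => ∑ j ∈ s, Real.log (q x (y j)) := by
  refine continuous_finsetSum _ fun j _ => ?_
  rw [continuous_iff_continuousAt]
  intro x
  rw [ContinuousAt, Metric.tendsto_nhds]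
  intro ε hε
  have h1 : ∀ᶠ x' : K in 𝓝 x, dist x' x < r := Metric.ball_mem_nhds x H.radius_pos
  have h2 : ∀ᶠ x' : K in 𝓝 x, dist x' x < ε / (Z (y j) + 1) :=
    Metric.ball_mem_nhds x (div_pos hε (by have := H.modulus_nonneg (y j); linarith))
  filter_upwards [h1, h2] with x' h1 h2
  have hZ := H.modulus_nonneg (y j)
  rw [lt_div_iff₀ (by linarith)] at h2
  have h3 := H.lipschitz (y j) x' x'.2 x x.2 h1
  rw [Real.dist_eq]
  have h4 : dist (x' : E) x = dist x' x := rfl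
  rw [h4] at h3
  nlinarith [dist_nonneg (x := x') (y := x)]

lemma RegularFamily.bddAbove_sum (H : RegularFamily μ q K Z r) (y : ℕ → Y) (s : Finset ℕ) :
    BddAbove (Set.range fun x : K => ∑ j ∈ s, Real.log (q x (y j))) := by
  have := isCompact_iff_compactSpace.1 H.compact
  exact (isCompact_range (H.continuous_sum y s)).bddAbove

/-- By continuity in the parameter, the supremum may be taken over a countable dense subset. -/
lemma RegularFamily.measurable_iSup_sum (H : RegularFamily μ q K Z r) (s : Finset ℕ) :
    Measurable fun y : ℕ → Y => ⨆ x : K, ∑ j ∈ s, Real.log (q x (y j)) := by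
  have := isCompact_iff_compactSpace.1 H.compact
  have : Nonempty K := H.nonempty.to_subtype
  obtain ⟨D, hDc, hDd⟩ := TopologicalSpace.exists_countable_dense K
  have : Countable D := hDc.to_subtype
  have heq : (fun y : ℕ → Y => ⨆ x : K, ∑ j ∈ s, Real.log (q x (y j))) =
      fun y => ⨆ x : D, ∑ j ∈ s, Real.log (q x (y j)) := by
    funext y
    exact (hDd.ciSup (H.continuous_sum y s) (H.bddAbove_sum y s)).symm
  rw [heq]
  refine Measurable.iSup fun x => Finset.measurable_fun_sum _ fun j _ => ?_
  have := H.measurable x x.1.2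
  fun_prop

lemma RegularModel.measurable_localGLR (H : RegularModel μ h f Γ Θ Zh rh Zf rf) (k t : ℕ) :
    Measurable fun y => localGLR h f Γ Θ y k t :=
  (H.alt.measurable_iSup_sum _).sub (H.null.measurable_iSup_sum _)

/-- The supremum over `Γ` is subtracted, so replacing it by the value at the true `γ` can only raise
the statistic. -/
lemma RegularModel.exists_of_lt_localGLR (H : RegularModel μ h f Γ Θ Zh rh Zf rf) {γ : E}
    (hγ : γ ∈ Γ) {y : ℕ → Y} {k t : ℕ} {c : ℝ} (hc : c < localGLR h f Γ Θ y k t) :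
    ∃ θ ∈ Θ, c < ∑ j ∈ Finset.Icc k t, logLR h f γ θ (y j) := by
  have : Nonempty Θ := H.alt.nonempty.to_subtype
  have h1 : ∑ j ∈ Finset.Icc k t, Real.log (h γ (y j)) ≤
      ⨆ γ : Γ, ∑ j ∈ Finset.Icc k t, Real.log (h γ (y j)) :=
    le_ciSup (H.null.bddAbove_sum y _) (⟨γ, hγ⟩ : Γ)
  obtain ⟨θ, hθ⟩ := exists_lt_of_lt_ciSup (lt_tsub_iff_right.1 hc)
  refine ⟨θ, θ.2, ?_⟩
  simp only [logLR, Finset.sum_sub_distrib]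
  linarith

end RegularFamilies

end LTS

namespace LTS

/-! ### Exponential bounds for the local statistic under the null hypothesis. -/

section Estimates

lemma eventually_mul_le_exp (C : ℝ) {c : ℝ} (hc : 0 < c) :
    ∀ᶠ u : ℝ in atTop, C * u ≤ Real.exp (c * u) := by
  filter_upwards [eventually_ge_atTop 0, eventually_ge_atTop (2 * C / c ^ 2)] with u h0 h1
  have h2 := Real.quadratic_le_exp_of_nonneg (mul_nonneg hc.le h0)
  rw [div_le_iff₀ (by positivity)] at h1
  nlinarith [mul_nonneg hc.le h0, mul_le_mul_of_nonneg_right h1 h0]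

lemma eventually_le_exp (C : ℝ) {c : ℝ} (hc : 0 < c) :
    ∀ᶠ u : ℝ in atTop, C ≤ Real.exp (c * u) :=
  (Real.tendsto_exp_atTop.comp (tendsto_id.const_mul_atTop hc)).eventually_ge_atTop C

variable {Y : Type*} [MeasurableSpace Y]

/-- Chernoff bound: Markov's inequality for the exponential of the sum, whose mean factorizes. -/
lemma infinitePi_sum_gt_le (P : Measure Y) [IsProbabilityMeasure P] {g : Y → ℝ}
    (hg : Measurable g) (c : ℝ) (m : ℕ) :
    (Measure.infinitePi fun _ : ℕ => P) {y | c < ∑ j ∈ Finset.Icc 1 m, g (y j)} ≤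
      ENNReal.ofReal (Real.exp (-c)) * (∫⁻ x, ENNReal.ofReal (Real.exp (g x)) ∂P) ^ m := by
  have hg' : Measurable fun x => ENNReal.ofReal (Real.exp (g x)) := by fun_prop
  have h1 := lintegral_prod_infinitePi (fun _ : ℕ => P) (Finset.Icc 1 m)
    (fun _ x => ENNReal.ofReal (Real.exp (g x))) (fun _ => hg')
  rw [Finset.prod_const, Nat.card_Icc, Nat.add_sub_cancel] at h1
  rw [← h1, ← lintegral_const_mul _ (Finset.measurable_fun_prod _ fun j _ => by fun_prop)]
  have hm : MeasurableSet {y : ℕ → Y | c < ∑ j ∈ Finset.Icc 1 m, g (y j)} :=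
    measurableSet_lt measurable_const (Finset.measurable_fun_sum _ fun j _ => by fun_prop)
  rw [← lintegral_indicator_one hm]
  refine lintegral_mono fun y => ?_
  by_cases hy : y ∈ {y : ℕ → Y | c < ∑ j ∈ Finset.Icc 1 m, g (y j)}
  · have hy' : c < ∑ j ∈ Finset.Icc 1 m, g (y j) := hy
    rw [Set.indicator_of_mem hy, ← ENNReal.ofReal_prod_of_nonneg (fun _ _ => (Real.exp_pos _).le), ← Real.exp_sum,
      ← ENNReal.ofReal_mul (Real.exp_pos _).le, ← Real.exp_add]
    rw [Pi.one_apply, ENNReal.one_le_ofReal, Real.one_le_exp_iff]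
    linarith
  · rw [Set.indicator_of_notMem hy]
    exact zero_le

variable {E F : Type*} [PseudoMetricSpace E] [PseudoMetricSpace F]
  {μ : Measure Y} {h : E → Y → ℝ} {f : F → Y → ℝ} {Γ : Set E} {Θ : Set F}
  {Zh Zf : Y → ℝ} {rh rf : ℝ}

/-- The law of the samples of one sensor. -/
noncomputable def sensorLaw (μ : Measure Y) (q : Y → ℝ) : Measure (ℕ → Y) :=
  Measure.infinitePi fun _ : ℕ => sampleLaw μ q

lemma lintegral_sampleLaw {q : Y → ℝ} (hq : Measurable q) (g : Y → ℝ≥0∞) (hg : Measurable g) :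
    ∫⁻ y, g y ∂(sampleLaw μ q) = ∫⁻ y, ENNReal.ofReal (q y) * g y ∂μ := by
  rw [sampleLaw, lintegral_withDensity_eq_lintegral_mul _ (by fun_prop) hg]
  rfl

lemma RegularModel.measurable_logLR (H : RegularModel μ h f Γ Θ Zh rh Zf rf) {γ : E} (hγ : γ ∈ Γ)
    {θ : F} (hθ : θ ∈ Θ) : Measurable (logLR h f γ θ) := by
  have h1 := H.null.measurable γ hγ
  have h2 := H.alt.measurable θ hθ
  unfold logLR
  fun_prop

lemma RegularModel.lintegral_exp_logLR (H : RegularModel μ h f Γ Θ Zh rh Zf rf) {γ : E}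
    (hγ : γ ∈ Γ) {θ : F} (hθ : θ ∈ Θ) :
    ∫⁻ y, ENNReal.ofReal (Real.exp (logLR h f γ θ y)) ∂(sampleLaw μ (h γ)) = 1 := by
  have h1 := H.measurable_logLR hγ hθ
  rw [lintegral_sampleLaw (H.null.measurable γ hγ) _ (by fun_prop), ← H.alt.lintegral_eq_one θ hθ]
  refine lintegral_congr fun y => ?_
  have h2 := H.null.pos γ hγ y
  have h3 := H.alt.pos θ hθ y
  rw [← ENNReal.ofReal_mul h2.le, logLR, Real.exp_sub, Real.exp_log h2, Real.exp_log h3,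
    mul_div_cancel₀ _ h2.ne']

/-- At exponent 1/2 the exponential moment is the Hellinger affinity, which is uniformly below 1.
The resulting decay is thus uniform in both parameters. -/
lemma RegularModel.lintegral_exp_half_logLR (H : RegularModel μ h f Γ Θ Zh rh Zf rf) {γ : E}
    (hγ : γ ∈ Γ) {θ : F} (hθ : θ ∈ Θ) :
    ∫⁻ y, ENNReal.ofReal (Real.exp (logLR h f γ θ y / 2)) ∂(sampleLaw μ (h γ)) =
      ∫⁻ y, ENNReal.ofReal (√(f θ y * h γ y)) ∂μ := by
  have h1 := H.measurable_logLR hγ hθ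
  rw [lintegral_sampleLaw (H.null.measurable γ hγ) _ (by fun_prop)]
  refine lintegral_congr fun y => ?_
  have h2 := H.null.pos γ hγ y
  have h3 := H.alt.pos θ hθ y
  rw [← ENNReal.ofReal_mul h2.le, logLR, Real.exp_half, Real.exp_sub, Real.exp_log h2,
    Real.exp_log h3]
  congr 1
  have : f θ y * h γ y = h γ y ^ 2 * (f θ y / h γ y) := by field_simp
  rw [this, Real.sqrt_mul (sq_nonneg _), Real.sqrt_sq h2.le]

/-- A net of scale `exp (-2 * e * u)` has only subexponentially many points, as covering numbers
grow polynomially. Unless one of the first `k * u` samples has a modulus above `exp (e * u)`, moving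
a parameter to the net changes the log-likelihood by at most `k * u * exp (-e * u) ≤ 1`. The tails
of the modulus beat every power, so this exception has exponentially small probability at any
prescribed rate `c`. The net is chosen before `γ`. -/
lemma RegularFamily.exists_net {E' : Type*} {q : E' → Y → ℝ} {K : Set E'}
    (hq : ∀ x ∈ K, IsProbabilityMeasure (sampleLaw μ (q x)))
    (H : RegularFamily μ f Θ Zf rf) (T : RapidTails μ q K Zf) {ε c k : ℝ} (hε : 0 < ε) :
    ∀ᶠ u : ℝ in atTop, ∃ N : Finset F, (N : Set F) ⊆ Θ ∧ (N.card : ℝ) ≤ Real.exp (ε * u) ∧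
      ∀ γ ∈ K, sensorLaw μ (q γ) {y | ¬ ∀ m : ℕ, (m : ℝ) ≤ k * u → ∀ θ ∈ Θ, ∃ θ' ∈ N,
        ∑ j ∈ Finset.Icc 1 m, Real.log (f θ (y j)) ≤
          ∑ j ∈ Finset.Icc 1 m, Real.log (f θ' (y j)) + 1} ≤
        ENNReal.ofReal (Real.exp (-(c * u))) := by
  obtain ⟨C, p, hC, hcov⟩ := H.covering
  set e : ℝ := ε / (4 * (p + 1)) with he
  have he0 : 0 < e := by positivity
  have hep : 2 * e * p ≤ ε / 2 := by
    rw [he]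
    have hp : (0 : ℝ) ≤ p := Nat.cast_nonneg p
    rw [show 2 * (ε / (4 * ((p : ℝ) + 1))) * p = (ε / 2) * (p / (p + 1)) by field_simp; ring]
    have : (p : ℝ) / (p + 1) ≤ 1 := by rw [div_le_one (by linarith)]; linarith
    nlinarith
  -- The `n`-th power makes the tail at `exp (e * u)` at most `exp (-(c + 1) * u)`. The extra `1`
  -- pays for the union over at most `exp u` samples.
  obtain ⟨n, hn⟩ := exists_nat_ge ((c + 1) / e)
  rw [div_le_iff₀ he0] at hn
  obtain ⟨x₀, hx₀, hT⟩ := T n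
  have hδr : ∀ᶠ u : ℝ in atTop, Real.exp (-(2 * e) * u) < rf := by
    have : Tendsto (fun u : ℝ => Real.exp (-(2 * e) * u)) atTop (𝓝 0) :=
      Real.tendsto_exp_atBot.comp (tendsto_id.const_mul_atTop_of_neg (by linarith))
    exact this.eventually_lt_const H.radius_pos
  filter_upwards [eventually_ge_atTop 0, eventually_le_exp C (half_pos hε), hδr,
    eventually_mul_le_exp k he0, eventually_le_exp x₀ he0,
    eventually_mul_le_exp k one_pos] with u hu0 hCu hδ hku hxu hku1
  have hδ1 : Real.exp (-(2 * e) * u) ≤ 1 := Real.exp_le_one_iff.2 (by nlinarith)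
  obtain ⟨N, hNΘ, hNc, hN⟩ := hcov _ (Real.exp_pos _) hδ1
  refine ⟨N, hNΘ, ?_, fun γ hγ => ?_⟩
  · refine hNc.trans ?_
    rw [one_div, ← Real.exp_neg, ← Real.exp_nat_mul]
    calc C * Real.exp (p * -(-(2 * e) * u)) ≤ Real.exp (ε / 2 * u) * Real.exp (ε / 2 * u) := by
          refine mul_le_mul hCu (Real.exp_le_exp.2 ?_) (Real.exp_pos _).le (Real.exp_pos _).le
          nlinarith
      _ = Real.exp (ε * u) := by rw [← Real.exp_add]; congr 1; ring
  have := hq γ hγ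
  have hsub : {y : ℕ → Y | ¬ ∀ m : ℕ, (m : ℝ) ≤ k * u → ∀ θ ∈ Θ, ∃ θ' ∈ N,
      ∑ j ∈ Finset.Icc 1 m, Real.log (f θ (y j)) ≤
        ∑ j ∈ Finset.Icc 1 m, Real.log (f θ' (y j)) + 1} ⊆
      ⋃ j ∈ Finset.Icc 1 ⌊k * u⌋₊, (fun y : ℕ → Y => y j) ⁻¹' {x | Real.exp (e * u) < Zf x} := by
    intro y hy
    by_contra hcon
    simp only [Set.mem_iUnion, not_exists] at hcon
    refine hy fun m hm θ hθ => ?_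
    obtain ⟨θ', hθ', hd⟩ := hN θ hθ
    refine ⟨θ', hθ', ?_⟩
    have hbound : ∀ j ∈ Finset.Icc 1 m, Real.log (f θ (y j)) ≤
        Real.log (f θ' (y j)) + Real.exp (-(e * u)) := by
      intro j hj
      rw [Finset.mem_Icc] at hj
      have hj' : j ∈ Finset.Icc 1 ⌊k * u⌋₊ := Finset.mem_Icc.2 ⟨hj.1, Nat.le_floor
        (le_trans (by exact_mod_cast hj.2) hm)⟩
      have hZ : Zf (y j) ≤ Real.exp (e * u) := not_lt.1 (hcon j hj')
      have h1 := H.lipschitz (y j) θ hθ θ' (hNΘ hθ') (hd.trans_lt hδ)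
      have h2 : Zf (y j) * dist θ θ' ≤ Real.exp (e * u) * Real.exp (-(2 * e) * u) :=
        mul_le_mul hZ hd dist_nonneg (Real.exp_pos _).le
      rw [← Real.exp_add, show e * u + -(2 * e) * u = -(e * u) by ring] at h2
      have h3 := (abs_le.1 (h1.trans h2)).2
      linarith
    refine (Finset.sum_le_sum hbound).trans ?_
    rw [Finset.sum_add_distrib, Finset.sum_const, Nat.card_Icc, Nat.add_sub_cancel, nsmul_eq_mul]
    have h4 : (m : ℝ) * Real.exp (-(e * u)) ≤ 1 := by
      rw [Real.exp_neg, ← div_eq_mul_inv, div_le_one (Real.exp_pos _)]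
      exact hm.trans hku
    linarith
  refine (measure_mono hsub).trans ((measure_biUnion_finset_le _ _).trans ?_)
  have hZm : MeasurableSet {x | Real.exp (e * u) < Zf x} :=
    measurableSet_lt measurable_const H.measurable_modulus
  have hev : ∀ j, sensorLaw μ (q γ) ((fun y : ℕ → Y => y j) ⁻¹' {x | Real.exp (e * u) < Zf x}) ≤
      ENNReal.ofReal (Real.exp (-((c + 1) * u))) := by
    intro j
    rw [sensorLaw, ← Measure.map_apply (by fun_prop) hZm, Measure.infinitePi_map_eval]
    refine (hT _ hxu γ hγ).trans (ENNReal.ofReal_le_ofReal ?_)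
    rw [← Real.exp_nat_mul, ← Real.exp_neg]
    refine Real.exp_le_exp.2 ?_
    nlinarith
  refine (Finset.sum_le_sum fun j _ => hev j).trans ?_
  rw [Finset.sum_const, Nat.card_Icc, Nat.add_sub_cancel, nsmul_eq_mul,
    ← ENNReal.ofReal_natCast, ← ENNReal.ofReal_mul (Nat.cast_nonneg _)]
  refine ENNReal.ofReal_le_ofReal ?_
  have h5 : ((⌊k * u⌋₊ : ℕ) : ℝ) ≤ Real.exp (1 * u) := by
    rcases le_total 0 (k * u) with h0 | h0
    · exact (Nat.floor_le h0).trans hku1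
    · rw [Nat.floor_of_nonpos h0]
      simpa using (Real.exp_pos u).le
  calc ((⌊k * u⌋₊ : ℕ) : ℝ) * Real.exp (-((c + 1) * u))
      ≤ Real.exp (1 * u) * Real.exp (-((c + 1) * u)) :=
        mul_le_mul_of_nonneg_right h5 (Real.exp_pos _).le
    _ = Real.exp (-(c * u)) := by rw [← Real.exp_add]; congr 1; ring

/-- Before time `m` large compared to `b` the local statistic falls below `-b`, up to an
exponentially small probability. -/
lemma RegularModel.exists_localGLR_tail (H : RegularModel μ h f Γ Θ Zh rh Zf rf) :
    ∃ c : ℝ, 0 < c ∧ ∀ᶠ m : ℕ in atTop, ∀ b : ℝ, b ≤ c * m → ∀ γ ∈ Γ,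
      sensorLaw μ (h γ) {y | -b < localGLR h f Γ Θ y 1 m} ≤
        ENNReal.ofReal (Real.exp (-(c * m))) := by
  obtain ⟨ρ, hρ0, hρ1, hρ⟩ := H.affinity
  set κ : ℝ := -Real.log ρ with hκ
  have hκ0 : 0 < κ := by rw [hκ]; linarith [Real.log_neg hρ0 hρ1]
  have hρκ : ρ = Real.exp (-κ) := by rw [hκ, neg_neg, Real.exp_log hρ0]
  -- The Chernoff factor is `exp (-κ * m)`. The net costs `κ * m / 8` in the exponent and the
  -- threshold `b / 2 ≤ κ * m / 16`, up to constants.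
  refine ⟨κ / 8, by positivity, ?_⟩
  have hnet := tendsto_natCast_atTop_atTop.eventually (H.alt.exists_net
    (fun γ hγ => H.null.isProbabilityMeasure hγ) H.tails_null (c := κ) (k := 1)
    (show (0 : ℝ) < κ / 8 by positivity))
  have hfour := tendsto_natCast_atTop_atTop.eventually
    (eventually_le_exp 4 (show (0 : ℝ) < κ / 8 by positivity))
  filter_upwards [hnet, hfour] with m hm h4 b hb γ hγ
  obtain ⟨N, hNΘ, hNc, hN⟩ := hm
  have := H.null.isProbabilityMeasure hγ
  have hsub : {y : ℕ → Y | -b < localGLR h f Γ Θ y 1 m} ⊆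
      {y | ¬ ∀ n : ℕ, (n : ℝ) ≤ 1 * m → ∀ θ ∈ Θ, ∃ θ' ∈ N,
        ∑ j ∈ Finset.Icc 1 n, Real.log (f θ (y j)) ≤
          ∑ j ∈ Finset.Icc 1 n, Real.log (f θ' (y j)) + 1} ∪
      -- The `1` is the error of the net, and the halving prepares the Chernoff bound with exponent
      -- 1/2.
      ⋃ θ' ∈ N, {y | (-b - 1) / 2 < ∑ j ∈ Finset.Icc 1 m, logLR h f γ θ' (y j) / 2} := by
    intro y hy
    by_cases hbad : ∀ n : ℕ, (n : ℝ) ≤ 1 * m → ∀ θ ∈ Θ, ∃ θ' ∈ N,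
        ∑ j ∈ Finset.Icc 1 n, Real.log (f θ (y j)) ≤
          ∑ j ∈ Finset.Icc 1 n, Real.log (f θ' (y j)) + 1
    · right
      obtain ⟨θ, hθ, hθs⟩ := H.exists_of_lt_localGLR hγ hy
      obtain ⟨θ', hθ', hle⟩ := hbad m (by simp) θ hθ
      simp only [Set.mem_iUnion]
      refine ⟨θ', hθ', ?_⟩
      simp only [logLR, Finset.sum_sub_distrib] at hθs
      rw [Set.mem_ofPred_eq, ← Finset.sum_div]
      simp only [logLR, Finset.sum_sub_distrib]
      linarith
    · exact Or.inl hbad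
  refine (measure_mono hsub).trans ((measure_union_le _ _).trans ?_)
  have h1 : sensorLaw μ (h γ) (⋃ θ' ∈ N, {y | (-b - 1) / 2 <
      ∑ j ∈ Finset.Icc 1 m, logLR h f γ θ' (y j) / 2}) ≤
      ENNReal.ofReal (Real.exp (κ / 8 * m) * (Real.exp ((b + 1) / 2) * Real.exp (-κ * m))) := by
    refine (measure_biUnion_finset_le _ _).trans ?_
    have h2 : ∀ θ' ∈ N, sensorLaw μ (h γ) {y | (-b - 1) / 2 <
        ∑ j ∈ Finset.Icc 1 m, logLR h f γ θ' (y j) / 2} ≤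
        ENNReal.ofReal (Real.exp ((b + 1) / 2) * Real.exp (-κ * m)) := by
      intro θ' hθ'
      have hms := H.measurable_logLR hγ (hNΘ hθ')
      refine (infinitePi_sum_gt_le (sampleLaw μ (h γ)) (g := fun y => logLR h f γ θ' y / 2)
        (by fun_prop) _ m).trans ?_
      rw [H.lintegral_exp_half_logLR hγ (hNΘ hθ'), ENNReal.ofReal_mul (Real.exp_pos _).le,
        show -((-b - 1) / 2) = (b + 1) / 2 by ring]
      refine mul_le_mul_right ((pow_le_pow_left' (hρ γ hγ θ' (hNΘ hθ')) m).trans ?_) _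
      rw [← ENNReal.ofReal_pow hρ0.le, hρκ, ← Real.exp_nat_mul]
      exact ENNReal.ofReal_le_ofReal (Real.exp_le_exp.2 (by linarith))
    refine (Finset.sum_le_sum h2).trans ?_
    rw [Finset.sum_const, nsmul_eq_mul, ← ENNReal.ofReal_natCast,
      ← ENNReal.ofReal_mul (Nat.cast_nonneg _)]
    exact ENNReal.ofReal_le_ofReal (mul_le_mul_of_nonneg_right hNc (by positivity))
  refine (add_le_add (hN γ hγ) h1).trans ?_
  rw [← ENNReal.ofReal_add (Real.exp_pos _).le (by positivity)]
  refine ENNReal.ofReal_le_ofReal ?_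
  have hm0 : (0 : ℝ) ≤ m := Nat.cast_nonneg m
  have hκm := mul_nonneg hκ0.le hm0
  have h3 : Real.exp (-(κ * m)) ≤ Real.exp (-(κ / 4 * m)) := Real.exp_le_exp.2 (by linarith)
  have h5 : Real.exp (κ / 8 * m) * (Real.exp ((b + 1) / 2) * Real.exp (-κ * m)) ≤
      2 * Real.exp (-(κ / 4 * m)) := by
    have h6 : Real.exp (1 / 2) ≤ 2 := by
      have := Real.exp_one_lt_d9
      rw [Real.exp_half]
      rw [Real.sqrt_le_left (by norm_num)]
      linarith
    calc _ = Real.exp (κ / 8 * m + (b / 2 + -κ * m)) * Real.exp (1 / 2) := by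
            simp only [← Real.exp_add]; congr 1; ring
      _ ≤ Real.exp (-(κ / 4 * m)) * 2 := by
            refine mul_le_mul (Real.exp_le_exp.2 ?_) h6 (Real.exp_pos _).le (Real.exp_pos _).le
            linarith
      _ = _ := mul_comm _ _
  have h7 : 4 * Real.exp (-(κ / 4 * m)) ≤ Real.exp (-(κ / 8 * m)) := by
    calc _ ≤ Real.exp (κ / 8 * m) * Real.exp (-(κ / 4 * m)) :=
          mul_le_mul_of_nonneg_right h4 (Real.exp_pos _).le
      _ = _ := by rw [← Real.exp_add]; congr 1; ring
  linarith [Real.exp_pos (-(κ / 4 * m))]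

/-- Under the null hypothesis a message is `1` with a probability that is at most about
`exp (-a)`. -/
lemma RegularModel.exitUp_le (H : RegularModel μ h f Γ Θ Zh rh Zf rf) {C r : ℝ} (hC : 0 < C)
    (hr : r < 1) :
    ∀ᶠ a : ℝ in atTop, ∀ b : ℝ, b ≤ C * a → ∀ γ ∈ Γ,
      sensorLaw μ (h γ) (⋃ m, exitUp h f Γ Θ a b 0 m) ≤ ENNReal.ofReal (Real.exp (-(r * a))) := by
  obtain ⟨c, hc, htail⟩ := H.exists_localGLR_tail
  -- Chosen so that `c * M ≥ (C + 1) * a` at time `M = ⌈k * a⌉₊`: this exceeds `b`, so the tail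
  -- bound applies, and also `a`, so its value is at most `exp (-a)`.
  set k : ℝ := (C + 1) / c with hk
  have hk0 : 0 < k := by positivity
  have hM : Tendsto (fun a : ℝ => ⌈k * a⌉₊) atTop atTop :=
    tendsto_nat_ceil_atTop.comp (tendsto_id.const_mul_atTop hk0)
  -- One `ε` is spent on the size of the net and one on the number `M` of times.
  set ε : ℝ := (1 - r) / 2 with hε
  have hε0 : 0 < ε := by rw [hε]; linarith
  have hnet := H.alt.exists_net (fun γ hγ => H.null.isProbabilityMeasure hγ) H.tails_null
    (c := 1) (k := k + 1) hε0
  filter_upwards [hM.eventually htail, hnet, eventually_ge_atTop 1,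
    eventually_le_exp 4 (show 0 < 2 * ε by positivity),
    eventually_mul_le_exp (2 * (k + 1) * Real.exp 2) hε0] with a ha hn ha1 h4 hlin b hb γ hγ
  obtain ⟨N, hNΘ, hNc, hN⟩ := hn
  set M := ⌈k * a⌉₊ with hMdef
  have hMlow : k * a ≤ M := Nat.le_ceil _
  have hka : 0 < k * a := by positivity
  have hMup : (M : ℝ) ≤ (k + 1) * a := by
    have := Nat.ceil_lt_add_one hka.le
    linarith
  have hMpos : 0 < M := Nat.ceil_pos.2 hka
  have hcM : (C + 1) * a ≤ c * M := by
    calc (C + 1) * a = c * (k * a) := by rw [hk]; field_simp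
      _ ≤ c * M := mul_le_mul_of_nonneg_left hMlow hc.le
  have htl := ha b (by nlinarith) γ hγ
  have := H.null.isProbabilityMeasure hγ
  have hsub : (⋃ m, exitUp h f Γ Θ a b 0 m) ⊆
      ({y | ¬ ∀ n : ℕ, (n : ℝ) ≤ (k + 1) * a → ∀ θ ∈ Θ, ∃ θ' ∈ N,
        ∑ j ∈ Finset.Icc 1 n, Real.log (f θ (y j)) ≤
          ∑ j ∈ Finset.Icc 1 n, Real.log (f θ' (y j)) + 1} ∪
      {y | -b < localGLR h f Γ Θ y 1 M}) ∪
      ⋃ m ∈ Finset.Icc 1 M, ⋃ θ' ∈ N,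
        {y | a - 2 < ∑ j ∈ Finset.Icc 1 m, logLR h f γ θ' (y j)} := by
    intro y hy
    by_cases hbad : ∀ n : ℕ, (n : ℝ) ≤ (k + 1) * a → ∀ θ ∈ Θ, ∃ θ' ∈ N,
        ∑ j ∈ Finset.Icc 1 n, Real.log (f θ (y j)) ≤
          ∑ j ∈ Finset.Icc 1 n, Real.log (f θ' (y j)) + 1
    swap
    · exact Or.inl (Or.inl hbad)
    obtain ⟨m, hm⟩ := Set.mem_iUnion.1 hy
    by_cases hmM : M < m
    -- A block that ends after `M` is still above `-b` at time `M`.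
    · exact Or.inl (Or.inr (hm.2.1 M hMpos hmM).1)
    · right
      -- One unit is given up to have a strict inequality, needed to select `θ`; the net takes
      -- another, hence `a - 2`.
      have h1 : a - 1 < localGLR h f Γ Θ y 1 m := by
        have := hm.2.2
        rw [zero_add] at this
        linarith
      obtain ⟨θ, hθ, hθs⟩ := H.exists_of_lt_localGLR hγ h1
      obtain ⟨θ', hθ', hle⟩ := hbad m
        (le_trans (by exact_mod_cast not_lt.1 hmM) hMup) θ hθ
      simp only [Set.mem_iUnion]
      refine ⟨m, Finset.mem_Icc.2 ⟨hm.1, not_lt.1 hmM⟩, θ', hθ', ?_⟩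
      simp only [logLR, Finset.sum_sub_distrib] at hθs
      simp only [Set.mem_ofPred_eq, logLR, Finset.sum_sub_distrib]
      linarith
  refine (measure_mono hsub).trans ((measure_union_le _ _).trans ?_)
  have h1 : sensorLaw μ (h γ) (⋃ m ∈ Finset.Icc 1 M, ⋃ θ' ∈ N,
        {y | a - 2 < ∑ j ∈ Finset.Icc 1 m, logLR h f γ θ' (y j)}) ≤
      ENNReal.ofReal (M * (Real.exp (ε * a) * Real.exp (-(a - 2)))) := by
    have h2 : ∀ m : ℕ, ∀ θ' ∈ N, sensorLaw μ (h γ)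
        {y | a - 2 < ∑ j ∈ Finset.Icc 1 m, logLR h f γ θ' (y j)} ≤
        ENNReal.ofReal (Real.exp (-(a - 2))) := by
      intro m θ' hθ'
      refine (infinitePi_sum_gt_le (sampleLaw μ (h γ))
        (H.measurable_logLR hγ (hNΘ hθ')) _ m).trans ?_
      rw [H.lintegral_exp_logLR hγ (hNΘ hθ'), one_pow, mul_one]
    have h3 : ∀ m : ℕ, sensorLaw μ (h γ) (⋃ θ' ∈ N,
        {y | a - 2 < ∑ j ∈ Finset.Icc 1 m, logLR h f γ θ' (y j)}) ≤
        ENNReal.ofReal (Real.exp (ε * a) * Real.exp (-(a - 2))) := by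
      intro m
      refine (measure_biUnion_finset_le _ _).trans ((Finset.sum_le_sum (h2 m)).trans ?_)
      rw [Finset.sum_const, nsmul_eq_mul, ← ENNReal.ofReal_natCast,
        ← ENNReal.ofReal_mul (Nat.cast_nonneg _)]
      exact ENNReal.ofReal_le_ofReal (mul_le_mul_of_nonneg_right hNc (by positivity))
    refine (measure_biUnion_finset_le _ _).trans ((Finset.sum_le_sum fun m _ => h3 m).trans ?_)
    rw [Finset.sum_const, Nat.card_Icc, Nat.add_sub_cancel, nsmul_eq_mul,
      ← ENNReal.ofReal_natCast, ← ENNReal.ofReal_mul (Nat.cast_nonneg _)]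
  refine (add_le_add ((measure_union_le _ _).trans (add_le_add (hN γ hγ) htl)) h1).trans ?_
  rw [← ENNReal.ofReal_add (Real.exp_pos _).le (Real.exp_pos _).le,
    ← ENNReal.ofReal_add (by positivity) (by positivity)]
  refine ENNReal.ofReal_le_ofReal ?_
  have h5 : Real.exp (-(c * M)) ≤ Real.exp (-(1 * a)) := Real.exp_le_exp.2 (by nlinarith)
  have hra : Real.exp (-(r * a)) = Real.exp (2 * ε * a) * Real.exp (-(1 * a)) := by
    rw [← Real.exp_add]; congr 1; rw [hε]; ring
  have h6 : (M : ℝ) * (Real.exp (ε * a) * Real.exp (-(a - 2))) ≤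
      Real.exp (2 * ε * a) * Real.exp (-(1 * a)) / 2 := by
    have h7 : (M : ℝ) * Real.exp 2 ≤ Real.exp (ε * a) / 2 := by
      have := mul_le_mul_of_nonneg_right hMup (Real.exp_pos 2).le
      linarith
    calc (M : ℝ) * (Real.exp (ε * a) * Real.exp (-(a - 2)))
        = (M * Real.exp 2) * (Real.exp (ε * a) * Real.exp (-(1 * a))) := by
          rw [show -(a - 2) = 2 + -(1 * a) by ring, Real.exp_add]; ring
      _ ≤ (Real.exp (ε * a) / 2) * (Real.exp (ε * a) * Real.exp (-(1 * a))) :=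
          mul_le_mul_of_nonneg_right h7 (by positivity)
      _ = _ := by
          rw [show 2 * ε * a = ε * a + ε * a by ring, Real.exp_add]; ring
  have h8 := mul_le_mul_of_nonneg_right h4 (Real.exp_pos (-(1 * a))).le
  rw [hra]
  linarith

end Estimates

end LTS

namespace LTS

/-! ### Upper bound on the error probability. -/

section UpperBound

variable {Y : Type*} [MeasurableSpace Y] {E F : Type*}
  {μ : Measure Y} {h : E → Y → ℝ} {f : F → Y → ℝ} {Γ : Set E} {Θ : Set F}
  {Zh Zf : Y → ℝ} {rh rf : ℝ} {a b : ℝ}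

lemma lintegral_tsum_blockWeight_le (P : Measure (ℕ → Y))
    (hmeas : ∀ k t, Measurable fun y => localGLR h f Γ Θ y k t) (c : ℝ) :
    ∫⁻ y, ∑' m, blockWeight h f Γ Θ a b c 0 0 m y ∂P ≤
      ENNReal.ofReal (Real.exp (c * a)) * P (⋃ m, exitUp h f Γ Θ a b 0 m) +
      ENNReal.ofReal (Real.exp (c * (-b))) * P (⋃ m, exitDown h f Γ Θ a b 0 m) := by
  have hU : MeasurableSet (⋃ m, exitUp h f Γ Θ a b 0 m) :=
    MeasurableSet.iUnion fun m => measurableSet_exitUp hmeas 0 m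
  have hD : MeasurableSet (⋃ m, exitDown h f Γ Θ a b 0 m) :=
    MeasurableSet.iUnion fun m => measurableSet_exitDown hmeas 0 m
  rw [← lintegral_indicator_const hU, ← lintegral_indicator_const hD,
    ← lintegral_add_left (measurable_const.indicator hU)]
  refine lintegral_mono fun y => tsum_blockWeight_zero_le fun m => ?_
  rw [blockWeight, zero_mul, add_zero, add_zero]
  exact add_le_add
    (Set.indicator_le_indicator_of_subset (Set.subset_iUnion _ m) (fun _ => zero_le) y)
    (Set.indicator_le_indicator_of_subset (Set.subset_iUnion _ m) (fun _ => zero_le) y)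

/-- The sum `G` over all numbers of messages and all transmission times bounds the exponentiated
contribution of a sensor at every time at once, so the law of the stopping time plays no role. Its
mean is at most a geometric series with ratio 1/2. -/
lemma jointLaw_decideOne_le {q : Y → ℝ} [IsProbabilityMeasure (sampleLaw μ q)]
    (hmeas : ∀ k t, Measurable fun y => localGLR h f Γ Θ y k t) (ha : 0 < a) (hb : 0 < b) {c : ℝ}
    (hc : 0 ≤ c)
    (hρ : ∫⁻ y, ∑' m, blockWeight h f Γ Θ a b c 0 0 m y ∂(sensorLaw μ q) ≤ 2⁻¹) (L : ℕ) (A B : ℝ) :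
    jointLaw L μ q (decideOne L h f Γ Θ a b A B) ≤ 2 ^ L * ENNReal.ofReal (Real.exp (-(c * A))) := by
  set G : (ℕ → Y) → ℝ≥0∞ := fun y => ∑' n, ∑' m, pathWeight h f Γ Θ a b c 0 n m y with hG
  have hGm : Measurable G := Measurable.tsum fun n => Measurable.tsum fun m =>
    measurable_pathWeight hmeas n m
  have hGint : ∫⁻ y, G y ∂(sensorLaw μ q) ≤ 2 := by
    rw [hG, lintegral_tsum fun n => (Measurable.tsum fun m =>
      measurable_pathWeight hmeas n m).aemeasurable]
    calc _ ≤ ∑' n : ℕ, (2⁻¹ : ℝ≥0∞) ^ n := by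
          refine ENNReal.tsum_le_tsum fun n => ?_
          rw [lintegral_tsum fun m => (measurable_pathWeight hmeas n m).aemeasurable]
          exact tsum_lintegral_pathWeight_le _ hmeas hρ n
      _ = 2 := by rw [ENNReal.tsum_geometric, ENNReal.one_sub_inv_two, inv_inv]
  have hsub : decideOne L h f Γ Θ a b A B ⊆ {ω | ENNReal.ofReal (Real.exp (c * A)) ≤
      ∏ ℓ : Fin L, G (fun j => ω (ℓ, j))} := by
    -- Only the existence of a time at which the fusion statistic is at least `A` is used.
    rintro ω ⟨t, -, ht⟩
    rw [fusionStat_eq_sum] at ht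
    have h1 : ∀ ℓ : Fin L, ENNReal.ofReal (Real.exp (c * messageSum h f Γ Θ a b
        (fun j => ω (ℓ, j)) (numMessages h f Γ Θ a b (fun j => ω (ℓ, j)) t))) ≤
        G (fun j => ω (ℓ, j)) := by
      intro ℓ
      obtain ⟨m, -, hm⟩ := transTime_numMessages (h := h) (f := f) (Γ := Γ) (Θ := Θ) (a := a)
        (b := b) (fun j => ω (ℓ, j)) t
      have h2 := le_pathWeight (c := c) (κ := 0) ha hb hm
      rw [zero_mul, add_zero] at h2
      exact h2.trans ((ENNReal.le_tsum m).trans (ENNReal.le_tsum (f := fun n => ∑' m,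
        pathWeight h f Γ Θ a b c 0 n m (fun j => ω (ℓ, j))) _))
    refine le_trans ?_ (Finset.prod_le_prod' fun ℓ _ => h1 ℓ)
    rw [← ENNReal.ofReal_prod_of_nonneg (fun _ _ => (Real.exp_pos _).le), ← Real.exp_sum,
      ← Finset.mul_sum]
    exact ENNReal.ofReal_le_ofReal (Real.exp_le_exp.2 (mul_le_mul_of_nonneg_left ht hc))
  have hmark := mul_meas_ge_le_lintegral (μ := jointLaw L μ q)
    (f := fun ω => ∏ ℓ : Fin L, G (fun j => ω (ℓ, j)))
    (Finset.measurable_fun_prod _ fun ℓ _ => hGm.comp (by fun_prop))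
    (ENNReal.ofReal (Real.exp (c * A)))
  rw [jointLaw, lintegral_prod_sensors _ G hGm, Fintype.card_fin] at hmark
  have hpow : (∫⁻ y, G y ∂(Measure.infinitePi fun _ : ℕ => sampleLaw μ q)) ^ L ≤ 2 ^ L :=
    pow_le_pow_left' hGint L
  have hle := (mul_le_mul_right (measure_mono hsub) (ENNReal.ofReal (Real.exp (c * A)))).trans
    (hmark.trans hpow)
  rw [Real.exp_neg, ENNReal.ofReal_inv_of_pos (Real.exp_pos _), ← div_eq_mul_inv,
    ENNReal.le_div_iff_mul_le (Or.inl (by simp [Real.exp_pos])) (Or.inl ENNReal.ofReal_ne_top),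
    mul_comm]
  exact hle

variable [PseudoMetricSpace E] [PseudoMetricSpace F]

/-- The upward probability is taken at a rate strictly between `r` and `1`, so that `exp (r * a)`
times it is at most 1/4. Downward blocks contribute at most `exp (-r * b) ≤ 1/4`. -/
lemma RegularModel.exists_jointLaw_decideOne_le (H : RegularModel μ h f Γ Θ Zh rh Zf rf)
    {C r : ℝ} (hC : 0 < C) (hr0 : 0 < r) (hr : r < 1) :
    ∃ a₀ : ℝ, ∀ a b : ℝ, a₀ ≤ a → a₀ ≤ b → b ≤ C * a → ∀ γ ∈ Γ, ∀ (L : ℕ) (A B : ℝ),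
      jointLaw L μ (h γ) (decideOne L h f Γ Θ a b A B) ≤
        2 ^ L * ENNReal.ofReal (Real.exp (-(r * A))) := by
  have h1 := H.exitUp_le (r := (1 + r) / 2) hC (by linarith)
  have h2 := eventually_le_exp 4 (show 0 < (1 - r) / 2 by linarith)
  have h3 := eventually_le_exp 4 hr0
  obtain ⟨a₀, ha₀⟩ := eventually_atTop.1 (h1.and (h2.and (h3.and (eventually_gt_atTop 0))))
  refine ⟨a₀, fun a b ha hb hba γ hγ L A B => ?_⟩
  have := H.null.isProbabilityMeasure hγ
  have : IsProbabilityMeasure (sensorLaw μ (h γ)) := by unfold sensorLaw; infer_instance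
  obtain ⟨h1a, h2a, -, ha0⟩ := ha₀ a ha
  obtain ⟨-, -, h3b, hb0⟩ := ha₀ b hb
  refine jointLaw_decideOne_le H.measurable_localGLR ha0 hb0 hr0.le ?_ L A B
  refine (lintegral_tsum_blockWeight_le _ H.measurable_localGLR r).trans ?_
  have h4 : ENNReal.ofReal (Real.exp (r * a)) *
      sensorLaw μ (h γ) (⋃ m, exitUp h f Γ Θ a b 0 m) ≤ ENNReal.ofReal 4⁻¹ := by
    refine (mul_le_mul_right (h1a b hba γ hγ) _).trans ?_
    rw [← ENNReal.ofReal_mul (Real.exp_pos _).le, ← Real.exp_add]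
    refine ENNReal.ofReal_le_ofReal ?_
    rw [show r * a + -((1 + r) / 2 * a) = -((1 - r) / 2 * a) by ring, Real.exp_neg]
    exact inv_anti₀ (by norm_num) h2a
  have h5 : ENNReal.ofReal (Real.exp (r * -b)) *
      sensorLaw μ (h γ) (⋃ m, exitDown h f Γ Θ a b 0 m) ≤ ENNReal.ofReal 4⁻¹ := by
    refine (mul_le_mul_right prob_le_one _).trans ?_
    rw [mul_one]
    refine ENNReal.ofReal_le_ofReal ?_
    rw [show r * -b = -(r * b) by ring, Real.exp_neg]
    exact inv_anti₀ (by norm_num) h3b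
  refine (add_le_add h4 h5).trans (le_of_eq ?_)
  rw [← ENNReal.ofReal_add (by norm_num) (by norm_num), show (4⁻¹ + 4⁻¹ : ℝ) = 2⁻¹ by norm_num,
    ENNReal.ofReal_inv_of_pos (by norm_num)]
  simp

end UpperBound

end LTS

namespace LTS

open ProbabilityTheory

/-! ### Laws of large numbers for the likelihood ratios. -/

section LawOfLargeNumbers

variable {Y : Type*} [MeasurableSpace Y]

lemma tendsto_average_infinitePi (P : Measure Y) [IsProbabilityMeasure P] {g : Y → ℝ}
    (hg : Measurable g) (hgi : Integrable g P) :
    ∀ᵐ y ∂(Measure.infinitePi fun _ : ℕ => P),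
      Tendsto (fun n : ℕ => (∑ j ∈ Finset.Icc 1 n, g (y j)) / n) atTop (𝓝 (∫ x, g x ∂P)) := by
  have hmap : ∀ i : ℕ, (Measure.infinitePi fun _ : ℕ => P).map (fun y => y i) = P := fun i =>
    Measure.infinitePi_map_eval (fun _ : ℕ => P) i
  have hmp : ∀ i : ℕ, MeasurePreserving (fun y : ℕ → Y => y i)
      (Measure.infinitePi fun _ : ℕ => P) P := fun i => ⟨by fun_prop, hmap i⟩
  have hind : iIndepFun (fun (i : ℕ) (y : ℕ → Y) => g (y i)) (Measure.infinitePi fun _ : ℕ => P) :=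
    iIndepFun_infinitePi (fun _ => hg)
  have hid : ∀ i, IdentDistrib (fun y : ℕ → Y => g (y (i + 1))) (fun y => g (y (0 + 1)))
      (Measure.infinitePi fun _ : ℕ => P) (Measure.infinitePi fun _ : ℕ => P) := by
    intro i
    have h1 : IdentDistrib (fun y : ℕ → Y => y (i + 1)) (fun y => y (0 + 1))
      (Measure.infinitePi fun _ : ℕ => P) (Measure.infinitePi fun _ : ℕ => P) :=
      ⟨(measurable_pi_apply _).aemeasurable, (measurable_pi_apply _).aemeasurable,
        by rw [hmap, hmap]⟩
    exact h1.comp hg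
  -- Samples are numbered from 1, whereas the strong law sums from 0.
  have h := strong_law_ae_real (fun (i : ℕ) (y : ℕ → Y) => g (y (i + 1)))
    ((hmp (0 + 1)).integrable_comp_of_integrable hgi)
    (fun i j hij => hind.indepFun (fun h => hij (Nat.succ_injective h))) hid
  have hint : ∫ y, g (y (0 + 1)) ∂(Measure.infinitePi fun _ : ℕ => P) = ∫ x, g x ∂P := by
    rw [← integral_map (f := g) (φ := fun y : ℕ → Y => y (0 + 1))
      (measurable_pi_apply _).aemeasurable
      (by rw [hmap]; exact hgi.aestronglyMeasurable), hmap]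
  rw [hint] at h
  filter_upwards [h] with y hy
  refine hy.congr fun n => ?_
  rw [Finset.range_eq_Ico, Finset.sum_Ico_add' (fun j => g (y j)) 0 n 1]
  rfl

lemma tendsto_measure_zero_of_ae_eventually_notMem {Ω : Type*} [MeasurableSpace Ω]
    {P : Measure Ω} [IsFiniteMeasure P] {S : ℕ → Set Ω} (hS : ∀ n, MeasurableSet (S n))
    (h : ∀ᵐ ω ∂P, ∀ᶠ n in atTop, ω ∉ S n) : Tendsto (fun n => P (S n)) atTop (𝓝 0) := by
  have := tendsto_measure_of_ae_tendsto_indicator_of_isFiniteMeasure (μ := P) (A := ∅) (As := S)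
    atTop MeasurableSet.empty hS (by
      filter_upwards [h] with ω hω
      filter_upwards [hω] with n hn
      simp [hn])
  simpa using this

lemma tendsto_measure_sum_gt (P : Measure Y) [IsProbabilityMeasure P] {g : Y → ℝ}
    (hg : Measurable g) (hgi : Integrable g P) {D : ℝ} (hD : ∫ x, g x ∂P < D) :
    Tendsto (fun n : ℕ => (Measure.infinitePi fun _ : ℕ => P)
      {y | n * D < ∑ j ∈ Finset.Icc 1 n, g (y j)}) atTop (𝓝 0) := by
  refine tendsto_measure_zero_of_ae_eventually_notMem (fun n => measurableSet_lt measurable_const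
    (Finset.measurable_fun_sum _ fun j _ => by fun_prop)) ?_
  filter_upwards [tendsto_average_infinitePi P hg hgi] with y hy
  filter_upwards [hy.eventually_lt_const hD, eventually_gt_atTop 0] with n hn hn0
  rw [div_lt_iff₀ (by exact_mod_cast hn0)] at hn
  simp only [not_lt]
  linarith

variable {E F : Type*} [PseudoMetricSpace E] [PseudoMetricSpace F]
  {μ : Measure Y} {h : E → Y → ℝ} {f : F → Y → ℝ} {Γ : Set E} {Θ : Set F}
  {Zh Zf : Y → ℝ} {rh rf : ℝ}

/-- `Z` is at most the number of integers `n ≥ 0` below it, and the tails at `n` are eventually at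
most `n ^ (-2)`. -/
lemma RapidTails.integrable {E' : Type*} {q : E' → Y → ℝ} {K : Set E'} {Z : Y → ℝ}
    (T : RapidTails μ q K Z) {x : E'} (hx : x ∈ K) [IsProbabilityMeasure (sampleLaw μ (q x))]
    (hZ : Measurable Z) (hZ0 : ∀ y, 0 ≤ Z y) : Integrable Z (sampleLaw μ (q x)) := by
  refine ⟨hZ.aestronglyMeasurable, ?_⟩
  rw [hasFiniteIntegral_iff_ofReal (Eventually.of_forall hZ0)]
  have hms : ∀ n : ℕ, MeasurableSet {y | (n : ℝ) < Z y} := fun n =>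
    measurableSet_lt measurable_const hZ
  have hpt : ∀ y, ENNReal.ofReal (Z y) ≤
      ∑' n : ℕ, {y | (n : ℝ) < Z y}.indicator (fun _ => (1 : ℝ≥0∞)) y := by
    intro y
    calc ENNReal.ofReal (Z y) ≤ ENNReal.ofReal (⌈Z y⌉₊ : ℝ) :=
          ENNReal.ofReal_le_ofReal (Nat.le_ceil _)
      _ = ∑ n ∈ Finset.range ⌈Z y⌉₊, {y | (n : ℝ) < Z y}.indicator (fun _ => (1 : ℝ≥0∞)) y := by
          rw [Finset.sum_congr rfl (g := fun _ => (1 : ℝ≥0∞))]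
          · simp
          · intro n hn
            rw [Finset.mem_range, Nat.lt_ceil] at hn
            exact Set.indicator_of_mem (show y ∈ {y | (n : ℝ) < Z y} from hn) _
      _ ≤ _ := ENNReal.sum_le_tsum _
  refine (lintegral_mono hpt).trans_lt ?_
  rw [lintegral_tsum fun n => (measurable_const.indicator (hms n)).aemeasurable]
  simp_rw [lintegral_indicator_const (hms _), one_mul]
  obtain ⟨x₀, hx₀, hT⟩ := T 2
  obtain ⟨n₀, hn₀⟩ := exists_nat_ge (x₀ + 1)
  rw [← ENNReal.summable.sum_add_tsum_nat_add' (f := fun n : ℕ =>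
    sampleLaw μ (q x) {y | (n : ℝ) < Z y}) (k := n₀)]
  refine ENNReal.add_lt_top.2 ⟨ENNReal.sum_lt_top.2 fun n _ => measure_lt_top _ _, ?_⟩
  have hle : ∀ n : ℕ, sampleLaw μ (q x) {y | ((n + n₀ : ℕ) : ℝ) < Z y} ≤
      ENNReal.ofReal ((((n + n₀ : ℕ) : ℝ) ^ 2)⁻¹) := fun n => hT _ (by
        push_cast
        have : (0 : ℝ) ≤ n := Nat.cast_nonneg n
        linarith) x hx
  refine (ENNReal.tsum_le_tsum hle).trans_lt ?_
  have hsum : Summable fun n : ℕ => (((n + n₀ : ℕ) : ℝ) ^ 2)⁻¹ :=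
    (summable_nat_add_iff n₀).2 (Real.summable_nat_pow_inv.2 one_lt_two)
  rw [← ENNReal.ofReal_tsum_of_nonneg (fun n => by positivity) hsum]
  exact ENNReal.ofReal_lt_top

/-- Under the alternative the local statistic grows at least at the rate of the smallest
divergence from the null hypothesis. -/
lemma RegularModel.tendsto_localGLR_lt (H : RegularModel μ h f Γ Θ Zh rh Zf rf) {θ : F}
    (hθ : θ ∈ Θ) {D D' : ℝ} (hint : ∀ γ ∈ Γ, Integrable (logLR h f γ θ) (sampleLaw μ (f θ)))
    (hD : ∀ γ ∈ Γ, D ≤ ∫ y, logLR h f γ θ y ∂(sampleLaw μ (f θ))) (hDD : D' < D) :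
    Tendsto (fun m : ℕ => sensorLaw μ (f θ) {y | localGLR h f Γ Θ y 1 m < m * D'}) atTop
      (𝓝 0) := by
  have := H.alt.isProbabilityMeasure hθ
  have : IsProbabilityMeasure (sensorLaw μ (f θ)) := by unfold sensorLaw; infer_instance
  refine tendsto_measure_zero_of_ae_eventually_notMem (fun m =>
    measurableSet_lt (H.measurable_localGLR 1 m) measurable_const) ?_
  have hZi := H.tails_alt.integrable hθ H.null.measurable_modulus H.null.modulus_nonneg
  set z := ∫ y, Zh y ∂(sampleLaw μ (f θ)) with hz
  have hz0 : 0 ≤ z := integral_nonneg H.null.modulus_nonneg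
  obtain ⟨C, p, -, hcov⟩ := H.null.covering
  -- Small enough for the Lipschitz bound to apply and for passing to the net to cost at most half
  -- of the gap `D - D'` per sample. The other half is left to the law of large numbers on the
  -- finite net.
  set δ : ℝ := min (min 1 (rh / 2)) ((D - D') / (2 * (z + 1))) with hδ
  have hδ0 : 0 < δ := lt_min (lt_min one_pos (half_pos H.null.radius_pos))
    (div_pos (by linarith) (by linarith))
  have hδr : δ < rh := ((min_le_left _ _).trans (min_le_right _ _)).trans_lt
    (half_lt_self H.null.radius_pos)
  have hδz : δ * (z + 1) ≤ (D - D') / 2 := by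
    have h1 : δ ≤ (D - D') / (2 * (z + 1)) := min_le_right _ _
    rw [le_div_iff₀ (by linarith)] at h1
    linarith
  obtain ⟨N, hNΓ, -, hN⟩ := hcov δ hδ0 ((min_le_left _ _).trans (min_le_left _ _))
  have hall : ∀ᵐ y ∂(sensorLaw μ (f θ)), ∀ γ ∈ N, Tendsto (fun n : ℕ =>
      (∑ j ∈ Finset.Icc 1 n, logLR h f γ θ (y j)) / n) atTop
      (𝓝 (∫ y, logLR h f γ θ y ∂(sampleLaw μ (f θ)))) :=
    (ae_ball_iff N.countable_toSet).2 fun γ hγ => tendsto_average_infinitePi _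
      (H.measurable_logLR (hNΓ hγ) hθ) (hint γ (hNΓ hγ))
  filter_upwards [hall, tendsto_average_infinitePi _ H.null.measurable_modulus hZi] with y hy hyZ
  have hN' : ∀ᶠ n : ℕ in atTop, ∀ γ ∈ N, D - (D - D') / 2 <
      (∑ j ∈ Finset.Icc 1 n, logLR h f γ θ (y j)) / n := by
    rw [eventually_all_finset]
    intro γ hγ
    exact (hy γ hγ).eventually_const_lt (by have := hD γ (hNΓ hγ); linarith)
  filter_upwards [hN', hyZ.eventually_lt_const (lt_add_one z), eventually_gt_atTop 0]
    with n hn hnZ hn0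
  have hn0' : (0 : ℝ) < n := by exact_mod_cast hn0
  rw [div_lt_iff₀ hn0'] at hnZ
  simp only [not_lt]
  have : Nonempty Γ := H.null.nonempty.to_subtype
  have hsup : ⨆ γ : Γ, ∑ j ∈ Finset.Icc 1 n, Real.log (h γ (y j)) ≤
      ∑ j ∈ Finset.Icc 1 n, Real.log (f θ (y j)) - n * D' := by
    refine ciSup_le fun γ => ?_
    obtain ⟨γ', hγ', hd⟩ := hN γ γ.2
    have h1 := hn γ' hγ'
    rw [lt_div_iff₀ hn0'] at h1
    simp only [logLR, Finset.sum_sub_distrib] at h1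
    have h2 : ∑ j ∈ Finset.Icc 1 n, Real.log (h γ (y j)) ≤
        ∑ j ∈ Finset.Icc 1 n, (Real.log (h γ' (y j)) + Zh (y j) * δ) := by
      refine Finset.sum_le_sum fun j _ => ?_
      have h3 := (abs_le.1 (H.null.lipschitz (y j) γ γ.2 γ' (hNΓ hγ') (hd.trans_lt hδr))).2
      have h4 := mul_le_mul_of_nonneg_left hd (H.null.modulus_nonneg (y j))
      linarith
    rw [Finset.sum_add_distrib, ← Finset.sum_mul] at h2
    have h5 : (∑ j ∈ Finset.Icc 1 n, Zh (y j)) * δ ≤ n * ((D - D') / 2) := by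
      have := mul_le_mul_of_nonneg_right hnZ.le hδ0.le
      have := mul_le_mul_of_nonneg_left hδz hn0'.le
      linarith
    linarith
  have hle : ∑ j ∈ Finset.Icc 1 n, Real.log (f θ (y j)) ≤
      ⨆ θ : Θ, ∑ j ∈ Finset.Icc 1 n, Real.log (f θ (y j)) :=
    le_ciSup (H.alt.bddAbove_sum y _) (⟨θ, hθ⟩ : Θ)
  rw [localGLR]
  linarith

end LawOfLargeNumbers

end LTS

namespace LTS

/-! ### Unfavourable events for a single sensor. -/

section Events

variable {Y E F : Type*} (h : E → Y → ℝ) (f : F → Y → ℝ) (Γ : Set E) (Θ : Set F) (a b : ℝ)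

/-- An event that contains all paths on which, for some `k ≥ 1`, the first `k` messages are sent by
time `n` and contribute at most `k * v` to the fusion statistic. -/
def lowSet (c v : ℝ) (n : ℕ) : Set (ℕ → Y) :=
  {y | 1 ≤ ∑' k : ℕ, ∑ s ∈ Finset.range (n + 1),
    ENNReal.ofReal (Real.exp (c * ((k + 1) * v))) * pathWeight h f Γ Θ a b (-c) 0 (k + 1) s y}

/-- The event that the `k`-th message is not sent by time `n`. -/
def lateSet (k n : ℕ) : Set (ℕ → Y) :=
  {y | ∀ s ∈ Finset.range (n + 1), pathWeight h f Γ Θ a b 0 0 k s y = 0}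

variable {h f Γ Θ a b}

/-- The event is phrased through path weights so that it is determined by the first `n` samples, as
the change of measure requires. -/
lemma dependsOn_lowSet (c v : ℝ) (n : ℕ) :
    DependsOn (· ∈ lowSet h f Γ Θ a b c v n) (Finset.Icc 1 n : Set ℕ) := by
  intro y y' hyy
  have h1 : ∀ k, ∀ s ∈ Finset.range (n + 1), pathWeight h f Γ Θ a b (-c) 0 (k + 1) s y =
      pathWeight h f Γ Θ a b (-c) 0 (k + 1) s y' := by
    intro k s hs
    refine dependsOn_pathWeight _ _ fun j hj => hyy j ?_
    simp only [Finset.mem_range, Finset.coe_Icc, Set.mem_Icc] at *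
    omega
  have h2 : ∑' k : ℕ, ∑ s ∈ Finset.range (n + 1),
      ENNReal.ofReal (Real.exp (c * ((k + 1) * v))) * pathWeight h f Γ Θ a b (-c) 0 (k + 1) s y =
      ∑' k : ℕ, ∑ s ∈ Finset.range (n + 1),
      ENNReal.ofReal (Real.exp (c * ((k + 1) * v))) * pathWeight h f Γ Θ a b (-c) 0 (k + 1) s y' :=
    tsum_congr fun k => Finset.sum_congr rfl fun s hs => by rw [h1 k s hs]
  simp only [lowSet, Set.mem_ofPred_eq, h2]

lemma dependsOn_lateSet (k n : ℕ) :
    DependsOn (· ∈ lateSet h f Γ Θ a b k n) (Finset.Icc 1 n : Set ℕ) := by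
  intro y y' hyy
  have h1 : ∀ s ∈ Finset.range (n + 1), pathWeight h f Γ Θ a b 0 0 k s y =
      pathWeight h f Γ Θ a b 0 0 k s y' := by
    intro s hs
    refine dependsOn_pathWeight _ _ fun j hj => hyy j ?_
    simp only [Finset.mem_range, Finset.coe_Icc, Set.mem_Icc] at *
    omega
  exact propext (forall₂_congr fun s hs => by rw [h1 s hs])

lemma lt_messageSum_of_notMem_lowSet (ha : 0 < a) (hb : 0 < b) {c v : ℝ} (hc : 0 < c) {n : ℕ}
    {y : ℕ → Y} (hy : y ∉ lowSet h f Γ Θ a b c v n) {k s : ℕ} (hsn : s ≤ n)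
    (hs : transTime h f Γ Θ a b y (k + 1) = s) :
    ((k : ℝ) + 1) * v < messageSum h f Γ Θ a b y (k + 1) := by
  by_contra hcon
  refine hy ?_
  rw [lowSet, Set.mem_ofPred_eq]
  refine le_trans ?_ (ENNReal.le_tsum k)
  refine le_trans ?_ (Finset.single_le_sum (fun _ _ => zero_le)
    (Finset.mem_range.2 (Nat.lt_succ_of_le hsn)))
  refine le_trans ?_ (mul_le_mul_right (le_pathWeight (c := -c) (κ := 0) ha hb hs) _)
  rw [← ENNReal.ofReal_mul (Real.exp_pos _).le, ← Real.exp_add, ENNReal.one_le_ofReal,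
    Real.one_le_exp_iff]
  nlinarith [mul_le_mul_of_nonneg_left (not_lt.1 hcon) hc.le]

lemma exists_transTime_of_notMem_lateSet {k n : ℕ} {y : ℕ → Y}
    (hy : y ∉ lateSet h f Γ Θ a b k n) : ∃ s ≤ n, transTime h f Γ Θ a b y k = s := by
  simp only [lateSet, Set.mem_ofPred_eq, not_forall] at hy
  obtain ⟨s, hs, hne⟩ := hy
  exact ⟨s, Nat.lt_succ_iff.1 (Finset.mem_range.1 hs), transTime_of_pathWeight_ne_zero hne⟩

lemma exists_transTime_of_forall_exit {y : ℕ → Y}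
    (hy : ∀ s, ∃ m, y ∈ exitUp h f Γ Θ a b s m ∨ y ∈ exitDown h f Γ Θ a b s m) (k : ℕ) :
    ∃ s : ℕ, transTime h f Γ Θ a b y k = s := by
  induction k with
  | zero => exact ⟨0, rfl⟩
  | succ k ih =>
    obtain ⟨s, hs⟩ := ih
    obtain ⟨m, hm⟩ := hy s
    exact ⟨m, transTime_succ_eq_coe.2 ⟨s, hs, hm⟩⟩

lemma localGLR_mem_Ioo_of_forall_notMem_exit {y : ℕ → Y}
    (hy : ∀ m, y ∉ exitUp h f Γ Θ a b 0 m ∧ y ∉ exitDown h f Γ Θ a b 0 m) {m : ℕ} (hm : 0 < m) :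
    localGLR h f Γ Θ y 1 m ∈ Set.Ioo (-b) a := by
  induction m using Nat.strong_induction_on with
  | _ m ih =>
    by_contra hcon
    rw [Set.mem_Ioo, not_and_or, not_lt, not_lt] at hcon
    rcases hcon with h1 | h1
    · exact (hy m).2 ⟨hm, fun t h0 ht => ih t ht h0, h1⟩
    · exact (hy m).1 ⟨hm, fun t h0 ht => ih t ht h0, h1⟩

/-- Three ranges of the exit time `m`: up to `m₀` the trivial bound holds; between `m₀` and `J` the
statistic was below `a` at time `m₀`; beyond `J` it was below `a` at time `m - 1 = J + i`. -/
lemma blockWeight_time_le {κ : ℝ} (ha : 0 < a) (hb : 0 < b) (hκ : 0 ≤ κ) {m₀ J : ℕ}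
    (hm₀ : 0 < m₀) (hJ : 0 < J) (m : ℕ) (y : ℕ → Y) :
    blockWeight h f Γ Θ a b 0 κ 0 m y ≤ ENNReal.ofReal (Real.exp (κ * m₀)) +
      ({y | localGLR h f Γ Θ y 1 m₀ < a}.indicator
        (fun _ => ENNReal.ofReal (Real.exp (κ * J))) y +
      ∑' i : ℕ, {y | localGLR h f Γ Θ y 1 (J + i) < a}.indicator
        (fun _ => ENNReal.ofReal (Real.exp (κ * (J + i + 1)))) y) := by
  by_cases hex : y ∈ exitUp h f Γ Θ a b 0 m ∨ y ∈ exitDown h f Γ Θ a b 0 m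
  swap
  · push Not at hex
    simp [blockWeight, hex.1, hex.2]
  have hval : blockWeight h f Γ Θ a b 0 κ 0 m y = ENNReal.ofReal (Real.exp (κ * m)) := by
    rcases hex with h1 | h1
    · have h2 : y ∉ exitDown h f Γ Θ a b 0 m := fun h2 => by
        have := h1.2.2
        have := h2.2.2
        linarith
      simp [blockWeight, h1, h2]
    · have h2 : y ∉ exitUp h f Γ Θ a b 0 m := fun h2 => by
        have := h1.2.2
        have := h2.2.2
        linarith
      simp [blockWeight, h1, h2]
  have hin : ∀ t, 0 < t → t < m → localGLR h f Γ Θ y 1 t < a := by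
    rcases hex with h1 | h1 <;> exact fun t h0 ht => (h1.2.1 t h0 ht).2
  have hmono : ∀ u v : ℝ, u ≤ v → ENNReal.ofReal (Real.exp (κ * u)) ≤
      ENNReal.ofReal (Real.exp (κ * v)) := fun u v huv =>
    ENNReal.ofReal_le_ofReal (Real.exp_le_exp.2 (mul_le_mul_of_nonneg_left huv hκ))
  rw [hval]
  rcases le_or_gt m m₀ with h1 | h1
  · exact (hmono _ _ (by exact_mod_cast h1)).trans le_self_add
  rcases le_or_gt m J with h2 | h2
  · refine le_trans ?_ (le_add_self.trans' le_self_add)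
    rw [Set.indicator_of_mem (show y ∈ {y | localGLR h f Γ Θ y 1 m₀ < a} from hin m₀ hm₀ h1)]
    exact hmono _ _ (by exact_mod_cast h2)
  · refine le_trans ?_ (le_add_self.trans' le_add_self)
    refine le_trans ?_ (ENNReal.le_tsum (m - 1 - J))
    have h3 : J + (m - 1 - J) = m - 1 := by omega
    rw [Set.indicator_of_mem]
    · refine hmono _ _ ?_
      have : ((J + (m - 1 - J) + 1 : ℕ) : ℝ) = m := by congr 1; omega
      push_cast at this
      exact this.ge
    · show localGLR h f Γ Θ y 1 (J + (m - 1 - J)) < a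
      rw [h3]
      exact hin _ (by omega) (by omega)

/-- Off the unfavourable events every sensor contributes at least `v` per message, so the fusion
statistic is never negative and is at least `L * k * v` at time `n`. A sensor may have sent more
than `k` messages, so the bound is needed for every number of messages. -/
lemma mem_decideOne_of_forall_notMem {A B v c : ℝ} {L n k : ℕ} (ha : 0 < a) (hb : 0 < b)
    (hB : 0 < B) (hv : 0 < v) (hc : 0 < c) (hA : A ≤ L * (k * v))
    {ω : Fin L × ℕ → Y}
    (hω : ∀ ℓ, (fun j => ω (ℓ, j)) ∉ lowSet h f Γ Θ a b c v n ∪ lateSet h f Γ Θ a b k n) :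
    ω ∈ decideOne L h f Γ Θ a b A B := by
  have hlow : ∀ ℓ t, t ≤ n → (numMessages h f Γ Θ a b (fun j => ω (ℓ, j)) t : ℝ) * v ≤
      messageSum h f Γ Θ a b (fun j => ω (ℓ, j))
        (numMessages h f Γ Θ a b (fun j => ω (ℓ, j)) t) := by
    intro ℓ t ht
    obtain ⟨m, hm, hN⟩ := transTime_numMessages (h := h) (f := f) (Γ := Γ) (Θ := Θ) (a := a)
      (b := b) (fun j => ω (ℓ, j)) t
    rcases hcase : numMessages h f Γ Θ a b (fun j => ω (ℓ, j)) t with _ | N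
    · simp [messageSum_zero]
    · rw [hcase] at hN
      have := lt_messageSum_of_notMem_lowSet ha hb hc (fun hl => hω ℓ (Or.inl hl))
        (hm.trans ht) hN
      push_cast
      exact this.le
  refine mem_decideOne_of_forall_pos ω n (fun t ht => ?_) ?_
  · rw [fusionStat_eq_sum]
    refine lt_of_lt_of_le (neg_lt_zero.2 hB) (Finset.sum_nonneg fun ℓ _ => ?_)
    exact le_trans (by positivity) (hlow ℓ t ht)
  · rw [fusionStat_eq_sum]
    have h1 : ∀ ℓ : Fin L, (k : ℝ) * v ≤ messageSum h f Γ Θ a b (fun j => ω (ℓ, j))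
        (numMessages h f Γ Θ a b (fun j => ω (ℓ, j)) n) := by
      intro ℓ
      obtain ⟨s, hs, hts⟩ := exists_transTime_of_notMem_lateSet (fun hl => hω ℓ (Or.inr hl))
      refine le_trans ?_ (hlow ℓ n le_rfl)
      exact mul_le_mul_of_nonneg_right (by exact_mod_cast le_numMessages hts hs) hv.le
    refine hA.trans ?_
    calc (L : ℝ) * (k * v) = ∑ _ℓ : Fin L, (k : ℝ) * v := by simp
      _ ≤ _ := Finset.sum_le_sum fun ℓ _ => h1 ℓ

variable [MeasurableSpace Y] (P : Measure Y) [IsProbabilityMeasure P]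

lemma measurableSet_lowSet (hmeas : ∀ k t, Measurable fun y => localGLR h f Γ Θ y k t)
    (c v : ℝ) (n : ℕ) : MeasurableSet (lowSet h f Γ Θ a b c v n) :=
  measurableSet_le measurable_const (Measurable.tsum fun k => Finset.measurable_fun_sum _
    fun s _ => (measurable_pathWeight hmeas (k + 1) s).const_mul _)

lemma measurableSet_lateSet (hmeas : ∀ k t, Measurable fun y => localGLR h f Γ Θ y k t)
    (k n : ℕ) : MeasurableSet (lateSet h f Γ Θ a b k n) := by
  have : lateSet h f Γ Θ a b k n = ⋂ s ∈ Finset.range (n + 1),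
      pathWeight h f Γ Θ a b 0 0 k s ⁻¹' {0} := by
    ext y
    simp [lateSet]
  rw [this]
  exact Finset.measurableSet_biInter _ fun s _ =>
    measurable_pathWeight hmeas k s (measurableSet_singleton 0)

/-- Markov's inequality, where the series over the number of messages is geometric with ratio at
most 1/2. -/
lemma measure_lowSet_le (hmeas : ∀ k t, Measurable fun y => localGLR h f Γ Θ y k t)
    {c v ρ : ℝ} (hρ0 : 0 ≤ ρ)
    (hρ : ∫⁻ y, ∑' m, blockWeight h f Γ Θ a b (-c) 0 0 m y
      ∂(Measure.infinitePi fun _ : ℕ => P) ≤ ENNReal.ofReal ρ)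
    (hx : Real.exp (c * v) * ρ ≤ 2⁻¹) (n : ℕ) :
    (Measure.infinitePi fun _ : ℕ => P) (lowSet h f Γ Θ a b c v n) ≤
      ENNReal.ofReal (2 * (Real.exp (c * v) * ρ)) := by
  set x := Real.exp (c * v) * ρ with hxdef
  have hx0 : 0 ≤ x := by positivity
  have hmk : ∀ k : ℕ, Measurable fun y => ∑ s ∈ Finset.range (n + 1),
      ENNReal.ofReal (Real.exp (c * ((k + 1) * v))) *
        pathWeight h f Γ Θ a b (-c) 0 (k + 1) s y := fun k =>
    Finset.measurable_fun_sum _ fun s _ => (measurable_pathWeight hmeas (k + 1) s).const_mul _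
  have hmark := mul_meas_ge_le_lintegral (μ := Measure.infinitePi fun _ : ℕ => P)
    (f := fun y => ∑' k : ℕ, ∑ s ∈ Finset.range (n + 1),
      ENNReal.ofReal (Real.exp (c * ((k + 1) * v))) * pathWeight h f Γ Θ a b (-c) 0 (k + 1) s y)
    (Measurable.tsum hmk) 1
  rw [one_mul] at hmark
  refine hmark.trans ?_
  rw [lintegral_tsum fun k => (hmk k).aemeasurable]
  have hterm : ∀ k : ℕ, ∫⁻ y, ∑ s ∈ Finset.range (n + 1),
      ENNReal.ofReal (Real.exp (c * ((k + 1) * v))) * pathWeight h f Γ Θ a b (-c) 0 (k + 1) s y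
        ∂(Measure.infinitePi fun _ : ℕ => P) ≤ ENNReal.ofReal (x * 2⁻¹ ^ k) := by
    intro k
    simp_rw [← Finset.mul_sum]
    rw [lintegral_const_mul _ (Finset.measurable_fun_sum _ fun s _ =>
      measurable_pathWeight hmeas (k + 1) s), lintegral_finsetSum _ fun s _ =>
      measurable_pathWeight hmeas (k + 1) s]
    calc _ ≤ ENNReal.ofReal (Real.exp (c * ((k + 1) * v))) * ENNReal.ofReal ρ ^ (k + 1) :=
          mul_le_mul_right ((ENNReal.sum_le_tsum _).trans
            (tsum_lintegral_pathWeight_le P hmeas hρ (k + 1))) _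
      _ = ENNReal.ofReal (x ^ (k + 1)) := by
          rw [← ENNReal.ofReal_pow hρ0, ← ENNReal.ofReal_mul (Real.exp_pos _).le, hxdef, mul_pow,
            ← Real.exp_nat_mul]
          congr 3
          push_cast
          ring
      _ ≤ _ := by
          refine ENNReal.ofReal_le_ofReal ?_
          rw [pow_succ, mul_comm]
          exact mul_le_mul_of_nonneg_left (pow_le_pow_left₀ hx0 hx k) hx0
  refine (ENNReal.tsum_le_tsum hterm).trans (le_of_eq ?_)
  have hgeo : Summable fun k : ℕ => (2⁻¹ : ℝ) ^ k :=
    summable_geometric_of_lt_one (by norm_num) (by norm_num)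
  rw [← ENNReal.ofReal_tsum_of_nonneg (fun k => by positivity) (hgeo.mul_left x), tsum_mul_left,
    tsum_geometric_of_lt_one (by norm_num) (by norm_num)]
  congr 1
  norm_num
  ring

/-- Exponential Markov bound for the time of the `k`-th message. Almost sure exits are assumed
because path weights only see transmissions that take place. -/
lemma measure_lateSet_le (hmeas : ∀ k t, Measurable fun y => localGLR h f Γ Θ y k t)
    (ha : 0 < a) (hb : 0 < b) {κ β : ℝ} (hκ : 0 ≤ κ)
    (hexit : ∀ᵐ y ∂(Measure.infinitePi fun _ : ℕ => P), ∀ s, ∃ m,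
      y ∈ exitUp h f Γ Θ a b s m ∨ y ∈ exitDown h f Γ Θ a b s m)
    (hβ : ∫⁻ y, ∑' m, blockWeight h f Γ Θ a b 0 κ 0 m y
      ∂(Measure.infinitePi fun _ : ℕ => P) ≤ ENNReal.ofReal (Real.exp β)) (k n : ℕ) :
    (Measure.infinitePi fun _ : ℕ => P) (lateSet h f Γ Θ a b k n) ≤
      ENNReal.ofReal (Real.exp (k * β - κ * n)) := by
  have hsub : (lateSet h f Γ Θ a b k n : Set (ℕ → Y)) ≤ᵐ[Measure.infinitePi fun _ : ℕ => P]
      ({y | ENNReal.ofReal (Real.exp (κ * n)) ≤ ∑' s, pathWeight h f Γ Θ a b 0 κ k s y} :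
        Set (ℕ → Y)) := by
    filter_upwards [hexit] with y hy hlate
    obtain ⟨s, hs⟩ := exists_transTime_of_forall_exit hy k
    have h1 := le_pathWeight (c := 0) (κ := 0) ha hb hs
    have h2 := le_pathWeight (c := 0) (κ := κ) ha hb hs
    have hns : n < s := by
      by_contra hcon
      have h3 := hlate s (Finset.mem_range.2 (by omega))
      rw [h3] at h1
      simp at h1
    refine le_trans (ENNReal.ofReal_le_ofReal (Real.exp_le_exp.2 ?_)) (h2.trans (ENNReal.le_tsum s))
    rw [zero_mul, zero_add]
    exact mul_le_mul_of_nonneg_left (by exact_mod_cast hns.le) hκ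
  refine (measure_mono_ae hsub).trans ?_
  have hmark := mul_meas_ge_le_lintegral (μ := Measure.infinitePi fun _ : ℕ => P)
    (f := fun y => ∑' s, pathWeight h f Γ Θ a b 0 κ k s y)
    (Measurable.tsum fun s => measurable_pathWeight hmeas k s)
    (ENNReal.ofReal (Real.exp (κ * n)))
  rw [lintegral_tsum fun s => (measurable_pathWeight hmeas k s).aemeasurable] at hmark
  have hle := hmark.trans (tsum_lintegral_pathWeight_le P hmeas hβ k)
  rw [Real.exp_sub, ENNReal.ofReal_div_of_pos (Real.exp_pos _),
    ENNReal.le_div_iff_mul_le (Or.inl (by simp [Real.exp_pos])) (Or.inl ENNReal.ofReal_ne_top),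
    mul_comm, Real.exp_nat_mul, ENNReal.ofReal_pow (Real.exp_pos _).le]
  exact hle

end Events

end LTS

namespace LTS

/-! ### Values and lengths of the blocks under the alternative. -/

section Alternative

variable {Y : Type*} [MeasurableSpace Y] {E F : Type*} [PseudoMetricSpace E] [PseudoMetricSpace F]
  {μ : Measure Y} {h : E → Y → ℝ} {f : F → Y → ℝ} {Γ : Set E} {Θ : Set F}
  {Zh Zf : Y → ℝ} {rh rf : ℝ}

lemma RegularModel.exists_localGLR_lt_tail (H : RegularModel μ h f Γ Θ Zh rh Zf rf) :
    ∃ c : ℝ, 0 < c ∧ ∀ᶠ m : ℕ in atTop, ∀ a : ℝ, a ≤ c * m → ∀ θ ∈ Θ,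
      sensorLaw μ (f θ) {y | localGLR h f Γ Θ y 1 m < a} ≤
        ENNReal.ofReal (Real.exp (-(c * m))) := by
  obtain ⟨c, hc, hm⟩ := H.swap.exists_localGLR_tail
  refine ⟨c, hc, hm.mono fun m hm a ha θ hθ => ?_⟩
  have := hm a ha θ hθ
  simp_rw [localGLR_swap (h := h) (f := f), neg_lt_neg_iff] at this
  exact this

/-- A path that never exits keeps the statistic below `a` at all times `m`, which has probability at
most `exp (-c * m)` for large `m`. Other starting times follow by stationarity. -/
lemma RegularModel.ae_forall_exists_exit (H : RegularModel μ h f Γ Θ Zh rh Zf rf) {θ : F}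
    (hθ : θ ∈ Θ) (a b : ℝ) : ∀ᵐ y ∂(sensorLaw μ (f θ)), ∀ s, ∃ m,
      y ∈ exitUp h f Γ Θ a b s m ∨ y ∈ exitDown h f Γ Θ a b s m := by
  have := H.alt.isProbabilityMeasure hθ
  have h0 : ∀ᵐ y ∂(sensorLaw μ (f θ)), ∃ m,
      y ∈ exitUp h f Γ Θ a b 0 m ∨ y ∈ exitDown h f Γ Θ a b 0 m := by
    obtain ⟨c, hc, hm⟩ := H.exists_localGLR_lt_tail
    rw [ae_iff]
    have htend : Tendsto (fun m : ℕ => ENNReal.ofReal (Real.exp (-(c * m)))) atTop (𝓝 0) := by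
      rw [← ENNReal.ofReal_zero]
      refine ENNReal.tendsto_ofReal (Real.tendsto_exp_atBot.comp ?_)
      exact tendsto_neg_atTop_atBot.comp (tendsto_natCast_atTop_atTop.const_mul_atTop hc)
    refine le_antisymm (ge_of_tendsto htend ?_) zero_le
    have hlarge : ∀ᶠ m : ℕ in atTop, a ≤ c * m :=
      (tendsto_natCast_atTop_atTop.const_mul_atTop hc).eventually_ge_atTop a
    filter_upwards [hm, hlarge, eventually_gt_atTop 0] with m hm ham hm0
    refine (measure_mono fun y hy => ?_).trans (hm a ham θ hθ)
    have hy' : ∀ m, y ∉ exitUp h f Γ Θ a b 0 m ∧ y ∉ exitDown h f Γ Θ a b 0 m := by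
      intro m
      by_contra hcon
      exact hy ⟨m, by tauto⟩
    exact (localGLR_mem_Ioo_of_forall_notMem_exit hy' hm0).2
  rw [ae_all_iff]
  intro s
  have hq : Measure.QuasiMeasurePreserving (fun (y : ℕ → Y) j => y (s + j)) (sensorLaw μ (f θ))
      (sensorLaw μ (f θ)) :=
    ⟨by fun_prop, by rw [sensorLaw, map_shift_infinitePi]⟩
  filter_upwards [hq.ae h0] with y hy
  obtain ⟨m, hm⟩ := hy
  exact ⟨s + m, by rwa [mem_exitUp_shift, mem_exitDown_shift]⟩

/-- Downward blocks are so rare under the alternative, about `exp (-3 * b / 4)`, that their large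
weight `exp (c * b)` is harmless for small `c`, and the moment is of the order it has when all
blocks end upwards. -/
lemma RegularModel.exists_lintegral_blockWeight_neg_le
    (H : RegularModel μ h f Γ Θ Zh rh Zf rf) {C c : ℝ} (hC : 0 < C)
    (hc : c = 1 / (4 * (C + 1))) :
    ∃ a₀ : ℝ, ∀ a b : ℝ, a₀ ≤ a → a₀ ≤ b → a ≤ C * b → ∀ θ ∈ Θ,
      ∫⁻ y, ∑' m, blockWeight h f Γ Θ a b (-c) 0 0 m y ∂(sensorLaw μ (f θ)) ≤
        ENNReal.ofReal (2 * Real.exp (-(c * a))) := by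
  have h1 := H.swap.exitUp_le (r := 3 / 4) hC (by norm_num)
  obtain ⟨a₀, ha₀⟩ := eventually_atTop.1 (h1.and (eventually_gt_atTop 0))
  refine ⟨a₀, fun a b ha hb hab θ hθ => ?_⟩
  have := H.alt.isProbabilityMeasure hθ
  have : IsProbabilityMeasure (sensorLaw μ (f θ)) := by unfold sensorLaw; infer_instance
  obtain ⟨h1b, hb0⟩ := ha₀ b hb
  have h2 := h1b a hab θ hθ
  simp_rw [exitUp_swap] at h2
  have hc0 : 0 < c := by rw [hc]; positivity
  -- Since `a ≤ C * b`, both `c * a` and `c * b` are at most `b / 4`, so `c * b - 3 * b / 4 ≤ -c *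
  -- a`.
  have hcC : c * (C + 1) = 1 / 4 := by rw [hc]; field_simp
  have hcb : c * b ≤ b / 4 := by nlinarith
  have hca : c * a ≤ b / 4 := by nlinarith
  refine (lintegral_tsum_blockWeight_le _ H.measurable_localGLR (-c)).trans ?_
  have h3 : ENNReal.ofReal (Real.exp (-c * a)) *
      sensorLaw μ (f θ) (⋃ m, exitUp h f Γ Θ a b 0 m) ≤
      ENNReal.ofReal (Real.exp (-(c * a))) := by
    refine (mul_le_mul_right prob_le_one _).trans ?_
    rw [mul_one, neg_mul]
  have h4 : ENNReal.ofReal (Real.exp (-c * -b)) *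
      sensorLaw μ (f θ) (⋃ m, exitDown h f Γ Θ a b 0 m) ≤
      ENNReal.ofReal (Real.exp (-(c * a))) := by
    refine (mul_le_mul_right h2 _).trans ?_
    rw [← ENNReal.ofReal_mul (Real.exp_pos _).le, ← Real.exp_add]
    exact ENNReal.ofReal_le_ofReal (Real.exp_le_exp.2 (by linarith))
  refine (add_le_add h3 h4).trans (le_of_eq ?_)
  rw [← ENNReal.ofReal_add (Real.exp_pos _).le (Real.exp_pos _).le, two_mul]

/-- The exponential moment of the length of a block under the alternative. -/
lemma RegularModel.eventually_lintegral_blockWeight_time_le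
    (H : RegularModel μ h f Γ Θ Zh rh Zf rf) {θ : F} (hθ : θ ∈ Θ) {D ε : ℝ} (hD0 : 0 < D)
    (hε : 0 < ε) (hint : ∀ γ ∈ Γ, Integrable (logLR h f γ θ) (sampleLaw μ (f θ)))
    (hD : ∀ γ ∈ Γ, D ≤ ∫ y, logLR h f γ θ y ∂(sampleLaw μ (f θ))) :
    ∀ᶠ a : ℝ in atTop, ∀ b : ℝ, 0 < b →
      ∫⁻ y, ∑' m, blockWeight h f Γ Θ a b 0 (1 / a) 0 m y ∂(sensorLaw μ (f θ)) ≤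
        ENNReal.ofReal (Real.exp ((1 + 2 * ε) / D)) := by
  have := H.alt.isProbabilityMeasure hθ
  have : IsProbabilityMeasure (sensorLaw μ (f θ)) := by unfold sensorLaw; infer_instance
  -- A rate just below `D`: by time `a / D'` the statistic has reached `a` with high probability.
  set D' := D / (1 + ε) with hD'
  have hD'0 : 0 < D' := by positivity
  have hDD : D' < D := by rw [hD', div_lt_iff₀ (by linarith)]; nlinarith
  have hD'inv : 1 / D' = (1 + ε) / D := by rw [hD', one_div_div]
  obtain ⟨c, hc, htail⟩ := H.exists_localGLR_lt_tail
  -- A third of the room above the main term `exp ((1 + ε) / D)`: one share each for rounding `m₀`,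
  -- for exits between `m₀` and `J`, and for exits after `J`.
  set g : ℝ := (Real.exp ((1 + 2 * ε) / D) - Real.exp ((1 + ε) / D)) / 3 with hg
  have hg0 : 0 < g := by
    have : (1 + ε) / D < (1 + 2 * ε) / D := div_lt_div_of_pos_right (by linarith) hD0
    have := Real.exp_lt_exp.2 this
    rw [hg]
    linarith
  set M : ℝ := Real.exp (1 / c + 1) with hM
  set M' : ℝ := Real.exp 1 * (1 - Real.exp (-(c / 2)))⁻¹ with hM'
  have hq1 : Real.exp (-(c / 2)) < 1 := Real.exp_lt_one_iff.2 (by linarith)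
  have hM'0 : 0 < M' := mul_pos (Real.exp_pos _) (inv_pos.2 (by linarith))
  have hm₀ : Tendsto (fun a : ℝ => ⌈a / D'⌉₊) atTop atTop :=
    tendsto_nat_ceil_atTop.comp (tendsto_id.atTop_div_const hD'0)
  have hJt : Tendsto (fun a : ℝ => ⌈a / c⌉₊) atTop atTop :=
    tendsto_nat_ceil_atTop.comp (tendsto_id.atTop_div_const hc)
  have e1 : ∀ᶠ a : ℝ in atTop, Real.exp (1 / D' + 1 / a) < Real.exp ((1 + ε) / D) + g := by
    have : Tendsto (fun a : ℝ => Real.exp (1 / D' + 1 / a)) atTop (𝓝 (Real.exp (1 / D' + 0))) := by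
      refine (Real.continuous_exp.tendsto _).comp (tendsto_const_nhds.add ?_)
      exact tendsto_const_nhds.div_atTop tendsto_id
    refine this.eventually_lt_const ?_
    rw [add_zero, hD'inv]
    linarith
  have e2 : ∀ᶠ a : ℝ in atTop, sensorLaw μ (f θ)
      {y | localGLR h f Γ Θ y 1 ⌈a / D'⌉₊ < (⌈a / D'⌉₊ : ℝ) * D'} <
      ENNReal.ofReal (g / M) :=
    ((H.tendsto_localGLR_lt hθ hint hD hDD).comp hm₀).eventually_lt_const
      (ENNReal.ofReal_pos.2 (div_pos hg0 (Real.exp_pos _)))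
  have e3 : ∀ᶠ a : ℝ in atTop, M' / g ≤ Real.exp (1 / 2 * a) :=
    eventually_le_exp _ (by norm_num)
  have e4 := hJt.eventually (eventually_forall_ge_atTop.2 htail)
  filter_upwards [e1, e2, e3, e4, eventually_ge_atTop 1, eventually_ge_atTop (2 / c)]
    with a h1 h2 h3 h4 ha1 ha2 b hb
  have ha0 : 0 < a := by linarith
  set m₀ := ⌈a / D'⌉₊ with hm₀def
  set J := ⌈a / c⌉₊ with hJdef
  have hm₀0 : 0 < m₀ := Nat.ceil_pos.2 (by positivity)
  have hJ0 : 0 < J := Nat.ceil_pos.2 (by positivity)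
  have hm₀l : a / D' ≤ m₀ := Nat.le_ceil _
  have hm₀u : (m₀ : ℝ) < a / D' + 1 := Nat.ceil_lt_add_one (by positivity)
  have hJl : a / c ≤ J := Nat.le_ceil _
  have hJu : (J : ℝ) < a / c + 1 := Nat.ceil_lt_add_one (by positivity)
  rw [div_le_iff₀ hD'0] at hm₀l
  rw [div_le_iff₀ hc] at hJl
  rw [div_le_iff₀ hc] at ha2
  have hms : ∀ j, MeasurableSet {y | localGLR h f Γ Θ y 1 j < a} := fun j =>
    measurableSet_lt (H.measurable_localGLR 1 j) measurable_const
  have hb1 : ∫⁻ y, ∑' m, blockWeight h f Γ Θ a b 0 (1 / a) 0 m y ∂(sensorLaw μ (f θ)) ≤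
      ENNReal.ofReal (Real.exp (1 / a * m₀)) +
      (ENNReal.ofReal (Real.exp (1 / a * J)) *
        sensorLaw μ (f θ) {y | localGLR h f Γ Θ y 1 m₀ < a} +
      ∑' i : ℕ, ENNReal.ofReal (Real.exp (1 / a * (J + i + 1))) *
        sensorLaw μ (f θ) {y | localGLR h f Γ Θ y 1 (J + i) < a}) := by
    refine (lintegral_mono fun y => tsum_blockWeight_zero_le fun m =>
      blockWeight_time_le ha0 hb (by positivity) hm₀0 hJ0 m y).trans (le_of_eq ?_)
    rw [lintegral_add_left measurable_const, lintegral_const, measure_univ, mul_one,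
      lintegral_add_left (measurable_const.indicator (hms m₀)), lintegral_indicator_const (hms m₀),
      lintegral_tsum fun i => (measurable_const.indicator (hms _)).aemeasurable]
    simp_rw [lintegral_indicator_const (hms _)]
  refine hb1.trans ?_
  have t1 : ENNReal.ofReal (Real.exp (1 / a * m₀)) ≤
      ENNReal.ofReal (Real.exp ((1 + ε) / D) + g) := by
    refine ENNReal.ofReal_le_ofReal ((Real.exp_le_exp.2 ?_).trans h1.le)
    have : 1 / a * (m₀ : ℝ) ≤ 1 / a * (a / D' + 1) :=
      mul_le_mul_of_nonneg_left hm₀u.le (by positivity)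
    refine this.trans (le_of_eq ?_)
    field_simp
  have t2 : ENNReal.ofReal (Real.exp (1 / a * J)) *
      sensorLaw μ (f θ) {y | localGLR h f Γ Θ y 1 m₀ < a} ≤ ENNReal.ofReal g := by
    have h5 : sensorLaw μ (f θ) {y | localGLR h f Γ Θ y 1 m₀ < a} ≤ ENNReal.ofReal (g / M) :=
      (measure_mono fun y (hy : _ < a) => show _ < _ from hy.trans_le hm₀l).trans h2.le
    have h6 : Real.exp (1 / a * J) ≤ M := by
      refine Real.exp_le_exp.2 ?_
      have : 1 / a * (J : ℝ) ≤ 1 / a * (a / c + 1) :=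
        mul_le_mul_of_nonneg_left hJu.le (by positivity)
      have h7 : 1 / a * (a / c + 1) = 1 / c + 1 / a := by field_simp
      have h8 : 1 / a ≤ 1 := by rw [div_le_one ha0]; exact ha1
      linarith
    refine (mul_le_mul' (ENNReal.ofReal_le_ofReal h6) h5).trans (le_of_eq ?_)
    rw [← ENNReal.ofReal_mul (Real.exp_pos _).le, mul_div_cancel₀ _ (Real.exp_pos _).ne']
  have t3 : ∑' i : ℕ, ENNReal.ofReal (Real.exp (1 / a * (J + i + 1))) *
      sensorLaw μ (f θ) {y | localGLR h f Γ Θ y 1 (J + i) < a} ≤ ENNReal.ofReal g := by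
    have h5 : ∀ i : ℕ, ENNReal.ofReal (Real.exp (1 / a * (J + i + 1))) *
        sensorLaw μ (f θ) {y | localGLR h f Γ Θ y 1 (J + i) < a} ≤
        -- Half of the tail exponent `c * (J + i)` absorbs the weight, as `1 / a ≤ c / 2`. The other
        -- half gives `exp (-a / 2)` from `c * J ≥ a`, and a geometric factor in `i`.
        ENNReal.ofReal (Real.exp 1 * Real.exp (-(1 / 2 * a)) * Real.exp (-(c / 2)) ^ i) := by
      intro i
      have hi0 : (0 : ℝ) ≤ i := Nat.cast_nonneg i
      have h6 := h4 (J + i) (Nat.le_add_right _ _) a (by push_cast; nlinarith) θ hθ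
      refine (mul_le_mul_right h6 _).trans ?_
      rw [← ENNReal.ofReal_mul (Real.exp_pos _).le, ← Real.exp_add, ← Real.exp_nat_mul,
        ← Real.exp_add, ← Real.exp_add]
      refine ENNReal.ofReal_le_ofReal (Real.exp_le_exp.2 ?_)
      push_cast
      have h8 : 1 / a ≤ 1 := by rw [div_le_one ha0]; exact ha1
      have h9 : 1 / a ≤ c / 2 := by rw [div_le_iff₀ ha0]; linarith
      have h10 : 1 / a * ((J : ℝ) + i) ≤ c / 2 * (J + i) :=
        mul_le_mul_of_nonneg_right h9 (by positivity)
      linarith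
    refine (ENNReal.tsum_le_tsum h5).trans ?_
    have hgeo : Summable fun i : ℕ => Real.exp (-(c / 2)) ^ i :=
      summable_geometric_of_lt_one (Real.exp_pos _).le hq1
    rw [← ENNReal.ofReal_tsum_of_nonneg (fun i => by positivity) (hgeo.mul_left _), tsum_mul_left,
      tsum_geometric_of_lt_one (Real.exp_pos _).le hq1]
    refine ENNReal.ofReal_le_ofReal ?_
    rw [div_le_iff₀ hg0] at h3
    calc _ = M' * Real.exp (-(1 / 2 * a)) := by rw [hM']; ring
      _ ≤ (Real.exp (1 / 2 * a) * g) * Real.exp (-(1 / 2 * a)) :=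
          mul_le_mul_of_nonneg_right h3 (Real.exp_pos _).le
      _ = g := by
          rw [mul_comm (Real.exp _) g, mul_assoc, ← Real.exp_add]; simp
  refine (add_le_add t1 (add_le_add t2 t3)).trans (le_of_eq ?_)
  rw [← ENNReal.ofReal_add hg0.le hg0.le, ← ENNReal.ofReal_add (by positivity) (by positivity)]
  congr 1
  rw [hg]
  ring

end Alternative

end LTS

namespace LTS

/-! ### Lower bound on the error probability by change of measure. -/

section LowerBound

variable {Y : Type*} [MeasurableSpace Y] {E F : Type*} [PseudoMetricSpace E] [PseudoMetricSpace F]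
  {μ : Measure Y} {h : E → Y → ℝ} {f : F → Y → ℝ} {Γ : Set E} {Θ : Set F}
  {Zh Zf : Y → ℝ} {rh rf : ℝ}

lemma RegularModel.sampleLaw_alt_eq (H : RegularModel μ h f Γ Θ Zh rh Zf rf) {γ : E} (hγ : γ ∈ Γ)
    {θ : F} (hθ : θ ∈ Θ) : sampleLaw μ (f θ) = (sampleLaw μ (h γ)).withDensity
      (fun y => ENNReal.ofReal (Real.exp (logLR h f γ θ y))) := by
  have h1 := H.null.measurable γ hγ
  have h2 := H.measurable_logLR hγ hθ
  rw [sampleLaw, sampleLaw, ← withDensity_mul _ (by fun_prop) (by fun_prop)]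
  congr 1
  funext y
  have h3 := H.null.pos γ hγ y
  have h4 := H.alt.pos θ hθ y
  rw [Pi.mul_apply, ← ENNReal.ofReal_mul h3.le, logLR, Real.exp_sub, Real.exp_log h3,
    Real.exp_log h4, mul_div_cancel₀ _ h3.ne']

/-- By a union bound all `L` sensors are good with probability at least 1/2 under `θ`. This event is
determined by the first `n` samples of each sensor, whose joint likelihood ratio against `γ` is at
most `exp (L * x)` on it. -/
lemma RegularModel.le_jointLaw_of_bad (H : RegularModel μ h f Γ Θ Zh rh Zf rf) {γ : E}
    (hγ : γ ∈ Γ) {θ : F} (hθ : θ ∈ Θ) {L n : ℕ} (hL : 0 < L) {bad : Set (ℕ → Y)}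
    (hm : MeasurableSet bad) (hdep : DependsOn (· ∈ bad) (Finset.Icc 1 n : Set ℕ))
    (hsmall : sensorLaw μ (f θ) bad ≤ ENNReal.ofReal (1 / (2 * L))) {x : ℝ}
    (hx : ∀ y, y ∉ bad → ∑ j ∈ Finset.Icc 1 n, logLR h f γ θ (y j) ≤ x) :
    ENNReal.ofReal (2⁻¹ * Real.exp (-(L * x))) ≤
      jointLaw L μ (h γ) {ω | ∀ ℓ, (fun j => ω (ℓ, j)) ∉ bad} := by
  have := H.alt.isProbabilityMeasure hθ
  have := H.null.isProbabilityMeasure hγ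
  have : IsProbabilityMeasure (jointLaw L μ (f θ)) := by unfold jointLaw; infer_instance
  have hLr := H.measurable_logLR hγ hθ
  set G : Set (Fin L × ℕ → Y) := {ω | ∀ ℓ, (fun j => ω (ℓ, j)) ∉ bad} with hG
  have hGc : Gᶜ = ⋃ ℓ : Fin L, (fun (ω : Fin L × ℕ → Y) j => ω (ℓ, j)) ⁻¹' bad := by
    ext ω
    simp [hG]
  have hGcm : MeasurableSet Gᶜ := by
    rw [hGc]
    exact MeasurableSet.iUnion fun ℓ => hm.preimage (by fun_prop)
  have hGm : MeasurableSet G := hGcm.of_compl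
  have hL0 : (0 : ℝ) < L := by exact_mod_cast hL
  have hbad : jointLaw L μ (f θ) Gᶜ ≤ ENNReal.ofReal 2⁻¹ := by
    rw [hGc]
    refine (measure_iUnion_fintype_le _ _).trans ?_
    have h1 : ∀ ℓ : Fin L, jointLaw L μ (f θ)
        ((fun (ω : Fin L × ℕ → Y) j => ω (ℓ, j)) ⁻¹' bad) ≤ ENNReal.ofReal (1 / (2 * L)) := by
      intro ℓ
      rw [← Measure.map_apply (by fun_prop) hm, jointLaw, map_sensor_infinitePi]
      exact hsmall
    refine (Finset.sum_le_sum fun ℓ _ => h1 ℓ).trans (le_of_eq ?_)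
    rw [Finset.sum_const, Finset.card_univ, Fintype.card_fin, nsmul_eq_mul,
      ← ENNReal.ofReal_natCast, ← ENNReal.ofReal_mul hL0.le]
    congr 1
    field_simp
  have hGlow : ENNReal.ofReal 2⁻¹ ≤ jointLaw L μ (f θ) G := by
    have h1 : 1 ≤ jointLaw L μ (f θ) G + jointLaw L μ (f θ) Gᶜ := by
      rw [measure_add_measure_compl hGm, measure_univ]
    have h2 : ENNReal.ofReal 2⁻¹ + ENNReal.ofReal 2⁻¹ = 1 := by
      rw [← ENNReal.ofReal_add (by norm_num) (by norm_num)]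
      norm_num
    have h3 := h1.trans (add_le_add_right hbad (jointLaw L μ (f θ) G))
    rw [← h2] at h3
    exact (ENNReal.add_le_add_iff_right ENNReal.ofReal_ne_top).1 h3
  have hGdep : DependsOn (· ∈ G) ((Finset.univ ×ˢ Finset.Icc 1 n : Finset (Fin L × ℕ)) :
      Set (Fin L × ℕ)) := by
    intro ω ω' hωω
    refine propext (forall_congr' fun ℓ => not_congr ?_)
    exact (hdep (x := fun j => ω (ℓ, j)) (y := fun j => ω' (ℓ, j)) fun j hj =>
      hωω (ℓ, j) (by simpa using hj)).to_iff
  have hcm := infinitePi_le_mul_of_likelihood_le (P₀ := sampleLaw μ (h γ))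
    (P₁ := sampleLaw μ (f θ)) (r := fun y => ENNReal.ofReal (Real.exp (logLR h f γ θ y)))
    (by fun_prop) (H.sampleLaw_alt_eq hγ hθ) (Finset.univ ×ˢ Finset.Icc 1 n) hGm hGdep
    (c := ENNReal.ofReal (Real.exp (L * x))) (by
      intro ω hω
      rw [← ENNReal.ofReal_prod_of_nonneg (fun _ _ => (Real.exp_pos _).le), ← Real.exp_sum,
        Finset.sum_product]
      refine ENNReal.ofReal_le_ofReal (Real.exp_le_exp.2 ?_)
      calc _ ≤ ∑ _ℓ : Fin L, x := Finset.sum_le_sum fun ℓ _ => hx _ (hω ℓ)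
        _ = L * x := by simp)
  have h5 := hGlow.trans hcm
  rw [Real.exp_neg, ← div_eq_mul_inv, ENNReal.ofReal_div_of_pos (Real.exp_pos _)]
  exact ENNReal.div_le_of_le_mul' h5

/-- About `A / (L * a)` messages per sensor suffice to reach `A`, each costs about `a / D` samples,
and each sample costs about `D` in the change of measure. -/
lemma RegularModel.eventually_le_jointLaw_decideOne
    (H : RegularModel μ h f Γ Θ Zh rh Zf rf) {γ : E} (hγ : γ ∈ Γ) {θ : F} (hθ : θ ∈ Θ) {L : ℕ}
    (hL : 0 < L) {D ε C : ℝ} (hD0 : 0 < D) (hε0 : 0 < ε) (hε1 : ε < 1) (hC : 0 < C)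
    (hint : ∀ γ ∈ Γ, Integrable (logLR h f γ θ) (sampleLaw μ (f θ)))
    (hD : ∀ γ ∈ Γ, D ≤ ∫ y, logLR h f γ θ y ∂(sampleLaw μ (f θ)))
    (hDγ : ∫ y, logLR h f γ θ y ∂(sampleLaw μ (f θ)) < (1 + 2 * ε) * D)
    {ι : Type*} {l : Filter ι} {a b A B : ι → ℝ} (ha : Tendsto a l atTop) (hb : Tendsto b l atTop)
    (hab : ∀ᶠ i in l, a i ≤ C * b i) (hA : Tendsto (fun i => A i / a i) l atTop)
    (hB : ∀ᶠ i in l, 0 < B i) :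
    ∀ᶠ i in l, ENNReal.ofReal (2⁻¹ * Real.exp (-(L * (⌈(1 + 3 * ε) *
        (⌈A i / a i / (L * (1 - ε))⌉₊ * a i) / D⌉₊ * ((1 + 2 * ε) * D))))) ≤
      jointLaw L μ (h γ) (decideOne L h f Γ Θ (a i) (b i) (A i) (B i)) := by
  have := H.alt.isProbabilityMeasure hθ
  have hmeas := H.measurable_localGLR
  have hL0 : (0 : ℝ) < L := by exact_mod_cast hL
  -- The least number of messages per sensor for which contributions of `(1 - ε) * a` each add up to
  -- `A` over the `L` sensors.
  set k : ι → ℕ := fun i => ⌈A i / a i / (L * (1 - ε))⌉₊ with hk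
  -- The margin between `1 + 3 * ε` and the `1 + 2 * ε` of the block length moment makes the
  -- probability of being late at most `exp (-ε * k / D)`.
  set n : ι → ℕ := fun i => ⌈(1 + 3 * ε) * (k i * a i) / D⌉₊ with hn
  have hε' : 0 < 1 - ε := by linarith
  have hkt : Tendsto k l atTop :=
    tendsto_nat_ceil_atTop.comp (hA.atTop_div_const (by positivity))
  have hkR : Tendsto (fun i => (k i : ℝ)) l atTop := tendsto_natCast_atTop_atTop.comp hkt
  have hnt : Tendsto n l atTop :=
    tendsto_nat_ceil_atTop.comp
      (((hkR.atTop_mul_atTop₀ ha).const_mul_atTop (by positivity)).atTop_div_const hD0)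
  -- Three unfavourable events of probability at most `η` each share the allowance `1 / (2 * L)`.
  set η : ℝ := 1 / (6 * L) with hη
  have hη0 : 0 < η := by positivity
  set c : ℝ := 1 / (4 * (C + 1)) with hc
  have hc0 : 0 < c := by positivity
  obtain ⟨a₀, ha₀⟩ := H.exists_lintegral_blockWeight_neg_le hC hc
  -- The term `4` brings the geometric ratio below 1/2, and `4 / η` brings the resulting bound below
  -- `η`.
  have e1 := ha.eventually (eventually_le_exp (4 / η + 4) (mul_pos hc0 hε0))
  have e2 := hkR.eventually (eventually_le_exp (1 / η) (div_pos hε0 hD0))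
  have e3 := hnt.eventually ((tendsto_measure_sum_gt (sampleLaw μ (f θ)) (H.measurable_logLR hγ hθ)
    (hint γ hγ) hDγ).eventually_lt_const (ENNReal.ofReal_pos.2 hη0))
  have e4 := ha.eventually (H.eventually_lintegral_blockWeight_time_le hθ hD0 hε0 hint hD)
  filter_upwards [e1, e2, e3, e4, ha.eventually_ge_atTop a₀, hb.eventually_ge_atTop a₀,
    ha.eventually_gt_atTop 0, hb.eventually_gt_atTop 0, hab, hB]
    with i h1 h2 h3 h4 ha1 hb1 ha0 hb0 habi hB0
  have hlow : sensorLaw μ (f θ) (lowSet h f Γ Θ (a i) (b i) c (a i * (1 - ε)) (n i)) ≤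
      ENNReal.ofReal η := by
    have hexp : Real.exp (c * (a i * (1 - ε))) * (2 * Real.exp (-(c * a i))) =
        2 * Real.exp (-(c * ε * a i)) := by
      rw [mul_left_comm, ← Real.exp_add]
      congr 2
      ring
    have h5 : Real.exp (-(c * ε * a i)) ≤ (4 / η + 4)⁻¹ := by
      rw [Real.exp_neg]
      exact inv_anti₀ (by positivity) h1
    have h6 : (4 / η + 4)⁻¹ ≤ 4⁻¹ := inv_anti₀ (by norm_num) (by
      have : 0 < 4 / η := by positivity
      linarith)
    have h7 : (4 / η + 4)⁻¹ ≤ η / 4 := by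
      rw [show η / 4 = (4 / η)⁻¹ by rw [inv_div]]
      exact inv_anti₀ (by positivity) (by linarith)
    refine (measure_lowSet_le _ hmeas (by positivity) (ha₀ _ _ ha1 hb1 habi θ hθ) ?_ _).trans ?_
    · rw [hexp]
      norm_num at h6 ⊢
      linarith
    · rw [hexp]
      exact ENNReal.ofReal_le_ofReal (by linarith)
  have hlate : sensorLaw μ (f θ) (lateSet h f Γ Θ (a i) (b i) (k i) (n i)) ≤
      ENNReal.ofReal η := by
    refine (measure_lateSet_le _ hmeas ha0 hb0 (by positivity)
      (H.ae_forall_exists_exit hθ (a i) (b i)) (h4 (b i) hb0) _ _).trans ?_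
    refine ENNReal.ofReal_le_ofReal ?_
    have h5 : (1 + 3 * ε) * (k i * a i) / D ≤ n i := Nat.le_ceil _
    have h6 : 1 / a i * ((1 + 3 * ε) * (k i * a i) / D) ≤ 1 / a i * n i :=
      mul_le_mul_of_nonneg_left h5 (by positivity)
    have h7 : 1 / a i * ((1 + 3 * ε) * (k i * a i) / D) = k i * ((1 + 2 * ε) / D) + ε / D * k i := by
      field_simp
      ring
    calc Real.exp (k i * ((1 + 2 * ε) / D) - 1 / a i * n i) ≤ Real.exp (-(ε / D * k i)) :=
          Real.exp_le_exp.2 (by linarith)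
      _ ≤ (1 / η)⁻¹ := by
          rw [Real.exp_neg]
          exact inv_anti₀ (by positivity) h2
      _ = η := by rw [one_div, inv_inv]
  set S : Set (ℕ → Y) := {y | n i * ((1 + 2 * ε) * D) <
    ∑ j ∈ Finset.Icc 1 (n i), logLR h f γ θ (y j)} with hS
  have hSm : MeasurableSet S := measurableSet_lt measurable_const
    (Finset.measurable_fun_sum _ fun j _ => by
      have := H.measurable_logLR hγ hθ
      fun_prop)
  have hSdep : DependsOn (· ∈ S) (Finset.Icc 1 (n i) : Set ℕ) := by
    intro y y' hyy
    have : ∑ j ∈ Finset.Icc 1 (n i), logLR h f γ θ (y j) =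
        ∑ j ∈ Finset.Icc 1 (n i), logLR h f γ θ (y' j) :=
      Finset.sum_congr rfl fun j hj => by rw [hyy j hj]
    simp only [hS, Set.mem_ofPred_eq, this]
  have hbad := H.le_jointLaw_of_bad hγ hθ hL
    (bad := (lowSet h f Γ Θ (a i) (b i) c (a i * (1 - ε)) (n i) ∪
      lateSet h f Γ Θ (a i) (b i) (k i) (n i)) ∪ S) (n := n i)
    (((measurableSet_lowSet hmeas _ _ _).union (measurableSet_lateSet hmeas _ _)).union hSm)
    (by
      intro y y' hyy
      refine propext (or_congr (or_congr ?_ ?_) ?_)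
      · exact (dependsOn_lowSet _ _ _ hyy).to_iff
      · exact (dependsOn_lateSet _ _ hyy).to_iff
      · exact (hSdep hyy).to_iff)
    (by
      refine (measure_union_le _ _).trans ((add_le_add ((measure_union_le _ _).trans
        (add_le_add hlow hlate)) h3.le).trans (le_of_eq ?_))
      rw [← ENNReal.ofReal_add hη0.le hη0.le, ← ENNReal.ofReal_add (by positivity) hη0.le]
      congr 1
      rw [hη]
      field_simp
      norm_num)
    (x := n i * ((1 + 2 * ε) * D)) (fun y hy => not_lt.1 fun hlt => hy (Or.inr hlt))
  refine hbad.trans (measure_mono fun ω hω => ?_)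
  refine mem_decideOne_of_forall_notMem (v := a i * (1 - ε)) (c := c) (k := k i) (n := n i)
    ha0 hb0 hB0 (by positivity) hc0 ?_ fun ℓ hl => hω ℓ (Or.inl hl)
  have h8 : A i / a i / (L * (1 - ε)) ≤ k i := Nat.le_ceil _
  rw [div_le_iff₀ (by positivity), div_le_iff₀ ha0] at h8
  linarith

end LowerBound

end LTS

namespace LTS

/-! ### Logarithmic asymptotics for regular models. -/

section Asymptotics

lemma tendsto_one_of_forall_real {ι : Type*} {l : Filter ι} {X : ι → EReal}
    (h : ∀ ε : ℝ, 0 < ε → ε < 1 →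
      ∀ᶠ i in l, ((1 - ε : ℝ) : EReal) ≤ X i ∧ X i ≤ ((1 + ε : ℝ) : EReal)) :
    Tendsto X l (𝓝 1) := by
  rw [tendsto_order]
  constructor
  · intro c hc
    obtain ⟨r, hcr, hr⟩ := EReal.lt_iff_exists_real_btwn.1 hc
    have hr1 : r < 1 := by exact_mod_cast hr
    filter_upwards [h (min (1 - r) 2⁻¹) (lt_min (by linarith) (by norm_num))
      ((min_le_right _ _).trans_lt (by norm_num))] with i hi
    refine hcr.trans_le (le_trans ?_ hi.1)
    have := min_le_left (1 - r) 2⁻¹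
    exact_mod_cast (show r ≤ 1 - min (1 - r) 2⁻¹ by linarith)
  · intro c hc
    obtain ⟨r, hr, hrc⟩ := EReal.lt_iff_exists_real_btwn.1 hc
    have hr1 : 1 < r := by exact_mod_cast hr
    filter_upwards [h (min (r - 1) 2⁻¹) (lt_min (by linarith) (by norm_num))
      ((min_le_right _ _).trans_lt (by norm_num))] with i hi
    refine lt_of_le_of_lt (hi.2.trans ?_) hrc
    have := min_le_left (r - 1) 2⁻¹
    exact_mod_cast (show 1 + min (r - 1) 2⁻¹ ≤ r by linarith)

lemma div_neg_mem_of_mem {S : EReal} {A ε : ℝ} (hA : 0 < A)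
    (h1 : ((-((1 + ε) * A) : ℝ) : EReal) ≤ S) (h2 : S ≤ ((-((1 - ε) * A) : ℝ) : EReal)) :
    ((1 - ε : ℝ) : EReal) ≤ S / ((-A : ℝ) : EReal) ∧
      S / ((-A : ℝ) : EReal) ≤ ((1 + ε : ℝ) : EReal) := by
  have hanti := EReal.antitone_div_right_of_nonpos (b := ((-A : ℝ) : EReal))
    (by exact_mod_cast (neg_neg_of_pos hA).le)
  have hA' : -A ≠ 0 := by linarith [hA.ne']
  constructor
  · refine le_trans (le_of_eq ?_) (hanti h2)
    simp only
    rw [← EReal.coe_div]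
    congr 1
    field_simp
  · refine le_trans (hanti h1) (le_of_eq ?_)
    simp only
    rw [← EReal.coe_div]
    congr 1
    field_simp

variable {Y : Type*} [MeasurableSpace Y] {E F : Type*} [PseudoMetricSpace E] [PseudoMetricSpace F]
  {μ : Measure Y} {h : E → Y → ℝ} {f : F → Y → ℝ} {Γ : Set E} {Θ : Set F}
  {Zh Zf : Y → ℝ} {rh rf : ℝ}

/-- The upper bound is uniform in `γ`. The lower bound is only claimed at one `γ` that nearly
minimizes the divergence from a fixed but arbitrary `θ`, which is enough for the supremum. -/
theorem RegularModel.tendsto_log_jointLaw_decideOne (H : RegularModel μ h f Γ Θ Zh rh Zf rf)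
    {L : ℕ} (hL : 0 < L) {θ : F} (hθ : θ ∈ Θ)
    (hint : ∀ γ ∈ Γ, Integrable (logLR h f γ θ) (sampleLaw μ (f θ)))
    (hpos : ∃ κ : ℝ, 0 < κ ∧ ∀ γ ∈ Γ, κ ≤ ∫ y, logLR h f γ θ y ∂(sampleLaw μ (f θ)))
    {ι : Type*} {l : Filter ι} {a b A B : ι → ℝ} {C : ℝ} (hC : 0 < C)
    (ha : Tendsto a l atTop) (hb : Tendsto b l atTop)
    (hab : ∀ᶠ i in l, a i ≤ C * b i) (hba : ∀ᶠ i in l, b i ≤ C * a i)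
    (hA : Tendsto (fun i => A i / a i) l atTop) (hB : ∀ᶠ i in l, 0 < B i) :
    Tendsto (fun i => (⨆ γ ∈ Γ, ENNReal.log (jointLaw L μ (h γ)
      (decideOne L h f Γ Θ (a i) (b i) (A i) (B i)))) / ((-(A i) : ℝ) : EReal)) l (𝓝 1) := by
  have hAt : Tendsto A l atTop := by
    refine (hA.atTop_mul_atTop₀ ha).congr' ?_
    filter_upwards [ha.eventually_gt_atTop 0] with i hi
    rw [div_mul_cancel₀ _ hi.ne']
  refine tendsto_one_of_forall_real fun ε hε0 hε1 => ?_
  have hupper : ∀ᶠ i in l, (⨆ γ ∈ Γ, ENNReal.log (jointLaw L μ (h γ)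
      (decideOne L h f Γ Θ (a i) (b i) (A i) (B i)))) ≤ ((-((1 - ε) * A i) : ℝ) : EReal) := by
    obtain ⟨a₀, ha₀⟩ := H.exists_jointLaw_decideOne_le (r := 1 - ε / 2) hC (by linarith)
      (by linarith)
    filter_upwards [ha.eventually_ge_atTop a₀, hb.eventually_ge_atTop a₀, hba,
      hAt.eventually_ge_atTop (2 * (L * Real.log 2) / ε)] with i ha1 hb1 hbai hA1
    refine iSup₂_le fun γ hγ => ?_
    refine (ENNReal.log_monotone (ha₀ _ _ ha1 hb1 hbai γ hγ L (A i) (B i))).trans ?_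
    have h2 : (2 : ℝ≥0∞) ^ L * ENNReal.ofReal (Real.exp (-((1 - ε / 2) * A i))) =
        ENNReal.ofReal (2 ^ L * Real.exp (-((1 - ε / 2) * A i))) := by
      rw [ENNReal.ofReal_mul (by positivity), ENNReal.ofReal_pow (by norm_num)]
      norm_num
    rw [h2, ENNReal.log_ofReal_of_pos (by positivity),
      Real.log_mul (by positivity) (by positivity), Real.log_pow, Real.log_exp]
    refine EReal.coe_le_coe_iff.2 ?_
    rw [div_le_iff₀ hε0] at hA1
    linarith
  have hlower : ∀ᶠ i in l, ((-((1 + ε) * A i) : ℝ) : EReal) ≤ (⨆ γ ∈ Γ, ENNReal.log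
      (jointLaw L μ (h γ) (decideOne L h f Γ Θ (a i) (b i) (A i) (B i)))) := by
    obtain ⟨κ, hκ0, hκ⟩ := hpos
    have : Nonempty Γ := H.null.nonempty.to_subtype
    have hbdd : BddBelow (Set.range fun γ : Γ => ∫ y, logLR h f γ θ y ∂(sampleLaw μ (f θ))) :=
      ⟨κ, by rintro _ ⟨γ, rfl⟩; exact hκ γ γ.2⟩
    set D : ℝ := ⨅ γ : Γ, ∫ y, logLR h f γ θ y ∂(sampleLaw μ (f θ)) with hDdef
    have hD0 : 0 < D := hκ0.trans_le (le_ciInf fun γ => hκ γ γ.2)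
    -- Then `(1 + 2 * e) * (1 + 3 * e) / (1 - e) ≤ 1 + 10 * e = 1 + ε / 2`; the remaining `ε / 2`
    -- absorbs the rounding of `k` and `n` and the factor 1/2.
    set e : ℝ := ε / 20 with he
    have he0 : 0 < e := by positivity
    have he1 : e ≤ 1 / 20 := by rw [he]; linarith
    obtain ⟨γ, hγD⟩ := exists_lt_of_ciInf_lt (show D < (1 + 2 * e) * D by nlinarith)
    have hlow := H.eventually_le_jointLaw_decideOne γ.2 hθ hL hD0 he0 (by linarith) hC hint
      (fun γ hγ => ciInf_le hbdd (⟨γ, hγ⟩ : Γ)) hγD ha hb hab hA hB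
    have hL0 : (0 : ℝ) < L := by exact_mod_cast hL
    filter_upwards [hlow, ha.eventually_gt_atTop 0, hAt.eventually_ge_atTop
      (4 / ε * (3 * L * D + Real.log 2)), hA.eventually_ge_atTop (4 / ε * (12 * L)),
      hAt.eventually_gt_atTop 0] with i hi ha0 hA1 hA2 hA0
    refine le_trans ?_ (le_iSup₂ (f := fun γ (_ : γ ∈ Γ) => ENNReal.log
      (jointLaw L μ (h γ) (decideOne L h f Γ Θ (a i) (b i) (A i) (B i)))) γ.1 γ.2)
    refine le_trans ?_ (ENNReal.log_monotone hi)
    rw [ENNReal.log_ofReal_of_pos (by positivity),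
      Real.log_mul (by positivity) (by positivity), Real.log_exp, Real.log_inv]
    refine EReal.coe_le_coe_iff.2 ?_
    have hLe : 0 < L * (1 - e) := mul_pos hL0 (by linarith)
    set k : ℕ := ⌈A i / a i / (L * (1 - e))⌉₊ with hk
    set n : ℕ := ⌈(1 + 3 * e) * (k * a i) / D⌉₊ with hn
    have hk1 : (k : ℝ) < A i / a i / (L * (1 - e)) + 1 := Nat.ceil_lt_add_one (by positivity)
    have hn1 : (n : ℝ) < (1 + 3 * e) * (k * a i) / D + 1 := Nat.ceil_lt_add_one (by positivity)
    have hka : (k : ℝ) * a i ≤ A i / (L * (1 - e)) + a i := by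
      have := mul_le_mul_of_nonneg_right hk1.le ha0.le
      have h2 : (A i / a i / (L * (1 - e)) + 1) * a i = A i / (L * (1 - e)) + a i := by
        field_simp
      linarith
    have hnD : (n : ℝ) * D ≤ (1 + 3 * e) * (A i / (L * (1 - e)) + a i) + D := by
      have := mul_le_mul_of_nonneg_right hn1.le hD0.le
      have h2 : ((1 + 3 * e) * (k * a i) / D + 1) * D = (1 + 3 * e) * (k * a i) + D := by
        field_simp
      have h3 := mul_le_mul_of_nonneg_left hka (show 0 ≤ 1 + 3 * e by linarith)
      linarith
    have hq : (1 + 2 * e) * (1 + 3 * e) / (1 - e) ≤ 1 + ε / 2 := by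
      rw [div_le_iff₀ (by linarith), show ε = 20 * e by rw [he]; ring]
      nlinarith
    have hmain : (L : ℝ) * (n * ((1 + 2 * e) * D)) ≤
        (1 + 2 * e) * (1 + 3 * e) / (1 - e) * A i +
          L * ((1 + 2 * e) * (1 + 3 * e) * a i) + L * ((1 + 2 * e) * D) := by
      have h2 := mul_le_mul_of_nonneg_left hnD (show 0 ≤ L * (1 + 2 * e) by positivity)
      have h3 : L * (1 + 2 * e) * ((1 + 3 * e) * (A i / (L * (1 - e)) + a i) + D) =
        (1 + 2 * e) * (1 + 3 * e) / (1 - e) * A i +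
          L * ((1 + 2 * e) * (1 + 3 * e) * a i) + L * ((1 + 2 * e) * D) := by
        have : (1 - e) ≠ 0 := by linarith
        field_simp
      linarith
    -- Rounding `k` up costs one more message, of order `a`, which is negligible because `A / a`
    -- tends to infinity.
    have hr1 : L * ((1 + 2 * e) * (1 + 3 * e) * a i) ≤ ε / 4 * A i := by
      rw [le_div_iff₀ ha0, div_mul_eq_mul_div, div_mul_eq_mul_div, div_le_iff₀ hε0] at hA2
      have h2 : (1 + 2 * e) * (1 + 3 * e) ≤ 12 := by nlinarith
      have h3 := mul_le_mul_of_nonneg_left h2 (mul_pos hL0 ha0).le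
      linarith
    have hr2 : L * ((1 + 2 * e) * D) + Real.log 2 ≤ ε / 4 * A i := by
      rw [div_mul_eq_mul_div, div_le_iff₀ hε0] at hA1
      have h2 := mul_le_mul_of_nonneg_left (show 1 + 2 * e ≤ 3 by linarith) (mul_pos hL0 hD0).le
      linarith
    have hqA := mul_le_mul_of_nonneg_right hq hA0.le
    linarith
  filter_upwards [hupper, hlower, hAt.eventually_gt_atTop 0] with i h1 h2 h3
  exact div_neg_mem_of_mem h3 h2 h1

end Asymptotics

end LTS

namespace LTS

/-! ### Covering numbers of bounded sets in Euclidean space. -/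

section Covering

/-- One point of `K` is picked in every occupied cell of a grid of mesh `δ / (d + 1)`, so the net
lies in `K`. The cells have diameter at most `√d * δ / (d + 1) ≤ δ`. -/
lemma polynomialCovering_of_isBounded {d : ℕ} {K : Set (EuclideanSpace ℝ (Fin d))}
    (hK : Bornology.IsBounded K) : PolynomialCovering K := by
  obtain ⟨R, hR0, hR⟩ := hK.exists_pos_norm_le
  refine ⟨(2 * R * (d + 1) + 3) ^ d, d, by positivity, fun δ hδ hδ1 => ?_⟩
  set m : ℝ := (d + 1) / δ with hm
  have hm0 : 0 < m := by positivity
  let g : EuclideanSpace ℝ (Fin d) → (Fin d → ℤ) := fun x i => ⌊x i * m⌋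
  set M : Finset (Fin d → ℤ) := Fintype.piFinset fun _ => Finset.Icc ⌊-(R * m)⌋ ⌊R * m⌋ with hM
  have hgM : ∀ x ∈ K, g x ∈ M := by
    intro x hx
    refine Fintype.mem_piFinset.2 fun i => Finset.mem_Icc.2 ?_
    have h1 : |x i| ≤ R := (PiLp.norm_apply_le x i).trans (hR x hx)
    have h2 := abs_le.1 h1
    exact ⟨Int.floor_le_floor (by nlinarith), Int.floor_le_floor (by nlinarith)⟩
  have hfin : (g '' K).Finite :=
    M.finite_toSet.subset (by rintro _ ⟨x, hx, rfl⟩; exact hgM x hx)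
  obtain ⟨N, hNK, hNg, hNc⟩ : ∃ N : Finset (EuclideanSpace ℝ (Fin d)), (N : Set _) ⊆ K ∧
      (∀ x ∈ K, ∃ x' ∈ N, g x' = g x) ∧ N.card ≤ M.card := by
    classical
    have hex : ∀ v : g '' K, ∃ x ∈ K, g x = v := fun v => v.2
    choose s hsK hsg using hex
    have := hfin.fintype
    refine ⟨Finset.univ.image s, ?_, fun x hx => ?_, ?_⟩
    · intro x hx
      obtain ⟨v, -, rfl⟩ := Finset.mem_image.1 (Finset.mem_coe.1 hx)
      exact hsK v
    · exact ⟨s ⟨g x, x, hx, rfl⟩, Finset.mem_image_of_mem _ (Finset.mem_univ _), hsg _⟩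
    · refine Finset.card_image_le.trans ?_
      rw [Finset.card_univ, ← Set.toFinset_card]
      refine Finset.card_le_card fun v hv => ?_
      obtain ⟨x, hx, rfl⟩ := Set.mem_toFinset.1 hv
      exact hgM x hx
  refine ⟨N, hNK, ?_, fun x hx => ?_⟩
  · have h1 : (M.card : ℝ) ≤ (2 * (R * m) + 2) ^ d := by
      rw [hM, Fintype.card_piFinset, Finset.prod_const, Finset.card_univ, Fintype.card_fin,
        Nat.cast_pow]
      refine pow_le_pow_left₀ (by positivity) ?_ d
      rw [Int.card_Icc]
      have h3 : ⌊-(R * m)⌋ ≤ ⌊R * m⌋ := Int.floor_le_floor (by nlinarith)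
      have h2 : (((⌊R * m⌋ + 1 - ⌊-(R * m)⌋).toNat : ℤ) : ℝ) =
          ((⌊R * m⌋ + 1 - ⌊-(R * m)⌋ : ℤ) : ℝ) := by
        rw [Int.toNat_of_nonneg (by omega)]
      rw [Int.cast_natCast] at h2
      rw [h2]
      push_cast
      have := Int.floor_le (R * m)
      have := Int.lt_floor_add_one (-(R * m))
      linarith
    calc (N.card : ℝ) ≤ M.card := by exact_mod_cast hNc
      _ ≤ (2 * (R * m) + 2) ^ d := h1
      _ ≤ ((2 * R * (d + 1) + 3) * (1 / δ)) ^ d := by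
          refine pow_le_pow_left₀ (by positivity) ?_ d
          have h4 : 1 ≤ 1 / δ := by rw [le_div_iff₀ hδ]; linarith
          have h5 : R * m = R * (d + 1) * (1 / δ) := by rw [hm]; ring
          rw [h5]
          nlinarith
      _ = _ := mul_pow _ _ _
  · obtain ⟨x', hx', hg⟩ := hNg x hx
    refine ⟨x', hx', ?_⟩
    have hcoord : ∀ i, dist (x i) (x' i) ≤ 1 / m := by
      intro i
      have h1 : ⌊x' i * m⌋ = ⌊x i * m⌋ := congrFun hg i
      have h2 := Int.abs_sub_lt_one_of_floor_eq_floor h1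
      rw [← sub_mul, abs_mul, abs_of_pos hm0, abs_sub_comm] at h2
      rw [Real.dist_eq, le_div_iff₀ hm0]
      exact h2.le
    rw [EuclideanSpace.dist_eq]
    calc √(∑ i, dist (x i) (x' i) ^ 2) ≤ √(∑ _i : Fin d, (1 / m) ^ 2) :=
          Real.sqrt_le_sqrt (Finset.sum_le_sum fun i _ =>
            pow_le_pow_left₀ dist_nonneg (hcoord i) 2)
      _ ≤ √((d + 1) ^ 2 * (1 / m) ^ 2) := by
          refine Real.sqrt_le_sqrt ?_
          simp only [Finset.sum_const, Finset.card_univ, Fintype.card_fin, nsmul_eq_mul]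
          refine mul_le_mul_of_nonneg_right ?_ (by positivity)
          have : (0 : ℝ) ≤ d := Nat.cast_nonneg d
          nlinarith
      _ = δ := by
          rw [← mul_pow, Real.sqrt_sq (by positivity), hm]
          field_simp

end Covering

/-! ### From gradient bounds to Lipschitz bounds along paths. -/

section Paths

variable {E : Type*} [NormedAddCommGroup E] [InnerProductSpace ℝ E] [CompleteSpace E]

/-- The path is only Lipschitz, so `φ ∘ p` need not be differentiable. The mean value inequality is
therefore used in the form that needs only a bound on right slopes, obtained from the first-order
expansion of `φ` within `K`. -/
lemma sub_le_of_hasGradientWithinAt_of_path {φ : E → ℝ} {G : E → E} {K : Set E} {σ : ℝ}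
    (hφ : ∀ x ∈ K, HasGradientWithinAt φ (G x) K x) (hG : ∀ x ∈ K, ‖G x‖ ≤ σ) {p : ℝ → E}
    {κ : ℝ≥0} (hp : LipschitzOnWith κ p (Set.Icc 0 1)) (hpK : ∀ s ∈ Set.Icc (0 : ℝ) 1, p s ∈ K) :
    φ (p 1) - φ (p 0) ≤ σ * κ := by
  have hcont : ContinuousOn φ K := fun x hx => (hφ x hx).continuousWithinAt
  have hpc : ContinuousOn (fun s => φ (p s)) (Set.Icc 0 1) := hcont.comp hp.continuousOn hpK
  have key := image_le_of_liminf_slope_right_le_deriv_boundary (f := fun s => φ (p s))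
    (a := 0) (b := 1) (B := fun s => φ (p 0) + σ * κ * s) (B' := fun _ => σ * κ) hpc (by simp)
    (by fun_prop)
    (fun x _ => by
      simpa using (((hasDerivAt_id x).const_mul (σ * κ)).const_add (φ (p 0))).hasDerivWithinAt)
    ?_ (x := 1) (by simp)
  · simp only [mul_one] at key
    linarith
  intro x hx r hr
  have hxI : x ∈ Set.Icc (0 : ℝ) 1 := ⟨hx.1, hx.2.le⟩
  have hd := (hφ (p x) (hpK x hxI)).hasFDerivWithinAt
  refine Eventually.frequently ?_
  -- the increment of `φ` along the path is bounded through its derivative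
  obtain ⟨ε, hε, hεr⟩ : ∃ ε : ℝ, 0 < ε ∧ (σ + ε) * κ < r := by
    refine ⟨(r - σ * κ) / (2 * (κ + 1)), by
      have : (0 : ℝ) ≤ κ := κ.2
      exact div_pos (by linarith) (by linarith), ?_⟩
    have hk : (0 : ℝ) ≤ κ := κ.2
    have h1 : (r - σ * κ) / (2 * (κ + 1)) * κ ≤ (r - σ * κ) / 2 := by
      rw [div_mul_eq_mul_div, div_le_div_iff₀ (by linarith) (by norm_num)]
      nlinarith
    nlinarith
  have hlit := hd.isLittleO.def hε
  have htend : Tendsto p (𝓝[>] x) (𝓝[K] (p x)) := by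
    refine tendsto_nhdsWithin_iff.2 ⟨?_, ?_⟩
    · refine (hp.continuousOn x hxI).tendsto.mono_left ?_
      exact nhdsWithin_le_iff.2 (mem_of_superset (Ioc_mem_nhdsGT hx.2)
        (fun s hs => ⟨hx.1.trans hs.1.le, hs.2⟩))
    · filter_upwards [Ioc_mem_nhdsGT hx.2] with s hs
      exact hpK s ⟨hx.1.trans hs.1.le, hs.2⟩
  filter_upwards [htend.eventually hlit, Ioc_mem_nhdsGT hx.2] with s hs hsI
  have hsI' : s ∈ Set.Icc (0 : ℝ) 1 := ⟨hx.1.trans hsI.1.le, hsI.2⟩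
  have hpos : 0 < s - x := by linarith [hsI.1]
  have hdist : ‖p s - p x‖ ≤ κ * (s - x) := by
    have := hp.dist_le_mul s hsI' x hxI
    rwa [dist_eq_norm, Real.dist_eq, abs_of_pos hpos] at this
  rw [slope_def_field, div_lt_iff₀ hpos]
  have h1 : inner ℝ (G (p x)) (p s - p x) ≤ σ * ‖p s - p x‖ :=
    (real_inner_le_norm _ _).trans
      (mul_le_mul_of_nonneg_right (hG _ (hpK x hxI)) (norm_nonneg _))
  have h2 := le_abs_self (φ (p s) - φ (p x) - inner ℝ (G (p x)) (p s - p x))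
  rw [InnerProductSpace.toDual_apply_apply, Real.norm_eq_abs] at hs
  have hσ : 0 ≤ σ := (norm_nonneg _).trans (hG _ (hpK x hxI))
  calc φ (p s) - φ (p x) ≤ (σ + ε) * ‖p s - p x‖ := by linarith
    _ ≤ (σ + ε) * (κ * (s - x)) := mul_le_mul_of_nonneg_left hdist (by positivity)
    _ < r * (s - x) := by rw [← mul_assoc]; exact mul_lt_mul_of_pos_right hεr hpos

lemma abs_sub_le_of_hasGradientWithinAt {φ : E → ℝ} {G : E → E} {K : Set E} {σ r : ℝ} {C : ℝ≥0}
    (hφ : ∀ x ∈ K, HasGradientWithinAt φ (G x) K x) (hG : ∀ x ∈ K, ‖G x‖ ≤ σ)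
    (hK : ∀ x ∈ K, ∀ y ∈ K, dist x y < r →
      ∃ p : ℝ → E, p 0 = x ∧ p 1 = y ∧ (∀ s ∈ Set.Icc (0 : ℝ) 1, p s ∈ K) ∧
        LipschitzOnWith (C * nndist x y) p (Set.Icc (0 : ℝ) 1))
    {x y : E} (hx : x ∈ K) (hy : y ∈ K) (hxy : dist x y < r) :
    |φ x - φ y| ≤ C * σ * dist x y := by
  have main : ∀ {x y : E}, x ∈ K → y ∈ K → dist x y < r → φ y - φ x ≤ C * σ * dist x y := by
    intro x y hx hy hxy
    obtain ⟨p, h0, h1, hpK, hp⟩ := hK x hx y hy hxy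
    have := sub_le_of_hasGradientWithinAt_of_path hφ hG hp hpK
    rw [h0, h1, NNReal.coe_mul, coe_nndist] at this
    linarith
  have h1 := main hx hy hxy
  have h2 := main hy hx (by rwa [dist_comm])
  rw [dist_comm y x] at h2
  exact abs_le.2 ⟨by linarith, by linarith⟩

end Paths

end LTS

namespace LTS

/-! ### A measurable Lipschitz modulus with rapidly decaying tails. -/

section Moduli

/-- With `u = log (x / C)`, the exponent `u ^ η` eventually exceeds `(k + 1) * u` because `η > 1`.
-/
lemma eventually_exp_neg_abs_log_rpow_le {η C : ℝ} (hη : 1 < η) (hC : 0 < C) (k : ℕ) :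
    ∀ᶠ x : ℝ in atTop, Real.exp (-(|Real.log (x / C)| ^ η)) ≤ (x ^ k)⁻¹ := by
  have hu : Tendsto (fun x : ℝ => Real.log (x / C)) atTop atTop :=
    Real.tendsto_log_atTop.comp (tendsto_id.atTop_div_const hC)
  have hpow : Tendsto (fun u : ℝ => u ^ (η - 1)) atTop atTop :=
    tendsto_rpow_atTop (by linarith)
  filter_upwards [eventually_gt_atTop 0, hu.eventually_gt_atTop 0,
    hu.eventually_ge_atTop (k * Real.log C), (hpow.comp hu).eventually_ge_atTop (k + 1)]
    with x hx0 hu0 hu1 hu2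
  set u := Real.log (x / C) with hudef
  have hlog : Real.log x = u + Real.log C := by
    rw [hudef, Real.log_div hx0.ne' hC.ne']; ring
  have h1 : u ^ η = u ^ (η - 1) * u := by
    rw [← Real.rpow_add_one hu0.ne']; ring_nf
  have h2 : (k + 1) * u ≤ u ^ (η - 1) * u := mul_le_mul_of_nonneg_right hu2 hu0.le
  have h3 : (x ^ k)⁻¹ = Real.exp (-(k * Real.log x)) := by
    rw [Real.exp_neg, ← Real.log_pow, Real.exp_log (by positivity)]
  rw [h3, abs_of_pos hu0, h1, hlog]
  refine Real.exp_le_exp.2 ?_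
  nlinarith

variable {Y : Type*} {E J : Type*} [NormedAddCommGroup E]

/-- The Lipschitz modulus of `x ↦ log (q x y)` at scales below `r`, over the points of `D`. -/
noncomputable def lipModulus (q : E → Y → ℝ) (D : Set E) (r : ℝ) (y : Y) : ℝ≥0∞ :=
  ⨆ p : {p : D × D // 0 < dist (p.1 : E) p.2 ∧ dist (p.1 : E) p.2 < r},
    ENNReal.ofReal (|Real.log (q p.1.1 y) - Real.log (q p.1.2 y)| / dist (p.1.1 : E) p.1.2)

variable {q : E → Y → ℝ} {D K : Set E} {r : ℝ}

lemma measurable_lipModulus [MeasurableSpace Y] (hD : D.Countable) (hq : ∀ x ∈ D, Measurable (q x)) :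
    Measurable (lipModulus q D r) := by
  have : Countable D := hD.to_subtype
  refine Measurable.iSup fun p => ?_
  have h1 := hq _ p.1.1.2
  have h2 := hq _ p.1.2.2
  have h3 : Measurable fun y => Real.log (q p.1.1 y) - Real.log (q p.1.2 y) :=
    (Real.measurable_log.comp h1).sub (Real.measurable_log.comp h2)
  exact ((continuous_abs.measurable.comp h3).div_const _).ennreal_ofReal

lemma abs_log_sub_log_le_lipModulus (hD : K ⊆ closure D) {y : Y} (hDK : D ⊆ K)
    (hW : lipModulus q D r y ≠ ∞) (hcont : ContinuousOn (fun x => Real.log (q x y)) K) {x x' : E}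
    (hx : x ∈ K) (hx' : x' ∈ K) (hr : dist x x' < r) :
    |Real.log (q x y) - Real.log (q x' y)| ≤ (lipModulus q D r y).toReal * dist x x' := by
  obtain ⟨u, huD, hu⟩ := mem_closure_iff_seq_limit.1 (hD hx)
  obtain ⟨v, hvD, hv⟩ := mem_closure_iff_seq_limit.1 (hD hx')
  have hdist : Tendsto (fun n => dist (u n) (v n)) atTop (𝓝 (dist x x')) := hu.dist hv
  have hlu : Tendsto (fun n => Real.log (q (u n) y)) atTop (𝓝 (Real.log (q x y))) :=
    (hcont x hx).tendsto.comp
      (tendsto_nhdsWithin_iff.2 ⟨hu, Eventually.of_forall fun n => hDK (huD n)⟩)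
  have hlv : Tendsto (fun n => Real.log (q (v n) y)) atTop (𝓝 (Real.log (q x' y))) :=
    (hcont x' hx').tendsto.comp
      (tendsto_nhdsWithin_iff.2 ⟨hv, Eventually.of_forall fun n => hDK (hvD n)⟩)
  refine le_of_tendsto_of_tendsto (hlu.sub hlv).abs (hdist.const_mul _) ?_
  filter_upwards [hdist.eventually_lt_const hr] with n hn
  rcases dist_nonneg.eq_or_lt (a := 0) (b := dist (u n) (v n)) with h0 | h0
  · rw [dist_eq_zero.1 h0.symm]
    simp
  · have h1 : ENNReal.ofReal (|Real.log (q (u n) y) - Real.log (q (v n) y)| / dist (u n) (v n)) ≤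
        lipModulus q D r y :=
      le_iSup (fun p : {p : D × D // 0 < dist (p.1 : E) p.2 ∧ dist (p.1 : E) p.2 < r} =>
        ENNReal.ofReal (|Real.log (q p.1.1 y) - Real.log (q p.1.2 y)| / dist (p.1.1 : E) p.1.2))
        ⟨(⟨u n, huD n⟩, ⟨v n, hvD n⟩), h0, hn⟩
    rw [ENNReal.ofReal_le_iff_le_toReal hW, div_le_iff₀ h0] at h1
    exact h1

variable [InnerProductSpace ℝ E] [CompleteSpace E]

lemma lipModulus_le {C : ℝ≥0} {σ : ℝ} {y : Y} (hDK : D ⊆ K)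
    (hK : ∀ x ∈ K, ∀ y ∈ K, dist x y < r →
      ∃ p : ℝ → E, p 0 = x ∧ p 1 = y ∧ (∀ s ∈ Set.Icc (0 : ℝ) 1, p s ∈ K) ∧
        LipschitzOnWith (C * nndist x y) p (Set.Icc (0 : ℝ) 1))
    {φ : E → ℝ} {G : E → E} (hφ : ∀ x ∈ K, HasGradientWithinAt φ (G x) K x)
    (hφq : ∀ x ∈ K, ∀ x' ∈ K, |φ x - φ x'| = |Real.log (q x y) - Real.log (q x' y)|)
    (hG : ∀ x ∈ K, ‖G x‖ ≤ σ) : lipModulus q D r y ≤ ENNReal.ofReal (C * σ) := by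
  refine iSup_le fun p => ENNReal.ofReal_le_ofReal ?_
  have h1 := hDK p.1.1.2
  have h2 := hDK p.1.2.2
  rw [div_le_iff₀ p.2.1, ← hφq _ h1 _ h2]
  exact abs_sub_le_of_hasGradientWithinAt hφ hG hK h1 h2 p.2.2

/-- The gradients and their tail bounds depend on `j`, but a single modulus must serve for all `j`.
It exists because the increments of `φ j` in the parameter are those of `log q` up to sign, whatever
`j` is: the modulus is defined from `q` alone, over a countable dense set to make it measurable, and
the gradient for each `j` bounds it. -/
lemma exists_modulus [MeasurableSpace Y] {μ : Measure Y} (hKc : IsCompact K) (hKq : LocallyQuasiconvex K)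
    (hq : ∀ x ∈ K, Measurable (q x)) {I : Set J} (hI : I.Nonempty) {ν : J → Measure Y}
    (hν : ∀ j ∈ I, ν j ≪ μ) (hμ : ∀ j ∈ I, μ ≪ ν j) {φ : J → E → Y → ℝ}
    (hφ : ∀ j ∈ I, ∀ x x' y, |φ j x y - φ j x' y| = |Real.log (q x y) - Real.log (q x' y)|)
    {η x₀ : ℝ} (hη : 1 < η) (hx₀ : 0 < x₀)
    (hgrad : ∀ j ∈ I, ∃ G : E → Y → E,
      (∀ᵐ y ∂μ, ∀ x ∈ K, HasGradientWithinAt (fun x' => φ j x' y) (G x y) K x) ∧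
      ∀ x : ℝ, x₀ < x → ν j {y | ENNReal.ofReal x < ⨆ x ∈ K, ‖G x y‖ₑ} ≤
        ENNReal.ofReal (Real.exp (-(|Real.log x| ^ η)))) :
    ∃ (W : Y → ℝ≥0∞) (r : ℝ), Measurable W ∧ 0 < r ∧
      (∀ᵐ y ∂μ, W y ≠ ∞ ∧ ∀ x ∈ K, ∀ x' ∈ K, dist x x' < r →
        |Real.log (q x y) - Real.log (q x' y)| ≤ (W y).toReal * dist x x') ∧
      ∀ k : ℕ, ∃ x₁ : ℝ, 0 < x₁ ∧ ∀ x, x₁ ≤ x → ∀ j ∈ I,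
        ν j {y | ENNReal.ofReal x < W y} ≤ ENNReal.ofReal ((x ^ k)⁻¹) := by
  obtain ⟨C₀, r, hr, hKp⟩ := hKq
  -- Makes the constant positive, as it will be divided by.
  set C : ℝ≥0 := max C₀ 1 with hCdef
  have hC1 : (1 : ℝ≥0) ≤ C := le_max_right _ _
  have hC : (0 : ℝ) < C := lt_of_lt_of_le one_pos (by exact_mod_cast hC1)
  have hKp' : ∀ x ∈ K, ∀ y ∈ K, dist x y < r →
      ∃ p : ℝ → E, p 0 = x ∧ p 1 = y ∧ (∀ s ∈ Set.Icc (0 : ℝ) 1, p s ∈ K) ∧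
        LipschitzOnWith (C * nndist x y) p (Set.Icc (0 : ℝ) 1) := by
    intro x hx y hy hxy
    obtain ⟨p, h0, h1, h2, h3⟩ := hKp x hx y hy hxy
    exact ⟨p, h0, h1, h2, h3.weaken (mul_le_mul_left (le_max_left _ _) _)⟩
  obtain ⟨D, hDK, hDc, hDd⟩ := hKc.isSeparable.exists_countable_dense_subset
  have htail : ∀ x : ℝ, x₀ < x / C → ∀ j ∈ I, ν j {y | ENNReal.ofReal x < lipModulus q D r y} ≤
      ENNReal.ofReal (Real.exp (-(|Real.log (x / C)| ^ η))) := by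
    intro x hx j hj
    obtain ⟨G, hG, hGt⟩ := hgrad j hj
    refine le_trans (measure_mono_ae ?_) (hGt (x / C) hx)
    filter_upwards [(hν j hj).ae_le hG] with y hy hlt
    by_contra hcon
    refine not_le.2 (show ENNReal.ofReal x < lipModulus q D r y from hlt) ?_
    have hsup : ⨆ x ∈ K, ‖G x y‖ₑ ≤ ENNReal.ofReal (x / C) := not_lt.1 hcon
    have hx0 : 0 ≤ x / C := (hx₀.trans hx).le
    have hσ : ∀ z ∈ K, ‖G z y‖ ≤ x / C := by
      intro z hz
      have h1 := (le_iSup₂ (f := fun z (_ : z ∈ K) => ‖G z y‖ₑ) z hz).trans hsup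
      rwa [← ofReal_norm, ENNReal.ofReal_le_ofReal_iff hx0] at h1
    have := lipModulus_le (q := q) (y := y) hDK hKp' hy (fun x _ x' _ => hφ j hj x x' y) hσ
    rwa [mul_div_cancel₀ _ hC.ne'] at this
  have hrapid : ∀ k : ℕ, ∃ x₁ : ℝ, 0 < x₁ ∧ ∀ x, x₁ ≤ x → ∀ j ∈ I,
      ν j {y | ENNReal.ofReal x < lipModulus q D r y} ≤ ENNReal.ofReal ((x ^ k)⁻¹) := by
    intro k
    obtain ⟨x₁, hx₁⟩ := eventually_atTop.1 ((eventually_exp_neg_abs_log_rpow_le hη hC k).and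
      ((tendsto_id.atTop_div_const hC).eventually_gt_atTop x₀))
    refine ⟨max x₁ 1, by positivity, fun x hx j hj => ?_⟩
    obtain ⟨h1, h2⟩ := hx₁ x ((le_max_left _ _).trans hx)
    exact (htail x h2 j hj).trans (ENNReal.ofReal_le_ofReal h1)
  have hmeas : Measurable (lipModulus q D r) := measurable_lipModulus hDc fun x hx => hq x (hDK hx)
  refine ⟨lipModulus q D r, r, hmeas, hr, ?_, hrapid⟩
  obtain ⟨j, hj⟩ := hI
  -- Infinite values lie in every tail event, hence are null for `ν j`, and then for `μ` by absolute
  -- continuity.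
  have hfin : ∀ᵐ y ∂μ, lipModulus q D r y ≠ ∞ := by
    refine (hμ j hj).ae_le ?_
    obtain ⟨x₁, hx₁, hx⟩ := hrapid 1
    have hle : ∀ᶠ x : ℝ in atTop, ν j {y | ¬ lipModulus q D r y ≠ ∞} ≤
        ENNReal.ofReal ((x ^ 1)⁻¹) := by
      filter_upwards [eventually_ge_atTop x₁] with x hx'
      refine (measure_mono fun y hy => ?_).trans (hx x hx' j hj)
      have hy' : lipModulus q D r y = ∞ := not_not.1 hy
      rw [Set.mem_ofPred_eq, hy']
      exact ENNReal.ofReal_lt_top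
    have hlim : Tendsto (fun x : ℝ => ENNReal.ofReal ((x ^ 1)⁻¹)) atTop (𝓝 0) := by
      rw [← ENNReal.ofReal_zero]
      refine ENNReal.tendsto_ofReal ?_
      simpa using tendsto_inv_atTop_zero (𝕜 := ℝ)
    exact le_antisymm (ge_of_tendsto hlim hle) zero_le
  obtain ⟨G, hG, -⟩ := hgrad j hj
  filter_upwards [hfin, hG] with y hy1 hy2
  refine ⟨hy1, fun x hx x' hx' hxx' => abs_log_sub_log_le_lipModulus hDd hDK hy1 ?_ hx hx' hxx'⟩
  have hc : ContinuousOn (fun x' => φ j x' y) K := fun x hx => (hy2 x hx).continuousWithinAt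
  intro z hz
  rw [ContinuousWithinAt, tendsto_iff_dist_tendsto_zero]
  have h1 := tendsto_iff_dist_tendsto_zero.1 (hc z hz)
  simpa only [Real.dist_eq, hφ j hj] using h1

end Moduli

end LTS

namespace LTS

/-! ### Kullback-Leibler divergence and Hellinger distance in terms of densities. -/

section Densities

variable {Y : Type*} [MeasurableSpace Y] {μ : Measure Y} {p q : Y → ℝ}

lemma isProbabilityMeasure_sampleLaw (hq : ∫⁻ y, ENNReal.ofReal (q y) ∂μ = 1) :
    IsProbabilityMeasure (sampleLaw μ q) :=
  ⟨by rw [sampleLaw, withDensity_apply _ MeasurableSet.univ, setLIntegral_univ, hq]⟩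

lemma llr_sampleLaw_ae_eq (hp : Measurable p) (hq : Measurable q)
    (hp0 : ∀ y, 0 < p y) (hq0 : ∀ y, 0 < q y) (hq1 : ∫⁻ y, ENNReal.ofReal (q y) ∂μ = 1) :
    llr (sampleLaw μ p) (sampleLaw μ q) =ᵐ[sampleLaw μ p]
      fun y => Real.log (p y) - Real.log (q y) := by
  have := isProbabilityMeasure_sampleLaw hq1
  have heq : sampleLaw μ p = (sampleLaw μ q).withDensity fun y => ENNReal.ofReal (p y / q y) := by
    rw [sampleLaw, sampleLaw, ← withDensity_mul _ (by fun_prop) (by fun_prop)]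
    congr 1
    funext y
    rw [Pi.mul_apply, ← ENNReal.ofReal_mul (hq0 y).le, mul_div_cancel₀ _ (hq0 y).ne']
  have h1 : (sampleLaw μ p).rnDeriv (sampleLaw μ q) =ᵐ[sampleLaw μ q]
      fun y => ENNReal.ofReal (p y / q y) := by
    conv_lhs => rw [heq]
    exact Measure.rnDeriv_withDensity _ (by fun_prop)
  have hac : sampleLaw μ p ≪ sampleLaw μ q := by
    rw [heq]
    exact withDensity_absolutelyContinuous _ _
  filter_upwards [hac.ae_le h1] with y hy
  rw [llr, hy, ENNReal.toReal_ofReal (div_pos (hp0 y) (hq0 y)).le,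
    Real.log_div (hp0 y).ne' (hq0 y).ne']

lemma integrable_and_klDiv_eq (hp : Measurable p) (hq : Measurable q)
    (hp0 : ∀ y, 0 < p y) (hq0 : ∀ y, 0 < q y) (hp1 : ∫⁻ y, ENNReal.ofReal (p y) ∂μ = 1)
    (hq1 : ∫⁻ y, ENNReal.ofReal (q y) ∂μ = 1)
    (hkl : InformationTheory.klDiv (sampleLaw μ p) (sampleLaw μ q) ≠ ∞) :
    Integrable (fun y => Real.log (p y) - Real.log (q y)) (sampleLaw μ p) ∧
      (InformationTheory.klDiv (sampleLaw μ p) (sampleLaw μ q)).toReal =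
        ∫ y, (Real.log (p y) - Real.log (q y)) ∂(sampleLaw μ p) := by
  have := isProbabilityMeasure_sampleLaw hp1
  have := isProbabilityMeasure_sampleLaw hq1
  obtain ⟨hac, hint⟩ := InformationTheory.klDiv_ne_top_iff.1 hkl
  have hae := llr_sampleLaw_ae_eq hp hq hp0 hq0 hq1
  refine ⟨hint.congr hae, ?_⟩
  rw [InformationTheory.toReal_klDiv_of_measure_eq hac (by simp)]
  exact integral_congr_ae hae

lemma lintegral_sqrt_sub_sq_add (hp : Measurable p) (hq : Measurable q)
    (hp0 : ∀ y, 0 < p y) (hq0 : ∀ y, 0 < q y) (hp1 : ∫⁻ y, ENNReal.ofReal (p y) ∂μ = 1)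
    (hq1 : ∫⁻ y, ENNReal.ofReal (q y) ∂μ = 1) :
    ∫⁻ y, ENNReal.ofReal ((√(p y) - √(q y)) ^ 2) ∂μ +
      2 * ∫⁻ y, ENNReal.ofReal (√(p y * q y)) ∂μ = 2 := by
  rw [← lintegral_const_mul _ (by fun_prop), ← lintegral_add_left (by fun_prop)]
  have h2 : (2 : ℝ≥0∞) = ENNReal.ofReal 2 := by simp
  calc _ = ∫⁻ y, (ENNReal.ofReal (p y) + ENNReal.ofReal (q y)) ∂μ := by
        refine lintegral_congr fun y => ?_
        have hp := hp0 y
        have hq := hq0 y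
        rw [h2, ← ENNReal.ofReal_mul (by norm_num), ← ENNReal.ofReal_add (by positivity)
          (by positivity), ← ENNReal.ofReal_add hp.le hq.le, Real.sqrt_mul hp.le]
        congr 1
        have h3 := Real.sq_sqrt hp.le
        have h4 := Real.sq_sqrt hq.le
        ring_nf
        linarith
    _ = 2 := by
        rw [lintegral_add_left (by fun_prop), hp1, hq1]
        norm_num

end Densities

section Affinity

variable {Y : Type*} [MeasurableSpace Y] {E F : Type*} [PseudoMetricSpace E] [PseudoMetricSpace F]
  {μ : Measure Y} {q : E → Y → ℝ} {K : Set E} {Z : Y → ℝ} {r : ℝ}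
  {h : E → Y → ℝ} {f : F → Y → ℝ} {Γ : Set E} {Θ : Set F} {Zh Zf : Y → ℝ} {rh rf : ℝ}

lemma RegularFamily.tendsto (H : RegularFamily μ q K Z r) {u : ℕ → E} (hu : ∀ n, u n ∈ K) {x : E}
    (hx : x ∈ K) (hux : Tendsto u atTop (𝓝 x)) (y : Y) :
    Tendsto (fun n => q (u n) y) atTop (𝓝 (q x y)) := by
  have h1 := H.continuous_sum (fun _ => y) {0}
  simp only [Finset.sum_singleton] at h1
  have h2 : Tendsto (fun n => (⟨u n, hu n⟩ : K)) atTop (𝓝 ⟨x, hx⟩) := tendsto_subtype_rng.2 hux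
  have h3 := (Real.continuous_exp.tendsto _).comp ((h1.tendsto ⟨x, hx⟩).comp h2)
  simpa [Function.comp_def, Real.exp_log (H.pos _ (hu _) y), Real.exp_log (H.pos _ hx y)] using h3

/-- Otherwise the affinities tend to 1 along a sequence of parameters, which by compactness may be
taken to converge. By Fatou's lemma the Hellinger distance vanishes at the limit, so the two laws
there would coincide. -/
lemma exists_affinity_le (Hh : RegularFamily μ h Γ Zh rh) (Hf : RegularFamily μ f Θ Zf rf)
    (hne : ∀ γ ∈ Γ, ∀ θ ∈ Θ, sampleLaw μ (f θ) ≠ sampleLaw μ (h γ)) :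
    ∃ ρ : ℝ, 0 < ρ ∧ ρ < 1 ∧ ∀ γ ∈ Γ, ∀ θ ∈ Θ,
      ∫⁻ y, ENNReal.ofReal (√(f θ y * h γ y)) ∂μ ≤ ENNReal.ofReal ρ := by
  by_contra! hcon
  have hex : ∀ n : ℕ, ∃ x : E × F, x.1 ∈ Γ ∧ x.2 ∈ Θ ∧ ENNReal.ofReal (1 - 1 / (n + 2)) <
      ∫⁻ y, ENNReal.ofReal (√(f x.2 y * h x.1 y)) ∂μ := by
    intro n
    have hn : (0 : ℝ) ≤ n := n.cast_nonneg
    obtain ⟨γ, hγ, θ, hθ, hlt⟩ := hcon (1 - 1 / (n + 2))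
      (by rw [sub_pos, div_lt_one (by positivity)]; linarith) (by
        have : (0 : ℝ) < 1 / (n + 2) := by positivity
        linarith)
    exact ⟨(γ, θ), hγ, hθ, hlt⟩
  choose u hu1 hu2 hu3 using hex
  obtain ⟨x, hx, ψ, hψ, hlim⟩ := (Hh.compact.prod Hf.compact).tendsto_subseq
    (x := u) fun n => ⟨hu1 n, hu2 n⟩
  set g : E × F → Y → ℝ≥0∞ := fun x y => ENNReal.ofReal ((√(f x.2 y) - √(h x.1 y)) ^ 2) with hg
  have hgm : ∀ x : E × F, x.1 ∈ Γ → x.2 ∈ Θ → Measurable (g x) := by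
    intro x hx1 hx2
    have := Hh.measurable _ hx1
    have := Hf.measurable _ hx2
    simp only [hg]
    fun_prop
  have hbound : ∀ n, ∫⁻ y, g (u n) y ∂μ ≤ ENNReal.ofReal (2 / (n + 2)) := by
    intro n
    have h1 := lintegral_sqrt_sub_sq_add (Hf.measurable _ (hu2 n)) (Hh.measurable _ (hu1 n))
      (Hf.pos _ (hu2 n)) (Hh.pos _ (hu1 n)) (Hf.lintegral_eq_one _ (hu2 n))
      (Hh.lintegral_eq_one _ (hu1 n))
    have hn : (0 : ℝ) ≤ n := n.cast_nonneg
    have hn1 : (1 : ℝ) / (n + 2) ≤ 1 := by rw [div_le_one (by positivity)]; linarith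
    have h2 : (2 : ℝ≥0∞) = ENNReal.ofReal 2 := by simp
    have h3 : ENNReal.ofReal (2 / (n + 2)) + 2 * ENNReal.ofReal (1 - 1 / (n + 2)) = 2 := by
      rw [h2, ← ENNReal.ofReal_mul (by norm_num), ← ENNReal.ofReal_add (by positivity)
        (by linarith)]
      congr 1
      ring
    refine (ENNReal.add_le_add_iff_right (a := 2 * ENNReal.ofReal (1 - 1 / (n + 2)))
      (ENNReal.mul_ne_top (by simp) ENNReal.ofReal_ne_top)).1 ?_
    rw [h3]
    calc _ ≤ ∫⁻ y, g (u n) y ∂μ + 2 * ∫⁻ y, ENNReal.ofReal (√(f (u n).2 y * h (u n).1 y)) ∂μ := by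
          gcongr
          exact (hu3 n).le
      _ = 2 := h1
  have hzero : ∫⁻ y, g x y ∂μ = 0 := by
    have hpt : ∀ y, liminf (fun n => g (u (ψ n)) y) atTop = g x y := by
      intro y
      refine Tendsto.liminf_eq (ENNReal.tendsto_ofReal ?_)
      have h1 := Hf.tendsto (fun n => hu2 (ψ n)) hx.2 ((continuous_snd.tendsto x).comp hlim) y
      have h2 := Hh.tendsto (fun n => hu1 (ψ n)) hx.1 ((continuous_fst.tendsto x).comp hlim) y
      exact (h1.sqrt.sub h2.sqrt).pow 2
    have hto : Tendsto (fun n => ENNReal.ofReal (2 / ((ψ n : ℝ) + 2))) atTop (𝓝 0) := by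
      rw [← ENNReal.ofReal_zero]
      refine ENNReal.tendsto_ofReal (Tendsto.comp (g := fun n : ℕ => 2 / ((n : ℝ) + 2)) ?_
        hψ.tendsto_atTop)
      exact (tendsto_natCast_atTop_atTop.atTop_add tendsto_const_nhds).const_div_atTop 2
    refine le_antisymm ?_ zero_le
    calc ∫⁻ y, g x y ∂μ = ∫⁻ y, liminf (fun n => g (u (ψ n)) y) atTop ∂μ := by simp only [hpt]
      _ ≤ liminf (fun n => ∫⁻ y, g (u (ψ n)) y ∂μ) atTop :=
          lintegral_liminf_le fun n => hgm _ (hu1 _) (hu2 _)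
      _ ≤ liminf (fun n => ENNReal.ofReal (2 / ((ψ n : ℝ) + 2))) atTop :=
          liminf_le_liminf (Eventually.of_forall fun n => hbound (ψ n))
      _ = 0 := hto.liminf_eq
  refine hne x.1 hx.1 x.2 hx.2 ?_
  refine withDensity_congr_ae ?_
  filter_upwards [(lintegral_eq_zero_iff (hgm x hx.1 hx.2)).1 hzero] with y hy
  have h1 : (√(f x.2 y) - √(h x.1 y)) ^ 2 = 0 :=
    le_antisymm (ENNReal.ofReal_eq_zero.1 hy) (sq_nonneg _)
  have h2 : √(f x.2 y) = √(h x.1 y) := sub_eq_zero.1 (pow_eq_zero_iff (by norm_num) |>.1 h1)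
  rw [← Real.sq_sqrt (Hf.pos _ hx.2 y).le, h2, Real.sq_sqrt (Hh.pos _ hx.1 y).le]

end Affinity

/-! ### Altering the densities on a null set. -/

section Regularization

variable {Y E F : Type*}

open Classical in
/-- The family `q`, with its values outside `S` replaced by `1`. -/
noncomputable def fillOne (S : Set Y) (q : E → Y → ℝ) (x : E) : Y → ℝ := S.piecewise (q x) 1

variable {S : Set Y} {q : E → Y → ℝ}

lemma fillOne_of_mem {y : Y} (hy : y ∈ S) (x : E) : fillOne S q x y = q x y := by
  simp [fillOne, hy]

lemma fillOne_of_notMem {y : Y} (hy : y ∉ S) (x : E) : fillOne S q x y = 1 := by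
  simp [fillOne, hy]

variable [MeasurableSpace Y] {μ : Measure Y} {K : Set E}

lemma sampleLaw_fillOne (hS : ∀ᵐ y ∂μ, y ∈ S) (x : E) :
    sampleLaw μ (fillOne S q x) = sampleLaw μ (q x) := by
  refine withDensity_congr_ae ?_
  filter_upwards [hS] with y hy
  rw [fillOne_of_mem hy]

lemma regularFamily_fillOne [PseudoMetricSpace E] (hq : IsDensityFamily μ q K)
    (hne : K.Nonempty) (hK : IsCompact K) (hcov : PolynomialCovering K) {W : Y → ℝ≥0∞}
    {r : ℝ} (hW : Measurable W) (hr : 0 < r) (hSm : MeasurableSet S) (hS : ∀ᵐ y ∂μ, y ∈ S)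
    (hpos : ∀ y ∈ S, ∀ x ∈ K, 0 < q x y)
    (hlip : ∀ y ∈ S, ∀ x ∈ K, ∀ x' ∈ K, dist x x' < r →
      |Real.log (q x y) - Real.log (q x' y)| ≤ (W y).toReal * dist x x') :
    RegularFamily μ (fillOne S q) K (fun y => (W y).toReal) r where
  nonempty := hne
  compact := hK
  covering := hcov
  measurable x hx := (hq.1 x hx).piecewise hSm measurable_one
  pos x hx y := by
    by_cases hy : y ∈ S
    · rw [fillOne_of_mem hy]; exact hpos y hy x hx
    · rw [fillOne_of_notMem hy]; exact one_pos
  lintegral_eq_one x hx := by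
    rw [← hq.2.1 x hx]
    refine lintegral_congr_ae ?_
    filter_upwards [hS] with y hy
    rw [fillOne_of_mem hy]
  measurable_modulus := hW.ennreal_toReal
  modulus_nonneg y := ENNReal.toReal_nonneg
  radius_pos := hr
  lipschitz y x hx x' hx' hxx' := by
    by_cases hy : y ∈ S
    · rw [fillOne_of_mem hy, fillOne_of_mem hy]; exact hlip y hy x hx x' hx' hxx'
    · rw [fillOne_of_notMem hy, fillOne_of_notMem hy, sub_self, abs_zero]
      exact mul_nonneg ENNReal.toReal_nonneg dist_nonneg

lemma rapidTails_fillOne (hS : ∀ᵐ y ∂μ, y ∈ S) {W : Y → ℝ≥0∞}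
    (hW : ∀ k : ℕ, ∃ x₁ : ℝ, 0 < x₁ ∧ ∀ x, x₁ ≤ x → ∀ γ ∈ K,
      sampleLaw μ (q γ) {y | ENNReal.ofReal x < W y} ≤ ENNReal.ofReal ((x ^ k)⁻¹)) :
    RapidTails μ (fillOne S q) K (fun y => (W y).toReal) := by
  intro k
  obtain ⟨x₁, hx₁, hx⟩ := hW k
  refine ⟨x₁, hx₁, fun x hxx γ hγ => ?_⟩
  rw [sampleLaw_fillOne hS]
  refine (measure_mono fun y hy => ?_).trans (hx x hxx γ hγ)
  have hy' : x < (W y).toReal := hy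
  exact ENNReal.ofReal_lt_iff_lt_toReal (hx₁.le.trans hxx)
    (fun hT => by rw [hT, ENNReal.toReal_top] at hy'; linarith) |>.2 hy'

/-- All exceptional null sets are gathered in a measurable one, off which the assumptions hold. On
it the densities are set to the constant 1, which is positive and trivially Lipschitz in the
parameter. Separation in divergence is used to exclude equal laws. -/
lemma exists_regularModel_fillOne {d₀ d₁ : ℕ} {Γ : Set (EuclideanSpace ℝ (Fin d₀))}
    {Θ : Set (EuclideanSpace ℝ (Fin d₁))} {h : EuclideanSpace ℝ (Fin d₀) → Y → ℝ}
    {f : EuclideanSpace ℝ (Fin d₁) → Y → ℝ} (hΓne : Γ.Nonempty) (hΘne : Θ.Nonempty)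
    (hh : IsDensityFamily μ h Γ) (hf : IsDensityFamily μ f Θ)
    (hsep : StrictlySeparated μ h f Γ Θ) (hΓ : IsCompact Γ) (hΘ : IsCompact Θ)
    (hΓq : LocallyQuasiconvex Γ) (hΘq : LocallyQuasiconvex Θ) (hgrad : GradientTails μ h f Γ Θ) :
    ∃ (S : Set Y) (Zh : Y → ℝ) (rh : ℝ) (Zf : Y → ℝ) (rf : ℝ), (∀ᵐ y ∂μ, y ∈ S) ∧
      RegularModel μ (fillOne S h) (fillOne S f) Γ Θ Zh rh Zf rf := by
  obtain ⟨η, x₀, hη, hx₀, hg1, hg2⟩ := hgrad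
  have hac : ∀ {d : ℕ} {K : Set (EuclideanSpace ℝ (Fin d))}
      {q : EuclideanSpace ℝ (Fin d) → Y → ℝ}, IsDensityFamily μ q K → ∀ x ∈ K,
      μ ≪ sampleLaw μ (q x) := by
    intro d K q hq x hx
    refine withDensity_absolutelyContinuous' (hq.1 x hx).ennreal_ofReal.aemeasurable ?_
    filter_upwards [hq.2.2] with y hy
    exact (ENNReal.ofReal_pos.2 (hy x hx)).ne'
  obtain ⟨Wf, rf, hWfm, hrf, hWf, hWft⟩ := exists_modulus (q := f) hΘ hΘq hf.1 hΓne
    (ν := fun γ => sampleLaw μ (h γ)) (fun γ _ => withDensity_absolutelyContinuous _ _) (hac hh)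
    (φ := fun γ θ y => logLR h f γ θ y)
    (fun γ _ θ θ' y => by simp only [logLR, sub_sub_sub_cancel_right]) hη hx₀ hg1
  obtain ⟨Wh, rh, hWhm, hrh, hWh, hWht⟩ := exists_modulus (q := h) hΓ hΓq hh.1 hΘne
    (ν := fun θ => sampleLaw μ (f θ)) (fun θ _ => withDensity_absolutelyContinuous _ _) (hac hf)
    (φ := fun θ γ y => logLR h f γ θ y)
    (fun θ _ γ γ' y => by
      simp only [logLR, sub_sub_sub_cancel_left]
      exact abs_sub_comm _ _) hη hx₀ hg2
  obtain ⟨t, hst, htm, ht0⟩ := exists_measurable_superset_of_null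
    (ae_iff.1 (((hh.2.2.and hf.2.2).and hWf).and hWh))
  have hS : ∀ᵐ y ∂μ, y ∈ tᶜ := measure_eq_zero_iff_ae_notMem.1 ht0
  have hmem := fun y (hy : y ∈ tᶜ) => not_not.1 fun hn => hy (hst hn)
  have Hh : RegularFamily μ (fillOne tᶜ h) Γ (fun y => (Wh y).toReal) rh :=
    regularFamily_fillOne hh hΓne hΓ (polynomialCovering_of_isBounded hΓ.isBounded) hWhm hrh
      htm.compl hS (fun y hy => (hmem y hy).1.1.1) fun y hy => (hmem y hy).2.2
  have Hf : RegularFamily μ (fillOne tᶜ f) Θ (fun y => (Wf y).toReal) rf :=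
    regularFamily_fillOne hf hΘne hΘ (polynomialCovering_of_isBounded hΘ.isBounded) hWfm hrf
      htm.compl hS (fun y hy => (hmem y hy).1.1.2) fun y hy => (hmem y hy).1.2.2
  refine ⟨tᶜ, _, rh, _, rf, hS, Hh, Hf, rapidTails_fillOne hS hWft, rapidTails_fillOne hS hWht,
    exists_affinity_le Hh Hf fun γ hγ θ hθ heq => ?_⟩
  obtain ⟨ε, hε, hε1, -⟩ := hsep
  have h1 := (hε1 θ hθ).trans_le (iInf₂_le γ hγ)
  rw [sampleLaw_fillOne hS, sampleLaw_fillOne hS] at heq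
  have := isProbabilityMeasure_sampleLaw (hh.2.1 γ hγ)
  rw [heq, InformationTheory.klDiv_self] at h1
  exact not_lt_zero h1

end Regularization

end LTS

namespace LTS

/-! ### Return to the original densities. -/

section Asymptotics

variable {Y : Type*} [MeasurableSpace Y] {E F : Type*} {μ : Measure Y} {h : E → Y → ℝ} {f : F → Y → ℝ} {Γ : Set E} {Θ : Set F} {S : Set Y}
  {Zh Zf : Y → ℝ} {rh rf : ℝ}

/-- Almost surely all of the countably many samples lie in `S`, where the altered densities agree
with the original ones. -/
lemma jointLaw_decideOne_fillOne {q : E → Y → ℝ} {x : E}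
    (hq : IsProbabilityMeasure (sampleLaw μ (q x))) (hS : ∀ᵐ y ∂μ, y ∈ S) (L : ℕ) (a b A B : ℝ) :
    jointLaw L μ (fillOne S q x) (decideOne L (fillOne S h) (fillOne S f) Γ Θ a b A B) =
      jointLaw L μ (q x) (decideOne L h f Γ Θ a b A B) := by
  have h1 : jointLaw L μ (fillOne S q x) = jointLaw L μ (q x) := by
    simp only [jointLaw, sampleLaw_fillOne hS]
  have h2 : ∀ᵐ ω ∂(jointLaw L μ (q x)), ∀ j, ω j ∈ S := by
    refine ae_all_iff.2 fun j => ?_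
    exact (measurePreserving_eval_infinitePi (fun _ : Fin L × ℕ => sampleLaw μ (q x))
      j).quasiMeasurePreserving.ae ((withDensity_absolutelyContinuous _ _).ae_le hS)
  rw [h1]
  refine measure_congr ?_
  filter_upwards [h2] with ω hω
  exact propext (mem_decideOne_congr (fun j γ _ => fillOne_of_mem (hω j) γ)
    fun j θ _ => fillOne_of_mem (hω j) θ)

/-- Finite divergence makes the log-likelihood ratio integrable with mean equal to the divergence,
and separation bounds these means below by `ε`, uniformly in `γ`. -/
lemma tendsto_log_jointLaw_decideOne_of_fillOne [PseudoMetricSpace E] [PseudoMetricSpace F]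
    (H : RegularModel μ (fillOne S h) (fillOne S f) Γ Θ Zh rh Zf rf) (hS : ∀ᵐ y ∂μ, y ∈ S)
    {θ : F} (hθ : θ ∈ Θ)
    (hkl : ∀ γ ∈ Γ, InformationTheory.klDiv (sampleLaw μ (f θ)) (sampleLaw μ (h γ)) ≠ ∞)
    {ε : ℝ} (hε : 0 < ε) (hsep : ENNReal.ofReal ε <
      ⨅ γ ∈ Γ, InformationTheory.klDiv (sampleLaw μ (f θ)) (sampleLaw μ (h γ)))
    {L : ℕ} (hL : 0 < L) {ι : Type*} {l : Filter ι} {a b A B : ι → ℝ}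
    (ha : Tendsto a l atTop) (hb : Tendsto b l atTop)
    (hab : l.IsBoundedUnder (· ≤ ·) (fun i => a i / b i))
    (hba : l.IsBoundedUnder (· ≤ ·) (fun i => b i / a i))
    (hA : Tendsto (fun i => A i / a i) l atTop) (hB : Tendsto (fun i => B i / b i) l atTop) :
    Tendsto (fun i => (⨆ γ ∈ Γ, ENNReal.log (jointLaw L μ (h γ)
      (decideOne L h f Γ Θ (a i) (b i) (A i) (B i)))) / ((-(A i) : ℝ) : EReal)) l (𝓝 1) := by
  have hint : ∀ γ ∈ Γ, Integrable (logLR (fillOne S h) (fillOne S f) γ θ)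
      (sampleLaw μ (fillOne S f θ)) ∧ ε ≤ ∫ y, logLR (fillOne S h) (fillOne S f) γ θ y
      ∂(sampleLaw μ (fillOne S f θ)) := by
    intro γ hγ
    have h1 : InformationTheory.klDiv (sampleLaw μ (fillOne S f θ)) (sampleLaw μ (fillOne S h γ)) =
        InformationTheory.klDiv (sampleLaw μ (f θ)) (sampleLaw μ (h γ)) := by
      rw [sampleLaw_fillOne hS, sampleLaw_fillOne hS]
    have h2 := hkl γ hγ
    obtain ⟨h3, h4⟩ := integrable_and_klDiv_eq (H.alt.measurable θ hθ) (H.null.measurable γ hγ)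
      (H.alt.pos θ hθ) (H.null.pos γ hγ) (H.alt.lintegral_eq_one θ hθ)
      (H.null.lintegral_eq_one γ hγ) (by rwa [h1])
    refine ⟨h3, ?_⟩
    have h5 := (hsep.trans_le (iInf₂_le γ hγ)).le
    rw [ENNReal.ofReal_le_iff_le_toReal h2, ← h1, h4] at h5
    exact h5
  obtain ⟨c₁, hc₁⟩ := hab
  obtain ⟨c₂, hc₂⟩ := hba
  rw [eventually_map] at hc₁ hc₂
  have hmain := H.tendsto_log_jointLaw_decideOne hL hθ (fun γ hγ => (hint γ hγ).1)
    ⟨ε, hε, fun γ hγ => (hint γ hγ).2⟩ (C := max (max c₁ c₂) 1) (by positivity) ha hb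
    (by
      filter_upwards [hc₁, hb.eventually_gt_atTop 0] with i h1 h2
      rw [div_le_iff₀ h2] at h1
      exact h1.trans (mul_le_mul_of_nonneg_right
        ((le_max_left _ _).trans (le_max_left _ _)) h2.le))
    (by
      filter_upwards [hc₂, ha.eventually_gt_atTop 0] with i h1 h2
      rw [div_le_iff₀ h2] at h1
      exact h1.trans (mul_le_mul_of_nonneg_right
        ((le_max_right _ _).trans (le_max_left _ _)) h2.le))
    hA (B := B) (by
      filter_upwards [hB.eventually_gt_atTop 0, hb.eventually_gt_atTop 0] with i h1 h2
      exact (div_pos_iff_of_pos_right h2).1 h1)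
  refine hmain.congr fun i => ?_
  congr 1
  refine iSup_congr fun γ => iSup_congr fun hγ => ?_
  have := H.null.isProbabilityMeasure hγ
  rw [sampleLaw_fillOne hS] at this
  rw [jointLaw_decideOne_fillOne this hS]

end Asymptotics

end LTS

theorem theorem2 {Y : Type*} [MeasurableSpace Y] (μ : Measure Y) [SigmaFinite μ]
    {L d₀ d₁ : ℕ} (hL : 0 < L)
    (Γ : Set (EuclideanSpace ℝ (Fin d₀))) (Θ : Set (EuclideanSpace ℝ (Fin d₁)))
    (h : EuclideanSpace ℝ (Fin d₀) → Y → ℝ) (f : EuclideanSpace ℝ (Fin d₁) → Y → ℝ)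
    (hΓne : Γ.Nonempty) (hΘne : Θ.Nonempty)
    (hh : LTS.IsDensityFamily μ h Γ) (hf : LTS.IsDensityFamily μ f Θ)
    (hsep : LTS.StrictlySeparated μ h f Γ Θ)
    (hsmooth : LTS.SmoothDivergences μ h f Γ Θ)
    (hΓ : IsCompact Γ) (hΘ : IsCompact Θ)
    (hΓq : LTS.LocallyQuasiconvex Γ) (hΘq : LTS.LocallyQuasiconvex Θ)
    (hgrad : LTS.GradientTails μ h f Γ Θ)
    {ι : Type*} (l : Filter ι) (a b A B : ι → ℝ)
    (ha : Tendsto a l atTop) (hb : Tendsto b l atTop)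
    (hab : l.IsBoundedUnder (· ≤ ·) (fun i => a i / b i))
    (hba : l.IsBoundedUnder (· ≤ ·) (fun i => b i / a i))
    (hA : Tendsto (fun i => A i / a i) l atTop) (hB : Tendsto (fun i => B i / b i) l atTop) :
    Tendsto (fun i =>
        (⨆ γ ∈ Γ, ENNReal.log (LTS.jointLaw L μ (h γ)
          (LTS.decideOne L h f Γ Θ (a i) (b i) (A i) (B i)))) / ((-(A i) : ℝ) : EReal))
      l (𝓝 1) ∧
    Tendsto (fun i =>
        (⨆ θ ∈ Θ, ENNReal.log (LTS.jointLaw L μ (f θ)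
          (LTS.decideZero L h f Γ Θ (a i) (b i) (A i) (B i)))) / ((-(B i) : ℝ) : EReal))
      l (𝓝 1) := by
  obtain ⟨S, Zh, rh, Zf, rf, hS, H⟩ := LTS.exists_regularModel_fillOne hΓne hΘne hh hf hsep hΓ hΘ
    hΓq hΘq hgrad
  obtain ⟨ε, hε, hsep1, hsep2⟩ := hsep
  obtain ⟨γ, hγ⟩ := hΓne
  obtain ⟨θ, hθ⟩ := hΘne
  refine ⟨LTS.tendsto_log_jointLaw_decideOne_of_fillOne H hS hθ
    (fun γ hγ => (hsmooth.1 γ hγ θ hθ).1) hε (hsep1 θ hθ) hL ha hb hab hba hA hB, ?_⟩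
  -- The second limit is the first one for exchanged hypotheses and thresholds. The decision events
  -- correspond once `a` and `b` are positive, hence only eventually along `l`.
  refine (LTS.tendsto_log_jointLaw_decideOne_of_fillOne H.swap hS hγ
    (fun θ hθ => (hsmooth.1 γ hγ θ hθ).2) hε (hsep2 γ hγ) hL hb ha hba hab hB hA).congr' ?_
  filter_upwards [ha.eventually_gt_atTop 0, hb.eventually_gt_atTop 0] with i hai hbi
  rw [LTS.decideOne_swap hai hbi]
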